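/- Let $\mathfrak g$ be an 8-dimensional real solvable Lie algebra that is algebraically rigid, i.e. the second Chevalley–Eilenberg cohomology space of its adjoint module vanishes: $\dim_{\mathbb R}H^2(\mathfrak g,\mathfrak g)=0$. An exterior torus of $\mathfrak g$ is an abelian subalgebra of the derivation algebra $\mathrm{Der}(\mathfrak g)$ all of whose elements are semisimple endomorphisms (equivalently, diagonalizable over $\mathbb C$), and the rank of $\mathfrak g$ is the largest dimension of an exterior torus (the common dimension of all maximal ones). Assume that some exterior torus of $\mathfrak g$ contains a derivation which is not diagonalizable over $\mathbb R$. Then the nilradical (largest nilpotent ideal) $\mathfrak n$ of $\mathfrak g$ satisfies $\dim_{\mathbb R}\mathfrak n\le 6$, and the rank of $\mathfrak g$ is not $1$. -/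

import Mathlib

namespace RigidLie

section

variable (K : Type*) [Field K] (L : Type*) [LieRing L] [LieAlgebra K L]

/-- The quotient `Z / B` of two subspaces `B ⊆ Z` of a vector space. -/
abbrev SubQuotient {K V : Type*} [Field K] [AddCommGroup V] [Module K V]
    (Z B : Submodule K V) : Type _ := Z ⧸ B.submoduleOf Z

theorem rank_subQuotient_eq_zero {K V : Type*} [Field K] [AddCommGroup V] [Module K V]
    (Z B : Submodule K V) : Module.rank K (SubQuotient Z B) = 0 ↔ Z ≤ B := by
  rw [rank_zero_iff, Submodule.Quotient.subsingleton_iff, Submodule.submoduleOf_eq_top]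

/-- The second Chevalley–Eilenberg cohomology space `H²(L, L)` of the adjoint module: 2-cocycles
modulo 2-coboundaries. -/
abbrev H2 : Type _ :=
  SubQuotient (V := LieModule.Cohomology.twoCochain K L L)
    (LieModule.Cohomology.twoCocycle K L L) (LinearMap.range (LieModule.Cohomology.d₁₂ K L L))

/-- `L` is algebraically rigid if `dim H²(L, L) = 0`. -/
def IsAlgebraicallyRigid : Prop := Module.rank K (H2 K L) = 0

/-- Algebraic rigidity means that every 2-cocycle is a 2-coboundary. -/
theorem isAlgebraicallyRigid_iff :
    IsAlgebraicallyRigid K L ↔ ∀ a ∈ LieModule.Cohomology.twoCocycle K L L,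
      ∃ f : L →ₗ[K] L, LieModule.Cohomology.d₁₂ K L L f = a :=
  rank_subQuotient_eq_zero (V := LieModule.Cohomology.twoCochain K L L) _ _

/-- The nilradical: the sum of all ideals that are nilpotent as Lie algebras. (Mathlib's
`LieAlgebra.maxNilpotentIdeal` is a different object: it asks the ideal to be nilpotent
as a module over the whole of `L`.) -/
def nilradical : LieIdeal K L := sSup {I : LieIdeal K L | LieRing.IsNilpotent I}

variable {K L}

/-- An exterior torus of derivations: an abelian subalgebra of `Der(L)` all of whose elements are
semisimple endomorphisms of `L`. -/
def IsExteriorTorus (t : LieSubalgebra K (LieDerivation K L L)) : Prop :=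
  IsLieAbelian t ∧ ∀ D ∈ t, Module.End.IsSemisimple (D : L →ₗ[K] L)

/-- An endomorphism is diagonalizable over the base field if the space is the sum of its
eigenspaces. -/
def IsDiagonalizable {V : Type*} [AddCommGroup V] [Module K V] (f : Module.End K V) : Prop :=
  ⨆ μ : K, Module.End.eigenspace f μ = ⊤

variable (K L)

/-- The rank: the largest dimension of an exterior torus of derivations of `L`. -/
noncomputable def rank : ℕ :=
  sSup {d : ℕ | ∃ t : LieSubalgebra K (LieDerivation K L L),
    IsExteriorTorus t ∧ Module.finrank K t = d}

variable {K L}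

/-- In finite dimension the supremum defining the rank is a genuine maximum: the dimensions of the
exterior tori are bounded. -/
theorem finrank_le_rank [FiniteDimensional K L] {t : LieSubalgebra K (LieDerivation K L L)}
    (ht : IsExteriorTorus t) : Module.finrank K t ≤ rank K L := by
  refine le_csSup ⟨Module.finrank K (Module.End K L), ?_⟩ ⟨t, ht, rfl⟩
  rintro _ ⟨s, -, rfl⟩
  let f : s →ₗ[K] Module.End K L :=
    { toFun := fun D => (D.1 : L →ₗ[K] L)
      map_add' := fun _ _ => rfl
      map_smul' := fun _ _ => rfl }
  refine LinearMap.finrank_le_finrank_of_injective (f := f) ?_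
  intro D E h
  apply Subtype.ext
  ext x
  exact LinearMap.congr_fun h x

end

end RigidLie

/-! Let M be the set of ad-nilpotent elements of 𝔤. By Lie's theorem over ℂ it is a nilpotent ideal
containing all brackets, and it contains the nilradical. Everything reduces to dim M ≤ 6.

The rank. If D is a nonzero semisimple derivation, then 𝔤 = ker D + im D and im D ⊆ M. For x in ker
D the semisimple part of ad x is again a derivation and commutes with D, so in rank one it is a
multiple cD. Hence M has codimension at most one, and dim M ≤ 6 excludes rank one in dimension 8.

Rigidity. Let α be a functional killing all brackets, with α(T) = 1. If d is a 1-cocycle of ker α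
with values in 𝔤, then α ∧ d is a 2-cocycle of 𝔤. Rigidity therefore makes ad T surjective, and by
finite dimension bijective, on H¹(ker α, 𝔤). If 𝔤 were nilpotent, this H¹ would vanish, which an
explicit cocycle β ⊗ w excludes; so dim M ≠ 8. If dim M = 7, take ker α = M: injectivity shows that
a derivation of 𝔤 is ad w on M, and that the derivations of M commuting with ad w (w outside M) lie
in ℝ ad w + ad M.

Dimension seven. It remains to see that, on a nilpotent N of dimension 7, a semisimple derivation τ
whose centralizer in Der N is ℝτ + ad N has only real eigenvalues. Complexify, and let σ be the
conjugation. Taking real parts of the eigenvalues of τ gives a derivation aτ + ad y, and nilpotency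
gives Re μ = aμ for each eigenvalue μ. A nonreal pair of conjugate eigenvalues forces a = 0, so the
spectrum is imaginary. Then T = -iτ has real weights and σ exchanges opposite weights. A derivation
commuting with T is aT + ad y, so its eigenvalues on vectors of opposite weights add up to zero. A
contradiction arises as soon as N has a grading, compatible with the weights, whose degrees on two
such vectors do not sum to zero (for instance a positive grading and a vector of weight zero). Since
7 is odd, there are 1, 2 or 3 positive weights with multiplicity, and ker T has dimension 5, 3 or 1.
In each case the Jacobi identity, nilpotency and σ restrict the brackets enough to exhibit a
grading. -/

namespace RigidLie

open Module TensorProduct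

/-! ### Lie's theorem and elements acting nilpotently -/

section LieTheorem

attribute [local instance 100] LieRing.ofAssociativeRing

/-- Over an algebraically closed field of characteristic zero, the nilpotency of the action of an
element of a solvable Lie algebra is detected by finitely or infinitely many characters. -/
theorem exists_characters_detecting_nilpotency {K : Type*} [Field K] [IsAlgClosed K] [CharZero K]
    {L : Type*} [LieRing L] [LieAlgebra K L] [LieAlgebra.IsSolvable L] (n : ℕ) :
    ∀ (V : Type*) [AddCommGroup V] [Module K V] [LieRingModule L V] [LieModule K L V]
      [FiniteDimensional K V], finrank K V = n →
      ∃ S : Set (Module.Dual K L), (∀ χ ∈ S, ∀ x y : L, χ ⁅x, y⁆ = 0) ∧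
        ∀ x, IsNilpotent (LieModule.toEnd K L V x) ↔ ∀ χ ∈ S, χ x = 0 := by
  induction n with
  | zero =>
    intro V _ _ _ _ _ hV
    have : Subsingleton V := finrank_zero_iff.mp hV
    refine ⟨∅, by simp, fun x => ⟨by simp, fun _ => ⟨1, Subsingleton.elim _ _⟩⟩⟩
  | succ n ih =>
    intro V _ _ _ _ _ hV
    have : Nontrivial V := nontrivial_of_finrank_pos (R := K) (by omega)
    obtain ⟨χ, hχ⟩ := LieModule.exists_nontrivial_weightSpace_of_isSolvable K L V
    obtain ⟨⟨v, hv⟩, hv0⟩ := exists_ne (0 : LieModule.weightSpace V χ)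
    rw [LieModule.mem_weightSpace] at hv
    have hv0' : v ≠ 0 := fun h => hv0 (Subtype.ext h)
    -- A common eigenvector spans N. An element acts nilpotently on V iff it does so on V/N and its
    -- character on N vanishes, so χ is the only character to add.
    let N : LieSubmodule K L V :=
      { Submodule.span K {v} with
        lie_mem := by
          intro x m hm
          obtain ⟨c, rfl⟩ := Submodule.mem_span_singleton.mp hm
          exact Submodule.mem_span_singleton.mpr ⟨c * χ x, by rw [lie_smul, hv, smul_smul]⟩ }
    have hN : ∀ m, m ∈ N ↔ ∃ c : K, c • v = m := fun m => Submodule.mem_span_singleton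
    have hfr : finrank K (V ⧸ N) = n := by
      have h1 := Submodule.finrank_quotient_add_finrank (N : Submodule K V)
      have h2 : finrank K (N : Submodule K V) = 1 := finrank_span_singleton hv0'
      have h3 : finrank K (V ⧸ N) = finrank K (V ⧸ (N : Submodule K V)) := rfl
      omega
    obtain ⟨S, hS, hS'⟩ := ih (V ⧸ N) hfr
    have hpow : ∀ (x : L) (k : ℕ) (m : V),
        LieSubmodule.Quotient.mk (N := N) ((LieModule.toEnd K L V x ^ k) m) =
          (LieModule.toEnd K L (V ⧸ N) x ^ k) (LieSubmodule.Quotient.mk m) := by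
      intro x k
      induction k with
      | zero => intro m; rfl
      | succ k ihk =>
        intro m
        rw [pow_succ, pow_succ, Module.End.mul_apply, Module.End.mul_apply, ihk]
        rfl
    refine ⟨insert χ S, ?_, fun x => ?_⟩
    · intro ψ hψ x y
      rcases hψ with rfl | hψ
      · have h1 : ψ ⁅x, y⁆ • v = 0 := by
          rw [← hv, lie_lie, hv, hv, lie_smul, lie_smul, hv, hv, smul_smul, smul_smul, mul_comm,
            sub_self]
        exact (smul_eq_zero.mp h1).resolve_right hv0'
      · exact hS ψ hψ x y
    · rw [Set.forall_mem_insert, ← hS']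
      constructor
      · rintro ⟨k, hk⟩
        refine ⟨?_, k, ?_⟩
        · have h1 : ∀ j : ℕ, (LieModule.toEnd K L V x ^ j) v = (χ x) ^ j • v := by
            intro j
            induction j with
            | zero => simp
            | succ j ihj =>
              rw [pow_succ, Module.End.mul_apply, LieModule.toEnd_apply_apply, hv, map_smul, ihj,
                smul_smul, pow_succ, mul_comm]
          have h2 := h1 k
          rw [hk, LinearMap.zero_apply] at h2
          exact eq_zero_of_pow_eq_zero ((smul_eq_zero.mp h2.symm).resolve_right hv0')
        · ext m
          obtain ⟨m, rfl⟩ := LieSubmodule.Quotient.surjective_mk' N m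
          change (LieModule.toEnd K L (V ⧸ N) x ^ k) (LieSubmodule.Quotient.mk m) = 0
          rw [← hpow, hk]
          rfl
      · rintro ⟨hχx, k, hk⟩
        refine ⟨k + 1, ?_⟩
        ext m
        have h1 := hpow x k m
        rw [hk] at h1
        have h2 : (LieModule.toEnd K L V x ^ k) m ∈ N :=
          (LieSubmodule.Quotient.mk_eq_zero N).mp h1
        obtain ⟨c, hc⟩ := (hN _).mp h2
        rw [pow_succ', Module.End.mul_apply, ← hc, LieModule.toEnd_apply_apply, lie_smul, hv, hχx]
        simp

/-- The elements of a real solvable Lie algebra acting nilpotently on a finite-dimensional module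
form a subspace that contains all brackets. -/
theorem exists_submodule_mem_iff_isNilpotent {L V : Type*} [LieRing L] [LieAlgebra ℝ L]
    [LieAlgebra.IsSolvable L] [AddCommGroup V] [Module ℝ V] [LieRingModule L V] [LieModule ℝ L V]
    [FiniteDimensional ℝ V] :
    ∃ S : Submodule ℝ L, (∀ x, x ∈ S ↔ IsNilpotent (LieModule.toEnd ℝ L V x)) ∧
      ∀ x y : L, ⁅x, y⁆ ∈ S := by
  obtain ⟨S, hS, hS'⟩ := exists_characters_detecting_nilpotency (K := ℂ) (L := ℂ ⊗[ℝ] L)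
    (finrank ℂ (ℂ ⊗[ℝ] V)) (ℂ ⊗[ℝ] V) rfl
  -- Nilpotency is unaffected by extension of scalars, so complex characters cut out a real
  -- subspace.
  have key : ∀ x : L, IsNilpotent (LieModule.toEnd ℝ L V x) ↔ ∀ χ ∈ S, χ (1 ⊗ₜ[ℝ] x) = 0 := by
    intro x
    have hbc : Function.Injective (Module.End.baseChangeHom ℝ ℂ V) :=
      LinearMap.baseChangeHom_injective ℝ V ℂ
    rw [← hS', ← IsNilpotent.map_iff hbc, LieModule.toEnd_baseChange]
    rfl
  refine ⟨{ carrier := {x | IsNilpotent (LieModule.toEnd ℝ L V x)}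
            add_mem' := ?_, zero_mem' := ?_, smul_mem' := ?_ }, fun x => Iff.rfl, fun x y => ?_⟩
  · intro a b ha hb
    rw [Set.mem_ofPred_eq, key] at *
    intro χ hχ
    rw [tmul_add, map_add, ha χ hχ, hb χ hχ, add_zero]
  · simp
  · intro c x hx
    rw [Set.mem_ofPred_eq, key] at *
    intro χ hχ
    have : (1 : ℂ) ⊗ₜ[ℝ] (c • x) = (c : ℂ) • ((1 : ℂ) ⊗ₜ[ℝ] x) := by
      rw [tmul_smul, smul_tmul', smul_tmul']
      simp
    rw [this, map_smul, hx χ hχ, smul_zero]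
  · change IsNilpotent (LieModule.toEnd ℝ L V ⁅x, y⁆)
    rw [key]
    intro χ hχ
    have : (1 : ℂ) ⊗ₜ[ℝ] ⁅x, y⁆ = ⁅(1 : ℂ) ⊗ₜ[ℝ] x, (1 : ℂ) ⊗ₜ[ℝ] y⁆ := by
      rw [LieAlgebra.ExtendScalars.bracket_tmul, one_mul]
    rw [this]
    exact hS χ hχ _ _

end LieTheorem

/-! ### Jordan decomposition of derivations -/

section Jordan

variable {K L : Type*} [Field K] [LieRing L] [LieAlgebra K L]

/-- The Leibniz rule for a linear endomorphism of a Lie algebra. -/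
def IsDer (f : Module.End K L) : Prop := ∀ x y, f ⁅x, y⁆ = ⁅f x, y⁆ + ⁅x, f y⁆

theorem IsDer.smul {f : Module.End K L} (c : K) (hf : IsDer f) : IsDer (c • f) := by
  intro x y
  rw [LinearMap.smul_apply, LinearMap.smul_apply, LinearMap.smul_apply, hf x y, smul_lie, lie_smul,
    smul_add]

theorem isDer_ad (x : L) : IsDer (LieAlgebra.ad K L x) := by
  intro y z
  rw [LieAlgebra.ad_apply, LieAlgebra.ad_apply, LieAlgebra.ad_apply, leibniz_lie]

theorem isDer_lieDerivation (D : LieDerivation K L L) : IsDer (D : L →ₗ[K] L) := by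
  intro x y
  have := D.apply_lie_eq_add x y
  rw [LieDerivation.coeFn_coe, this, add_comm]

/-- A Leibniz endomorphism as a Lie derivation. -/
def IsDer.toLieDerivation {f : Module.End K L} (hf : IsDer f) : LieDerivation K L L where
  toLinearMap := f
  leibniz' x y := by
    rw [hf x y, ← lie_skew (f x) y, sub_eq_add_neg, add_comm]

variable {B : Type*} [AddCommGroup B] [Module K B]

/-- On ker(ν + s) the operator s equals -ν, so there it is both semisimple and nilpotent, hence
zero. -/
theorem eq_zero_of_add_eq_zero_of_isSemisimple {ν s : Module.End K B} (hc : Commute ν s)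
    (hν : IsNilpotent ν) (hs : s.IsSemisimple) {β : B} (hβ : (ν + s) β = 0) : s β = 0 := by
  have hinv : ∀ γ ∈ LinearMap.ker (ν + s), s γ ∈ LinearMap.ker (ν + s) := by
    intro γ hγ
    rw [LinearMap.mem_ker] at *
    have := LinearMap.congr_fun (hc.symm.add_right (Commute.refl s)) γ
    rw [Module.End.mul_apply, Module.End.mul_apply, hγ, map_zero] at this
    exact this.symm
  let r : Module.End K (LinearMap.ker (ν + s)) := s.restrict hinv
  have hres : r.IsSemisimple := hs.restrict hinv
  have hpow : ∀ (k : ℕ) (γ : LinearMap.ker (ν + s)), ((r ^ k) γ : B) = ((-ν) ^ k) γ := by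
    intro k
    induction k with
    | zero => intro γ; rfl
    | succ k ih =>
      intro γ
      rw [pow_succ, pow_succ, Module.End.mul_apply, Module.End.mul_apply, ih]
      congr 1
      have := γ.2
      rw [LinearMap.mem_ker, LinearMap.add_apply] at this
      exact eq_neg_of_add_eq_zero_right this
  have hnil : IsNilpotent r := by
    obtain ⟨k, hk⟩ := hν.neg
    refine ⟨k, LinearMap.ext fun γ => Subtype.ext ?_⟩
    rw [hpow, hk]
    rfl
  have h0 := Module.End.eq_zero_of_isNilpotent_isSemisimple hnil hres
  exact congrArg Subtype.val (LinearMap.congr_fun h0 ⟨β, hβ⟩)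

/-- Only powers of the single element f have to be respected: pre-composition reverses products and
is not an algebra homomorphism. -/
theorem aeval_apply_of_map_pow (φ : Module.End K L →ₗ[K] Module.End K B) (f : Module.End K L)
    (h : ∀ n : ℕ, φ (f ^ n) = φ f ^ n) (p : Polynomial K) :
    Polynomial.aeval (φ f) p = φ (Polynomial.aeval f p) := by
  induction p using Polynomial.induction_on' with
  | add p q hp hq => rw [map_add, map_add, hp, hq, map_add]
  | monomial n a =>
    rw [Polynomial.aeval_monomial, Polynomial.aeval_monomial, ← h, ← Algebra.smul_def,
      ← Algebra.smul_def, map_smul]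

theorem isSemisimple_of_map_pow [FiniteDimensional K L]
    (φ : Module.End K L →ₗ[K] Module.End K B) {f : Module.End K L}
    (h : ∀ n : ℕ, φ (f ^ n) = φ f ^ n) (hf : f.IsSemisimple) : (φ f).IsSemisimple := by
  refine Module.End.isSemisimple_of_squarefree_aeval_eq_zero hf.minpoly_squarefree ?_
  rw [aeval_apply_of_map_pow φ f h, minpoly.aeval, map_zero]

theorem isNilpotent_of_map_pow (φ : Module.End K L →ₗ[K] Module.End K B) {f : Module.End K L}
    (h : ∀ n : ℕ, φ (f ^ n) = φ f ^ n) (hf : IsNilpotent f) : IsNilpotent (φ f) := by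
  obtain ⟨n, hn⟩ := hf
  exact ⟨n, by rw [← h, hn, map_zero]⟩

variable (K L) in
/-- The space of bilinear maps `L × L → L`. -/
def BilinMap : Type _ := L →ₗ[K] L →ₗ[K] L

instance : AddCommGroup (BilinMap K L) := inferInstanceAs (AddCommGroup (L →ₗ[K] L →ₗ[K] L))

instance : Module K (BilinMap K L) := inferInstanceAs (Module K (L →ₗ[K] L →ₗ[K] L))

/-- The underlying bilinear map. -/
def BilinMap.toLin (β : BilinMap K L) : L →ₗ[K] L →ₗ[K] L := β

/-- The value of a bilinear map. -/
def BilinMap.eval (β : BilinMap K L) (x y : L) : L := β.toLin x y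

theorem BilinMap.ext {β γ : BilinMap K L} (h : ∀ x y, β.eval x y = γ.eval x y) : β = γ :=
  LinearMap.ext₂ h

theorem BilinMap.eval_add_left (β : BilinMap K L) (x y z : L) :
    β.eval (x + y) z = β.eval x z + β.eval y z := LinearMap.map_add₂ β.toLin x y z

theorem BilinMap.eval_add_right (β : BilinMap K L) (x y z : L) :
    β.eval x (y + z) = β.eval x y + β.eval x z :=
  LinearMap.map_add (β.toLin x) y z

theorem BilinMap.eval_smul_left (β : BilinMap K L) (c : K) (x y : L) :
    β.eval (c • x) y = c • β.eval x y := LinearMap.map_smul₂ β.toLin c x y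

theorem BilinMap.eval_smul_right (β : BilinMap K L) (c : K) (x y : L) :
    β.eval x (c • y) = c • β.eval x y :=
  LinearMap.map_smul (β.toLin x) c y

variable (K L) in
/-- Post-composition of bilinear maps with an endomorphism. -/
def postComp : Module.End K L →ₗ[K] Module.End K (BilinMap K L) where
  toFun f :=
    { toFun := fun β => LinearMap.compr₂ β f
      map_add' := fun _ _ => BilinMap.ext fun _ _ => map_add f _ _
      map_smul' := fun _ _ => BilinMap.ext fun _ _ => map_smul f _ _ }
  map_add' _ _ := LinearMap.ext fun _ => BilinMap.ext fun _ _ => rfl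
  map_smul' _ _ := LinearMap.ext fun _ => BilinMap.ext fun _ _ => rfl

variable (K L) in
/-- Pre-composition of bilinear maps with an endomorphism in the first argument. -/
def preCompLeft : Module.End K L →ₗ[K] Module.End K (BilinMap K L) where
  toFun f :=
    { toFun := fun β => LinearMap.comp (M₃ := L →ₗ[K] L) β f
      map_add' := fun _ _ => rfl
      map_smul' := fun _ _ => rfl }
  map_add' _ _ := LinearMap.ext fun β => BilinMap.ext fun _ _ => β.eval_add_left _ _ _
  map_smul' _ _ := LinearMap.ext fun β => BilinMap.ext fun _ _ => β.eval_smul_left _ _ _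

variable (K L) in
/-- Pre-composition of bilinear maps with an endomorphism in the second argument. -/
def preCompRight : Module.End K L →ₗ[K] Module.End K (BilinMap K L) where
  toFun f :=
    { toFun := fun β => LinearMap.compl₂ β f
      map_add' := fun _ _ => rfl
      map_smul' := fun _ _ => rfl }
  map_add' _ _ := LinearMap.ext fun β => BilinMap.ext fun _ _ => β.eval_add_right _ _ _
  map_smul' _ _ := LinearMap.ext fun β => BilinMap.ext fun _ _ => β.eval_smul_right _ _ _

theorem postComp_pow (f : Module.End K L) (n : ℕ) : postComp K L (f ^ n) = postComp K L f ^ n := by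
  induction n with
  | zero => rfl
  | succ n ih => rw [pow_succ', pow_succ', ← ih]; rfl

theorem preCompLeft_pow (f : Module.End K L) (n : ℕ) :
    preCompLeft K L (f ^ n) = preCompLeft K L f ^ n := by
  induction n with
  | zero => rfl
  | succ n ih => rw [pow_succ, pow_succ', ← ih]; rfl

theorem preCompRight_pow (f : Module.End K L) (n : ℕ) :
    preCompRight K L (f ^ n) = preCompRight K L f ^ n := by
  induction n with
  | zero => rfl
  | succ n ih => rw [pow_succ, pow_succ', ← ih]; rfl

variable (K L) in
/-- The action of an endomorphism of a Lie algebra on bilinear maps. -/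
def bilinAction : Module.End K L →ₗ[K] Module.End K (BilinMap K L) :=
  postComp K L - preCompLeft K L - preCompRight K L

theorem bilinAction_eval (f : Module.End K L) (β : BilinMap K L) (x y : L) :
    (bilinAction K L f β).eval x y = f (β.eval x y) - β.eval (f x) y - β.eval x (f y) := rfl

variable (K L) in
/-- The Lie bracket as a bilinear map. -/
def lieBilin : BilinMap K L :=
  LinearMap.mk₂ K (fun x y : L => ⁅x, y⁆) (fun _ _ _ => add_lie _ _ _) (fun _ _ _ => smul_lie _ _ _)
    (fun _ _ _ => lie_add _ _ _) (fun _ _ _ => lie_smul _ _ _)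

/-- Derivations form the stabilizer of the bracket under the action of 𝔤𝔩(L) on bilinear maps. This
action preserves Jordan decompositions, so the stabilizer contains semisimple parts. -/
theorem isDer_iff_bilinAction (f : Module.End K L) :
    IsDer f ↔ bilinAction K L f (lieBilin K L) = 0 := by
  have h : ∀ x y, (bilinAction K L f (lieBilin K L)).eval x y = f ⁅x, y⁆ - ⁅f x, y⁆ - ⁅x, f y⁆ :=
    fun _ _ => rfl
  constructor
  · intro hf
    refine BilinMap.ext fun x y => ?_
    rw [h, hf x y, sub_sub, sub_self]
    rfl
  · intro h0 x y
    have h1 := h x y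
    rw [h0, sub_sub] at h1
    exact sub_eq_zero.mp h1.symm

theorem bilinAction_commute {f h : Module.End K L} (hfh : Commute f h) :
    Commute (bilinAction K L f) (bilinAction K L h) := by
  have e : ∀ v, f (h v) = h (f v) := fun v => LinearMap.congr_fun hfh v
  refine LinearMap.ext fun β => BilinMap.ext fun x y => ?_
  simp only [Module.End.mul_apply, bilinAction_eval, map_sub, e]
  abel

theorem bilinAction_isSemisimple [PerfectField K] [FiniteDimensional K L] {s : Module.End K L}
    (hs : s.IsSemisimple) : (bilinAction K L s).IsSemisimple := by
  have : FiniteDimensional K (BilinMap K L) :=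
    inferInstanceAs (FiniteDimensional K (L →ₗ[K] L →ₗ[K] L))
  have h1 := isSemisimple_of_map_pow (postComp K L) (postComp_pow s) hs
  have h2 := isSemisimple_of_map_pow (preCompLeft K L) (preCompLeft_pow s) hs
  have h3 := isSemisimple_of_map_pow (preCompRight K L) (preCompRight_pow s) hs
  have c12 : Commute (postComp K L s) (preCompLeft K L s) := rfl
  have c13 : Commute (postComp K L s) (preCompRight K L s) := rfl
  have c23 : Commute (preCompLeft K L s) (preCompRight K L s) := rfl
  exact (h1.sub_of_commute c12 h2).sub_of_commute (c13.sub_left c23) h3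

theorem bilinAction_isNilpotent {s : Module.End K L}
    (hs : IsNilpotent s) : IsNilpotent (bilinAction K L s) := by
  have h1 := isNilpotent_of_map_pow (postComp K L) (postComp_pow s) hs
  have h2 := isNilpotent_of_map_pow (preCompLeft K L) (preCompLeft_pow s) hs
  have h3 := isNilpotent_of_map_pow (preCompRight K L) (preCompRight_pow s) hs
  have c12 : Commute (postComp K L s) (preCompLeft K L s) := rfl
  have c13 : Commute (postComp K L s) (preCompRight K L s) := rfl
  have c23 : Commute (preCompLeft K L s) (preCompRight K L s) := rfl
  exact (c13.sub_left c23).isNilpotent_sub (c12.isNilpotent_sub h1 h2) h3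

/-- The semisimple part of a derivation is a derivation. -/
theorem IsDer.semisimple_part [PerfectField K] [FiniteDimensional K L] {d s ν : Module.End K L}
    (hd : IsDer d) (hsum : d = ν + s) (hc : Commute ν s) (hν : IsNilpotent ν)
    (hs : s.IsSemisimple) : IsDer s := by
  rw [isDer_iff_bilinAction] at hd ⊢
  have hsum' : bilinAction K L d = bilinAction K L ν + bilinAction K L s := by
    rw [hsum, map_add]
  exact eq_zero_of_add_eq_zero_of_isSemisimple (bilinAction_commute hc)
    (bilinAction_isNilpotent hν) (bilinAction_isSemisimple hs) (by rw [← hsum', hd])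

end Jordan

end RigidLie

namespace RigidLie

open Module

/-! ### The ideal of ad-nilpotent elements and its extension by a derivation -/

section NilpotentElements

attribute [local instance 100] LieRing.ofAssociativeRing

theorem coe_ad_pow_of_ideal {K L : Type*} [Field K] [LieRing L] [LieAlgebra K L]
    (I : LieIdeal K L) (x y : I) (k : ℕ) :
    (((LieAlgebra.ad K I x) ^ k) y : L) = ((LieAlgebra.ad K L (x : L)) ^ k) (y : L) := by
  induction k generalizing y with
  | zero => rfl
  | succ k ih =>
    rw [pow_succ, pow_succ, Module.End.mul_apply, Module.End.mul_apply, ih]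
    rfl

theorem isNilpotent_ad_of_mem_nilpotent_ideal {K L : Type*} [Field K] [LieRing L] [LieAlgebra K L]
    [FiniteDimensional K L] {I : LieIdeal K L} (hI : LieRing.IsNilpotent I) {x : L} (hx : x ∈ I) :
    IsNilpotent (LieAlgebra.ad K L x) := by
  obtain ⟨k, hk⟩ := (LieAlgebra.isNilpotent_iff_forall (R := K)).mp hI ⟨x, hx⟩
  -- One more application of ad x first moves an arbitrary element into I.
  refine ⟨k + 1, LinearMap.ext fun y => ?_⟩
  have hxy : ⁅x, y⁆ ∈ I := lie_mem_left K L I x y hx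
  have h := coe_ad_pow_of_ideal I ⟨x, hx⟩ ⟨⁅x, y⁆, hxy⟩ k
  rw [hk] at h
  rw [pow_succ, Module.End.mul_apply, LieAlgebra.ad_apply]
  exact h.symm

/-- In a real solvable Lie algebra the ad-nilpotent elements form a nilpotent ideal containing all
brackets. -/
theorem exists_ideal_mem_iff_isNilpotent_ad {g : Type*} [LieRing g] [LieAlgebra ℝ g]
    [FiniteDimensional ℝ g] [LieAlgebra.IsSolvable g] :
    ∃ M : LieIdeal ℝ g, (∀ x, x ∈ M ↔ IsNilpotent (LieAlgebra.ad ℝ g x)) ∧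
      (∀ x y : g, ⁅x, y⁆ ∈ M) ∧ LieRing.IsNilpotent M := by
  obtain ⟨S, hS, hS'⟩ := exists_submodule_mem_iff_isNilpotent (L := g) (V := g)
  let M : LieIdeal ℝ g := { S with lie_mem := fun {x m} _ => hS' x m }
  have hM : ∀ x, x ∈ M ↔ IsNilpotent (LieAlgebra.ad ℝ g x) := hS
  refine ⟨M, hM, hS', ?_⟩
  rw [LieAlgebra.isNilpotent_iff_forall (R := ℝ)]
  intro x
  obtain ⟨k, hk⟩ := (hM x).mp x.2
  refine ⟨k, LinearMap.ext fun y => Subtype.ext ?_⟩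
  rw [coe_ad_pow_of_ideal, hk]
  rfl

theorem isSolvable_of_ideal {K L : Type*} [Field K] [LieRing L] [LieAlgebra K L]
    (I : LieIdeal K L) [hI : LieAlgebra.IsSolvable I] (h : ∀ x y : L, ⁅x, y⁆ ∈ I) :
    LieAlgebra.IsSolvable L := by
  obtain ⟨k, hk⟩ := LieAlgebra.IsSolvable.solvable K I
  rw [LieIdeal.derivedSeries_eq_bot_iff] at hk
  have h1 : LieAlgebra.derivedSeriesOfIdeal K L 1 ⊤ ≤ I := by
    rw [LieAlgebra.derivedSeriesOfIdeal_succ, LieAlgebra.derivedSeriesOfIdeal_zero,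
      LieSubmodule.lie_le_iff]
    exact fun x _ y _ => h x y
  refine LieAlgebra.IsSolvable.mk (R := K) (k := k + 1) ?_
  rw [eq_bot_iff, ← hk]
  change LieAlgebra.derivedSeriesOfIdeal K L (k + 1) ⊤ ≤ _
  rw [LieAlgebra.derivedSeriesOfIdeal_add]
  exact LieAlgebra.derivedSeriesOfIdeal_mono h1 k

variable {K L : Type*} [Field K] [LieRing L] [LieAlgebra K L]

theorem IsDer.lie_ad {D : Module.End K L} (hD : IsDer D) (x : L) :
    ⁅D, LieAlgebra.ad K L x⁆ = LieAlgebra.ad K L (D x) := by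
  refine LinearMap.ext fun y => ?_
  change D ⁅x, y⁆ - ⁅x, D y⁆ = ⁅D x, y⁆
  rw [hD, add_sub_cancel_right]

theorem IsDer.lie_ad_add_smul {D : Module.End K L} (hD : IsDer D) (x y : L) (c d : K) :
    ⁅LieAlgebra.ad K L x + c • D, LieAlgebra.ad K L y + d • D⁆ =
      LieAlgebra.ad K L (⁅x, y⁆ + c • D y - d • D x) := by
  refine LinearMap.ext fun z => ?_
  change ⁅x, ⁅y, z⁆ + d • D z⁆ + c • D (⁅y, z⁆ + d • D z) -
    (⁅y, ⁅x, z⁆ + c • D z⁆ + d • D (⁅x, z⁆ + c • D z)) = ⁅⁅x, y⁆ + c • D y - d • D x, z⁆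
  simp only [map_add, map_smul, hD x z, hD y z, lie_add, lie_smul, add_lie, sub_lie, smul_lie,
    smul_add, lie_lie, smul_smul, mul_comm d c]
  abel

/-- The Lie algebra of endomorphisms `ad x + c D`. -/
def adExtension {D : Module.End K L} (hD : IsDer D) : LieSubalgebra K (Module.End K L) where
  carrier := {f | ∃ (x : L) (c : K), f = LieAlgebra.ad K L x + c • D}
  add_mem' := by
    rintro _ _ ⟨x, c, rfl⟩ ⟨y, d, rfl⟩
    exact ⟨x + y, c + d, by rw [map_add, add_smul, add_add_add_comm]⟩
  zero_mem' := ⟨0, 0, by rw [map_zero, zero_smul, add_zero]⟩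
  smul_mem' := by
    rintro a _ ⟨x, c, rfl⟩
    exact ⟨a • x, a * c, by rw [map_smul, smul_add, smul_smul]⟩
  lie_mem' := by
    rintro _ _ ⟨x, c, rfl⟩ ⟨y, d, rfl⟩
    exact ⟨⁅x, y⁆ + c • D y - d • D x, 0, by rw [hD.lie_ad_add_smul, zero_smul, add_zero]⟩

theorem isSolvable_adExtension [LieAlgebra.IsSolvable L] {D : Module.End K L} (hD : IsDer D) :
    LieAlgebra.IsSolvable (adExtension hD) := by
  let I : LieIdeal K (adExtension hD) :=
    { carrier := {f | ∃ x : L, (f : Module.End K L) = LieAlgebra.ad K L x}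
      add_mem' := by
        rintro f h ⟨x, hx⟩ ⟨y, hy⟩
        exact ⟨x + y, by rw [map_add, ← hx, ← hy]; rfl⟩
      zero_mem' := ⟨0, by rw [map_zero]; rfl⟩
      smul_mem' := by
        rintro a f ⟨x, hx⟩
        exact ⟨a • x, by rw [map_smul, ← hx]; rfl⟩
      lie_mem := by
        rintro ⟨_, ⟨x, c, rfl⟩⟩ f ⟨y, hy⟩
        refine ⟨⁅x, y⁆ + c • D y, ?_⟩
        rw [LieSubalgebra.coe_bracket, hy, add_lie, smul_lie, hD.lie_ad, map_add, map_smul,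
          LieHom.map_lie] }
  have hI : ∀ f : adExtension hD, f ∈ I ↔ ∃ x : L, (f : Module.End K L) = LieAlgebra.ad K L x :=
    fun _ => Iff.rfl
  let φ : I →ₗ⁅K⁆ (LieAlgebra.ad K L).range :=
    { toFun := fun f => ⟨f.1.1, by obtain ⟨x, hx⟩ := f.2; exact ⟨x, hx.symm⟩⟩
      map_add' := fun _ _ => rfl
      map_smul' := fun _ _ => rfl
      map_lie' := fun {_ _} => rfl }
  have hφ : Function.Injective φ := fun f h hfh =>
    Subtype.ext (Subtype.ext (congrArg (fun z => z.1) hfh))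
  have : LieAlgebra.IsSolvable I := hφ.lieAlgebra_isSolvable
  refine isSolvable_of_ideal I ?_
  rintro ⟨_, ⟨x, c, rfl⟩⟩ ⟨_, ⟨y, d, rfl⟩⟩
  rw [hI]
  exact ⟨⁅x, y⁆ + c • D y - d • D x, hD.lie_ad_add_smul x y c d⟩

/-- For a derivation `D` of a real solvable Lie algebra, the nilpotent endomorphisms of the form
`ad x + c D` form a subspace containing all `ad (D x)`. -/
theorem exists_submodule_nilpotent_adExtension {g : Type*} [LieRing g] [LieAlgebra ℝ g]
    [FiniteDimensional ℝ g] [LieAlgebra.IsSolvable g] {D : Module.End ℝ g} (hD : IsDer D) :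
    ∃ S : Submodule ℝ (Module.End ℝ g),
      (∀ f ∈ adExtension hD, f ∈ S ↔ IsNilpotent f) ∧
        ∀ x, LieAlgebra.ad ℝ g (D x) ∈ S := by
  have := isSolvable_adExtension hD
  obtain ⟨S, hS, hS'⟩ := exists_submodule_mem_iff_isNilpotent (L := adExtension hD) (V := g)
  refine ⟨S.map (adExtension hD).toSubmodule.subtype, fun f hf => ?_, fun x => ?_⟩
  · constructor
    · rintro ⟨h, hh, rfl⟩
      exact (hS h).mp hh
    · intro h
      exact ⟨⟨f, hf⟩, (hS ⟨f, hf⟩).mpr h, rfl⟩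
  -- ad (D x) is the bracket of D and ad x inside a solvable algebra, and brackets act nilpotently.
  · have h1 : D ∈ adExtension hD := ⟨0, 1, by rw [map_zero, one_smul, zero_add]⟩
    have h2 : LieAlgebra.ad ℝ g x ∈ adExtension hD := ⟨x, 0, by rw [zero_smul, add_zero]⟩
    exact ⟨⁅(⟨D, h1⟩ : adExtension hD), ⟨_, h2⟩⁆, hS' _ _, hD.lie_ad x⟩

end NilpotentElements

end RigidLie

/-! ### Exterior tori and the codimension of the nilradical -/

namespace RigidLie

open Module

/-- The kernel has an f-stable complement, and f is injective on it, hence bijective by finite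
dimension. -/
theorem exists_ker_add_range_of_isSemisimple {K V : Type*} [Field K] [AddCommGroup V] [Module K V]
    [FiniteDimensional K V] {f : Module.End K V} (hf : f.IsSemisimple) (x : V) :
    ∃ k y, f k = 0 ∧ x = k + f y := by
  obtain ⟨q, hq, hc⟩ := Module.End.isSemisimple_iff.mp hf (LinearMap.ker f)
    (fun v hv => by
      rw [Submodule.mem_comap, LinearMap.mem_ker]
      rw [LinearMap.mem_ker] at hv
      rw [hv, map_zero])
  obtain ⟨k, hk, r, hr, rfl⟩ := Submodule.mem_sup.mp (hc.sup_eq_top ▸ Submodule.mem_top : x ∈ _)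
  have hinj : Function.Injective (f.restrict hq) := by
    rw [← LinearMap.ker_eq_bot, LinearMap.ker_eq_bot']
    intro v hv
    have h1 : (v : V) ∈ LinearMap.ker f ⊓ q := ⟨congrArg Subtype.val hv, v.2⟩
    rw [hc.inf_eq_bot] at h1
    exact Subtype.ext h1
  obtain ⟨y, hy⟩ := LinearMap.injective_iff_surjective.mp hinj ⟨r, hr⟩
  exact ⟨k, y, hk, by
    have h1 : f y = r := congrArg Subtype.val hy
    rw [h1]⟩

section Torus

variable {K L : Type*} [Field K] [LieRing L] [LieAlgebra K L]

theorem lieDerivation_lie_eq_zero {D E : LieDerivation K L L} (h : ∀ x, D (E x) = E (D x)) :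
    ⁅D, E⁆ = 0 := by
  ext x
  rw [LieDerivation.lie_apply, h, sub_self]
  rfl

theorem lie_smul_add_smul_eq_zero {D E : LieDerivation K L L} (h : ∀ x, D (E x) = E (D x))
    (a b c d : K) : ⁅a • D + b • E, c • D + d • E⁆ = 0 := by
  refine lieDerivation_lie_eq_zero fun x => ?_
  simp only [LieDerivation.add_apply, LieDerivation.smul_apply, map_add, map_smul, h, smul_add,
    smul_smul, mul_comm]
  abel

/-- The exterior torus spanned by two commuting semisimple derivations. -/
def pairTorus (D E : LieDerivation K L L) (h : ∀ x, D (E x) = E (D x)) :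
    LieSubalgebra K (LieDerivation K L L) where
  carrier := {F | ∃ a b : K, F = a • D + b • E}
  add_mem' := by
    rintro _ _ ⟨a, b, rfl⟩ ⟨c, d, rfl⟩
    exact ⟨a + c, b + d, by rw [add_smul, add_smul, add_add_add_comm]⟩
  zero_mem' := ⟨0, 0, by rw [zero_smul, zero_smul, add_zero]⟩
  smul_mem' := by
    rintro c _ ⟨a, b, rfl⟩
    exact ⟨c * a, c * b, by rw [smul_add, smul_smul, smul_smul]⟩
  lie_mem' := by
    rintro _ _ ⟨a, b, rfl⟩ ⟨c, d, rfl⟩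
    exact ⟨0, 0, by rw [lie_smul_add_smul_eq_zero h, zero_smul, zero_smul, add_zero]⟩

theorem isExteriorTorus_pairTorus [PerfectField K] [FiniteDimensional K L]
    {D E : LieDerivation K L L} (h : ∀ x, D (E x) = E (D x))
    (hD : Module.End.IsSemisimple (D : L →ₗ[K] L)) (hE : Module.End.IsSemisimple (E : L →ₗ[K] L)) :
    IsExteriorTorus (pairTorus D E h) := by
  refine ⟨⟨?_⟩, ?_⟩
  · rintro ⟨_, ⟨a, b, rfl⟩⟩ ⟨_, ⟨c, d, rfl⟩⟩
    exact Subtype.ext (lie_smul_add_smul_eq_zero h a b c d)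
  · rintro _ ⟨a, b, rfl⟩
    let D' : Module.End K L := (D : L →ₗ[K] L)
    let E' : Module.End K L := (E : L →ₗ[K] L)
    have hc : Commute D' E' := LinearMap.ext h
    exact (Module.End.IsSemisimple_smul a hD).add_of_commute
      ((hc.smul_left a).smul_right b) (Module.End.IsSemisimple_smul b hE)

/-- If all exterior tori have dimension at most one, a semisimple derivation commuting with a
nonzero semisimple derivation `D` is a multiple of `D`. -/
theorem exists_eq_smul_of_rank_le_one [PerfectField K] [FiniteDimensional K L]
    (hr : rank K L ≤ 1) {D E : LieDerivation K L L} (h : ∀ x, D (E x) = E (D x))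
    (hD : Module.End.IsSemisimple (D : L →ₗ[K] L)) (hE : Module.End.IsSemisimple (E : L →ₗ[K] L))
    (hD0 : D ≠ 0) : ∃ c : K, E = c • D := by
  have h1 := (finrank_le_rank (isExteriorTorus_pairTorus h hD hE)).trans hr
  have hDm : D ∈ pairTorus D E h := ⟨1, 0, by rw [one_smul, zero_smul, add_zero]⟩
  have hEm : E ∈ pairTorus D E h := ⟨0, 1, by rw [one_smul, zero_smul, zero_add]⟩
  have hfin : FiniteDimensional K (pairTorus D E h) := by
    have : (pairTorus D E h).toSubmodule = Submodule.span K {D, E} := by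
      ext F
      rw [Submodule.mem_span_pair]
      exact ⟨fun ⟨a, b, h⟩ => ⟨a, b, h.symm⟩, fun ⟨a, b, h⟩ => ⟨a, b, h.symm⟩⟩
    change FiniteDimensional K (pairTorus D E h).toSubmodule
    rw [this]
    exact FiniteDimensional.span_of_finite K (Set.toFinite _)
  obtain ⟨v, hv⟩ := finrank_le_one_iff.mp h1
  obtain ⟨a, ha⟩ := hv ⟨D, hDm⟩
  obtain ⟨b, hb⟩ := hv ⟨E, hEm⟩
  have ha' : a • (v : LieDerivation K L L) = D := congrArg Subtype.val ha
  have hb' : b • (v : LieDerivation K L L) = E := congrArg Subtype.val hb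
  have ha0 : a ≠ 0 := by
    rintro rfl
    exact hD0 (by rw [← ha', zero_smul])
  refine ⟨b / a, ?_⟩
  calc E = b • (v : LieDerivation K L L) := hb'.symm
    _ = (b / a) • a • (v : LieDerivation K L L) := by rw [smul_smul, div_mul_cancel₀ _ ha0]
    _ = (b / a) • D := congrArg _ ha'

end Torus

/-- If the rank of a real solvable Lie algebra is at most one and there is a nonzero semisimple
derivation, then the ideal of ad-nilpotent elements has codimension at most one. -/
theorem finrank_le_finrank_add_one_of_rank_le_one {g : Type*} [LieRing g] [LieAlgebra ℝ g]
    [FiniteDimensional ℝ g] [LieAlgebra.IsSolvable g] (hr : rank ℝ g ≤ 1)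
    {D : LieDerivation ℝ g g} (hD : Module.End.IsSemisimple (D : g →ₗ[ℝ] g)) (hD0 : D ≠ 0)
    {M : LieIdeal ℝ g} (hM : ∀ x, x ∈ M ↔ IsNilpotent (LieAlgebra.ad ℝ g x)) :
    finrank ℝ g ≤ finrank ℝ M + 1 := by
  let D' : Module.End ℝ g := (D : g →ₗ[ℝ] g)
  have hder : IsDer D' := isDer_lieDerivation D
  obtain ⟨S, hS, hS'⟩ := exists_submodule_nilpotent_adExtension hder
  have hadm : ∀ x, LieAlgebra.ad ℝ g x ∈ adExtension hder := fun x =>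
    ⟨x, 0, by rw [zero_smul, add_zero]⟩
  have hMS : ∀ x, x ∈ M ↔ LieAlgebra.ad ℝ g x ∈ S := fun x => by rw [hM, hS _ (hadm x)]
  -- When D x = 0, ad x commutes with D, and so does its semisimple part, which is a derivation. The
  -- bound on the rank makes that part cD, and ad x - cD is the nilpotent part.
  have key : ∀ x, D' x = 0 → ∃ c : ℝ, LieAlgebra.ad ℝ g x - c • D' ∈ S := by
    intro x hx
    obtain ⟨ν, hν, s, hs, hνn, hss, hsum⟩ :=
      (LieAlgebra.ad ℝ g x).exists_isNilpotent_isSemisimple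
    have hcomm : Commute D' (LieAlgebra.ad ℝ g x) := LinearMap.ext fun y => by
      change D' ⁅x, y⁆ = ⁅x, D' y⁆
      rw [hder, hx, zero_lie, zero_add]
    have hνs : Commute ν s :=
      Algebra.commute_of_mem_adjoin_singleton_of_commute hs
        (Algebra.commute_of_mem_adjoin_self hν).symm
    have hDs : Commute D' s := Algebra.commute_of_mem_adjoin_singleton_of_commute hs hcomm
    have hsd : IsDer s := (isDer_ad x).semisimple_part hsum hνs hνn hss
    obtain ⟨c, hc⟩ := exists_eq_smul_of_rank_le_one hr (D := D) (E := hsd.toLieDerivation)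
      (fun y => LinearMap.congr_fun hDs y) hD hss hD0
    have hc' : s = c • D' := congrArg (fun F : LieDerivation ℝ g g => (F : g →ₗ[ℝ] g)) hc
    refine ⟨c, (hS _ ⟨x, -c, by rw [neg_smul, sub_eq_add_neg]⟩).mpr ?_⟩
    rw [← hc', hsum, add_sub_cancel_right]
    exact hνn
  by_cases hall : ∀ x, D' x = 0 → x ∈ M
  · have : M = ⊤ := by
      rw [eq_top_iff]
      intro x _
      obtain ⟨k, y, hk, rfl⟩ := exists_ker_add_range_of_isSemisimple hD x
      exact add_mem (hall k hk) ((hMS _).mpr (hS' y))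
    rw [this]
    change finrank ℝ g ≤ finrank ℝ (⊤ : Submodule ℝ g) + 1
    rw [finrank_top]
    omega
  · push Not at hall
    obtain ⟨x₁, hx₁, hx₁M⟩ := hall
    obtain ⟨c₁, hc₁⟩ := key x₁ hx₁
    have hc₁0 : c₁ ≠ 0 := by
      rintro rfl
      rw [zero_smul, sub_zero] at hc₁
      exact hx₁M ((hMS _).mpr hc₁)
    have h1 : finrank ℝ (g ⧸ M.toSubmodule) ≤ 1 := by
      refine finrank_le_one (M.toSubmodule.mkQ x₁) fun w => ?_
      obtain ⟨w, rfl⟩ := M.toSubmodule.mkQ_surjective w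
      obtain ⟨k, y, hk, rfl⟩ := exists_ker_add_range_of_isSemisimple hD w
      obtain ⟨c, hc⟩ := key k hk
      -- This ratio cancels the multiples of D in ad k - (c / c₁) ad x₁, leaving an element of S.
      refine ⟨c / c₁, ?_⟩
      rw [← map_smul]
      refine ((Submodule.Quotient.eq _).mpr ?_).symm
      change k + D' y - (c / c₁) • x₁ ∈ M
      rw [add_sub_right_comm]
      refine add_mem ?_ ((hMS _).mpr (hS' y))
      rw [hMS, map_sub, map_smul]
      have h2 : LieAlgebra.ad ℝ g k - (c / c₁) • LieAlgebra.ad ℝ g x₁ =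
          (LieAlgebra.ad ℝ g k - c • D') - (c / c₁) • (LieAlgebra.ad ℝ g x₁ - c₁ • D') := by
        rw [smul_sub, smul_smul, div_mul_cancel₀ _ hc₁0]
        abel
      rw [h2]
      exact sub_mem hc (S.smul_mem _ hc₁)
    have h2 := M.toSubmodule.finrank_quotient_add_finrank
    change finrank ℝ g ≤ finrank ℝ M.toSubmodule + 1
    omega

theorem nilradical_le {g : Type*} [LieRing g] [LieAlgebra ℝ g] [FiniteDimensional ℝ g]
    {M : LieIdeal ℝ g} (hM : ∀ x, x ∈ M ↔ IsNilpotent (LieAlgebra.ad ℝ g x)) :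
    nilradical ℝ g ≤ M :=
  sSup_le fun _ hI x hx => (hM x).mpr (isNilpotent_ad_of_mem_nilpotent_ideal hI hx)

end RigidLie

namespace RigidLie

open Module

/-! ### Rigidity and the first cohomology of a codimension-one ideal -/

section Rigidity

variable {K g : Type*} [Field K] [LieRing g] [LieAlgebra K g]

/-- Endomorphisms vanishing at `T` whose restriction to the kernel of `α` is a 1-cocycle with values
in the whole Lie algebra. -/
def relDer (α : g →ₗ[K] K) (T : g) : Submodule K (Module.End K g) where
  carrier := {d | d T = 0 ∧ ∀ x y, α x = 0 → α y = 0 → d ⁅x, y⁆ = ⁅d x, y⁆ + ⁅x, d y⁆}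
  add_mem' := by
    rintro d e ⟨hd, hd'⟩ ⟨he, he'⟩
    refine ⟨by rw [LinearMap.add_apply, hd, he, add_zero], fun x y hx hy => ?_⟩
    simp only [LinearMap.add_apply, hd' x y hx hy, he' x y hx hy, add_lie, lie_add]
    abel
  zero_mem' := ⟨rfl, fun x y _ _ => by simp⟩
  smul_mem' := by
    rintro c d ⟨hd, hd'⟩
    refine ⟨by rw [LinearMap.smul_apply, hd, smul_zero], fun x y hx hy => ?_⟩
    simp only [LinearMap.smul_apply, hd' x y hx hy, smul_lie, lie_smul, smul_add]

/-- Endomorphisms vanishing at `T` whose restriction to the kernel of `α` is inner. -/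
def relInner (α : g →ₗ[K] K) (T : g) : Submodule K (Module.End K g) where
  carrier := {d | d T = 0 ∧ ∃ w : g, ∀ y, α y = 0 → d y = ⁅w, y⁆}
  add_mem' := by
    rintro d e ⟨hd, w, hd'⟩ ⟨he, v, he'⟩
    refine ⟨by rw [LinearMap.add_apply, hd, he, add_zero], w + v, fun y hy => ?_⟩
    rw [LinearMap.add_apply, hd' y hy, he' y hy, add_lie]
  zero_mem' := ⟨rfl, 0, fun y _ => by simp⟩
  smul_mem' := by
    rintro c d ⟨hd, w, hd'⟩
    refine ⟨by rw [LinearMap.smul_apply, hd, smul_zero], c • w, fun y hy => ?_⟩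
    rw [LinearMap.smul_apply, hd' y hy, smul_lie]

variable (K) in
/-- The commutator with `ad T`, on endomorphisms. -/
def adComm (T : g) : Module.End K (Module.End K g) where
  toFun f := LieAlgebra.ad K g T * f - f * LieAlgebra.ad K g T
  map_add' _ _ := by rw [mul_add, add_mul, add_sub_add_comm]
  map_smul' _ _ := by rw [mul_smul_comm, smul_mul_assoc, smul_sub]; rfl

theorem adComm_apply (T : g) (f : Module.End K g) (y : g) :
    adComm K T f y = ⁅T, f y⁆ - f ⁅T, y⁆ := rfl

variable {α : g →ₗ[K] K} {T : g}

/-- The inner cochain of w goes to that of ⁅T, w⁆. Thus `adComm` descends to `relDer` modulo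
`relInner`, which is H¹(ker α, 𝔤). -/
theorem adComm_mem_relInner (hα : ∀ x y : g, α ⁅x, y⁆ = 0) {d : Module.End K g}
    (hd : d ∈ relInner α T) : adComm K T d ∈ relInner α T := by
  obtain ⟨hd, w, hw⟩ := hd
  refine ⟨by rw [adComm_apply, hd, lie_self, lie_zero, map_zero, sub_zero], ⁅T, w⁆, fun y hy => ?_⟩
  rw [adComm_apply, hw y hy, hw _ (hα T y), lie_lie]

theorem adComm_mem_relDer (hα : ∀ x y : g, α ⁅x, y⁆ = 0) {d : Module.End K g}
    (hd : d ∈ relDer α T) : adComm K T d ∈ relDer α T := by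
  obtain ⟨hd, hd'⟩ := hd
  refine ⟨by rw [adComm_apply, hd, lie_self, lie_zero, map_zero, sub_zero], fun x y hx hy => ?_⟩
  simp only [adComm_apply]
  rw [leibniz_lie T x y, map_add, hd' _ _ hx hy, hd' _ _ (hα T x) hy, hd' _ _ hx (hα T y),
    lie_add, leibniz_lie T (d x) y, leibniz_lie T x (d y)]
  simp only [sub_lie, lie_sub]
  abel

/-- Splitting x as α(x) T plus an element of ker α shows that the failure of the Leibniz rule is
governed by the commutator with ad T alone. In the coboundary of α ∧ d these defects cancel. -/
theorem relDer_leibniz_defect (hT : α T = 1) {d : Module.End K g}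
    (hd : d ∈ relDer α T) (x y : g) :
    d ⁅x, y⁆ = ⁅d x, y⁆ + ⁅x, d y⁆ + α y • adComm K T d x - α x • adComm K T d y := by
  obtain ⟨hd, hd'⟩ := hd
  have hdecomp : ∀ z : g, ∃ z', α z' = 0 ∧ z = α z • T + z' := fun z =>
    ⟨z - α z • T, by simp [hT], by abel⟩
  obtain ⟨x', hx', hx⟩ := hdecomp x
  obtain ⟨y', hy', hy⟩ := hdecomp y
  have hx2 : d x = d x' := by rw [hx]; simp [hd]
  have hy2 : d y = d y' := by rw [hy]; simp [hd]
  simp only [adComm_apply, hx2, hy2]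
  generalize α x = a at *
  generalize α y = b at *
  subst hx hy
  simp only [lie_add, add_lie, lie_smul, smul_lie, map_add, map_smul, lie_self, smul_zero, zero_add,
    hd' x' y' hx' hy']
  rw [← lie_skew (d x') T, ← lie_skew x' T, map_neg]
  module

/-- The 2-cocycle `α ∧ d`. -/
theorem wedge_cocycle (hα : ∀ x y : g, α ⁅x, y⁆ = 0) (hT : α T = 1) {d : Module.End K g}
    (hd : d ∈ relDer α T) :
    ∃ a ∈ LieModule.Cohomology.twoCocycle K g g, ∀ x y, a x y = α x • d y - α y • d x := by
  let a : LieModule.Cohomology.twoCochain K g g :=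
    ⟨LinearMap.mk₂ K (fun x y => α x • d y - α y • d x)
      (fun x x' y => by simp only [map_add]; module)
      (fun c x y => by simp only [map_smul, smul_eq_mul]; module)
      (fun x y y' => by simp only [map_add]; module)
      (fun c x y => by simp only [map_smul, smul_eq_mul]; module),
      fun x => by simp⟩
  have ha : ∀ x y, a x y = α x • d y - α y • d x := fun _ _ => rfl
  refine ⟨a, ?_, ha⟩
  rw [LieModule.Cohomology.mem_twoCocycle_iff]
  ext x y z
  rw [LieModule.Cohomology.d₂₃_apply]
  simp only [ha, hα, zero_smul, zero_sub, lie_sub, lie_smul, LinearMap.zero_apply]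
  rw [relDer_leibniz_defect hT hd x y, relDer_leibniz_defect hT hd x z,
    relDer_leibniz_defect hT hd y z, ← lie_skew (d x) y, ← lie_skew (d x) z, ← lie_skew (d y) z]
  module

/-- Rigidity makes `ad T` surjective on the first cohomology of the codimension-one ideal
`ker α` with values in the whole Lie algebra. -/
theorem exists_adComm_add_of_rigid (hrig : IsAlgebraicallyRigid K g)
    (hα : ∀ x y : g, α ⁅x, y⁆ = 0) (hT : α T = 1) {d : Module.End K g} (hd : d ∈ relDer α T) :
    ∃ f ∈ relDer α T, ∃ b ∈ relInner α T, d = adComm K T f + b := by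
  obtain ⟨a, ha, ha'⟩ := wedge_cocycle hα hT hd
  obtain ⟨f, hf⟩ := (isAlgebraicallyRigid_iff K g).mp hrig a ha
  have key : ∀ x y, ⁅x, f y⁆ - ⁅y, f x⁆ - f ⁅x, y⁆ = α x • d y - α y • d x := fun x y => by
    rw [← ha', ← hf]
    rfl
  have hdT := hd.1
  -- The correction makes f vanish at T without changing it on ker α; f T reappears as the element
  -- defining the inner remainder.
  let f' : Module.End K g := f - α.smulRight (f T)
  have hf' : ∀ y, f' y = f y - α y • f T := fun _ => rfl
  have hf'T : f' T = 0 := by rw [hf', hT, one_smul, sub_self]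
  refine ⟨f', ⟨hf'T, fun x y hx hy => ?_⟩, d - adComm K T f', ⟨?_, f T, fun y hy => ?_⟩, ?_⟩
  · have h := key x y
    rw [hx, hy, zero_smul, zero_smul, sub_zero, sub_eq_zero] at h
    rw [hf', hf', hf', hα, hx, hy, ← h, ← lie_skew y (f x)]
    simp only [zero_smul, sub_zero]
    abel
  · rw [LinearMap.sub_apply, adComm_apply, hf'T, hdT, lie_self, lie_zero, map_zero, sub_zero,
      sub_zero]
  · have h := key T y
    rw [hT, one_smul, hy, zero_smul, sub_zero] at h
    rw [LinearMap.sub_apply, adComm_apply, hf', hf', hy, hα, ← h, ← lie_skew y (f T)]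
    simp only [zero_smul, sub_zero]
    abel
  · abel

/-- In a rigid Lie algebra, `ad T` acts injectively on the first cohomology of the codimension-one
ideal `ker α` with values in the whole Lie algebra. -/
theorem mem_relInner_of_adComm_mem [FiniteDimensional K g] (hrig : IsAlgebraicallyRigid K g)
    (hα : ∀ x y : g, α ⁅x, y⁆ = 0) (hT : α T = 1) {d : Module.End K g} (hd : d ∈ relDer α T)
    (h : adComm K T d ∈ relInner α T) : d ∈ relInner α T := by
  -- Z / B is H¹(ker α, 𝔤), where a surjective endomorphism is injective by finite dimension.
  let Z := relDer α T
  let B : Submodule K Z := (relInner α T).comap Z.subtype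
  let τ : Z →ₗ[K] Z := (adComm K T).restrict fun _ hx => adComm_mem_relDer hα hx
  have hτB : B ≤ B.comap τ := fun x hx => adComm_mem_relInner hα hx
  have hsurj : Function.Surjective (B.mapQ B τ hτB) := by
    intro q
    obtain ⟨⟨e, he⟩, rfl⟩ := B.mkQ_surjective q
    obtain ⟨f, hf, b, hb, hfb⟩ := exists_adComm_add_of_rigid hrig hα hT he
    refine ⟨B.mkQ ⟨f, hf⟩, ?_⟩
    rw [Submodule.mkQ_apply, Submodule.mapQ_apply, Submodule.mkQ_apply, Submodule.Quotient.eq]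
    change adComm K T f - e ∈ relInner α T
    rw [hfb, sub_add_cancel_left]
    exact neg_mem hb
  have hinj := LinearMap.injective_iff_surjective.mpr hsurj
  have h0 : B.mapQ B τ hτB (B.mkQ ⟨d, hd⟩) = B.mapQ B τ hτB 0 := by
    rw [map_zero, Submodule.mkQ_apply, Submodule.mapQ_apply, Submodule.Quotient.mk_eq_zero]
    exact h
  have h1 := hinj h0
  rw [Submodule.mkQ_apply, Submodule.Quotient.mk_eq_zero] at h1
  exact h1

/-- Surjectivity on H¹ can be iterated, while the commutator with a nilpotent ad T is nilpotent,
being a difference of commuting nilpotent multiplications. So H¹(ker α, 𝔤) = 0. -/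
theorem relDer_le_relInner_of_isNilpotent (hrig : IsAlgebraicallyRigid K g)
    (hα : ∀ x y : g, α ⁅x, y⁆ = 0) (hT : α T = 1)
    (hnil : IsNilpotent (LieAlgebra.ad K g T)) : relDer α T ≤ relInner α T := by
  have h1 : ∀ (n : ℕ), ∀ d ∈ relDer α T,
      ∃ f ∈ relDer α T, ∃ b ∈ relInner α T, d = ((adComm K T) ^ n) f + b := by
    intro n
    induction n with
    | zero => exact fun d hd => ⟨d, hd, 0, zero_mem _, by simp⟩
    | succ n ih =>
      intro d hd
      obtain ⟨f, hf, b, hb, rfl⟩ := exists_adComm_add_of_rigid hrig hα hT hd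
      obtain ⟨f', hf', b', hb', rfl⟩ := ih f hf
      refine ⟨f', hf', adComm K T b' + b, add_mem (adComm_mem_relInner hα hb') hb, ?_⟩
      rw [pow_succ', Module.End.mul_apply, map_add, add_assoc]
  have hn : IsNilpotent (adComm K T) := by
    have hc : Commute (LinearMap.mulLeft K (LieAlgebra.ad K g T))
        (LinearMap.mulRight K (LieAlgebra.ad K g T)) := LinearMap.commute_mulLeft_right _ _
    exact hc.isNilpotent_sub ((LinearMap.isNilpotent_mulLeft_iff K _).mpr hnil)
      ((LinearMap.isNilpotent_mulRight_iff K _).mpr hnil)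
  obtain ⟨n, hn⟩ := hn
  intro d hd
  obtain ⟨f, _, b, hb, rfl⟩ := h1 n d hd
  rw [hn, LinearMap.zero_apply, zero_add]
  exact hb

/-- In a nilpotent Lie algebra, a subspace `W` contained in the span of the brackets `⁅x, w⁆`
is zero. -/
theorem eq_bot_of_le_span_lie (hnil : LieRing.IsNilpotent g) {W : Submodule K g}
    (h : W ≤ Submodule.span K {z | ∃ x : g, ∃ w ∈ W, ⁅x, w⁆ = z}) : W = ⊥ := by
  obtain ⟨k, hk⟩ := (LieModule.isNilpotent_iff K g g).mp hnil
  have h1 : ∀ n, W ≤ (LieModule.lowerCentralSeries K g g n).toSubmodule := by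
    intro n
    induction n with
    | zero => exact fun _ _ => trivial
    | succ n ih =>
      refine h.trans (Submodule.span_le.mpr ?_)
      rintro _ ⟨x, w, hw, rfl⟩
      rw [LieModule.lowerCentralSeries_succ]
      exact LieSubmodule.lie_mem_lie (LieSubmodule.mem_top x) (ih hw)
  have := h1 k
  rw [hk] at this
  exact le_bot_iff.mp this

theorem exists_dual_ne_zero_of_ne_top {V : Type*} [AddCommGroup V] [Module K V] {p : Submodule K V}
    (hp : p ≠ ⊤) : ∃ (f : V →ₗ[K] K) (v : V), (∀ x ∈ p, f x = 0) ∧ f v = 1 := by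
  obtain ⟨v, hv⟩ : ∃ v, v ∉ p := by
    by_contra hcon
    push Not at hcon
    exact hp (eq_top_iff.mpr fun x _ => hcon x)
  obtain ⟨f, hf, hf'⟩ := Submodule.exists_le_ker_of_notMem hv
  exact ⟨(f v)⁻¹ • f, v, fun x hx => by simp [LinearMap.mem_ker.mp (hf' hx)], by simp [hf]⟩

/-- A nonzero Lie algebra of dimension at least two that is nilpotent is not rigid. -/
theorem not_rigid_of_isNilpotent (hrig : IsAlgebraicallyRigid K g) (hnil : LieRing.IsNilpotent g)
    (hdim : 2 ≤ finrank K g) : False := by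
  have hfd : FiniteDimensional K g := FiniteDimensional.of_finrank_pos (by omega)
  have hadn : ∀ x, IsNilpotent (LieAlgebra.ad K g x) :=
    (LieAlgebra.isNilpotent_iff_forall (R := K)).mp hnil
  let D : Submodule K g := Submodule.span K {z | ∃ x y : g, ⁅x, y⁆ = z}
  have hD : D ≠ ⊤ := by
    intro hD
    have := eq_bot_of_le_span_lie (K := K) hnil (W := ⊤) (by
      rw [← hD]
      refine Submodule.span_le.mpr ?_
      rintro _ ⟨x, y, rfl⟩
      exact Submodule.subset_span ⟨x, y, by rw [hD]; trivial, rfl⟩)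
    have h1 := finrank_top K g
    rw [this, finrank_bot] at h1
    omega
  obtain ⟨α, T, hα', hT⟩ := exists_dual_ne_zero_of_ne_top hD
  have hα : ∀ x y : g, α ⁅x, y⁆ = 0 := fun x y => hα' _ (Submodule.subset_span ⟨x, y, rfl⟩)
  have hZB := relDer_le_relInner_of_isNilpotent hrig hα hT (hadn T)
  -- E is proper, since otherwise the nonzero nilpotent algebra ker α would equal its derived
  -- algebra. So some β ≠ 0 kills T and the brackets of ker α.
  let E : Submodule K g :=
    Submodule.span K {z | ∃ x y : g, α x = 0 ∧ α y = 0 ∧ ⁅x, y⁆ = z} ⊔ Submodule.span K {T}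
  have hE : E ≠ ⊤ := by
    intro hE
    have hker : LinearMap.ker α ≤ Submodule.span K {z | ∃ x y : g, α x = 0 ∧ α y = 0 ∧ ⁅x, y⁆ = z} := by
      intro x hx
      have hxE : x ∈ E := hE ▸ Submodule.mem_top
      obtain ⟨y, hy, z, hz, rfl⟩ := Submodule.mem_sup.mp hxE
      obtain ⟨c, rfl⟩ := Submodule.mem_span_singleton.mp hz
      have hy0 : α y = 0 := by
        have : Submodule.span K {z | ∃ x y : g, α x = 0 ∧ α y = 0 ∧ ⁅x, y⁆ = z} ≤
            LinearMap.ker α := by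
          refine Submodule.span_le.mpr ?_
          rintro _ ⟨x, y, _, _, rfl⟩
          exact hα x y
        exact this hy
      rw [LinearMap.mem_ker, map_add, hy0, map_smul, hT, zero_add, smul_eq_mul, mul_one] at hx
      rw [hx, zero_smul, add_zero]
      exact hy
    have h0 := eq_bot_of_le_span_lie (K := K) hnil (W := LinearMap.ker α) (hker.trans
      (Submodule.span_mono (by
        rintro _ ⟨x, y, _, hy, rfl⟩
        exact ⟨x, y, hy, rfl⟩)))
    have h1 := LinearMap.finrank_le_finrank_of_injective (LinearMap.ker_eq_bot.mp h0)
    rw [finrank_self] at h1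
    omega
  obtain ⟨β, T', hβ', hT'⟩ := exists_dual_ne_zero_of_ne_top hE
  have hβT : β T = 0 :=
    hβ' T (Submodule.mem_sup_right (Submodule.mem_span_singleton_self T))
  have hβ : ∀ x y : g, α x = 0 → α y = 0 → β ⁅x, y⁆ = 0 := fun x y hx hy =>
    hβ' _ (Submodule.mem_sup_left (Submodule.subset_span ⟨x, y, hx, hy, rfl⟩))
  obtain ⟨T₂, hT₂, hβT₂⟩ : ∃ T₂, α T₂ = 0 ∧ β T₂ = 1 :=
    ⟨T' - α T' • T, by simp [hT], by simp [hβT, hT']⟩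
  -- W centralizes ker α ∩ ker β, which makes β ⊗ w a 1-cocycle on ker α for each w in W.
  let W : Submodule K g :=
    { carrier := {w : g | ∀ x : g, α x = 0 → β x = 0 → ⁅w, x⁆ = 0}
      add_mem' := fun ha hb x hx hx' => by rw [add_lie, ha x hx hx', hb x hx hx', add_zero]
      zero_mem' := fun x _ _ => zero_lie x
      smul_mem' := fun c w hw x hx hx' => by rw [smul_lie, hw x hx hx', smul_zero] }
  have hWT : ∀ w ∈ W, ∀ y, α y = 0 → ⁅w, y⁆ = β y • ⁅w, T₂⁆ := by
    intro w hw y hy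
    have := hw (y - β y • T₂) (by simp [hy, hT₂]) (by simp [hβT₂])
    rwa [lie_sub, lie_smul, sub_eq_zero] at this
  -- As H¹ vanishes, β ⊗ w is ad v on ker α. Then v is in W and w = ⁅v, T₂⁆, so W ⊆ ⁅𝔤, W⁆ and
  -- nilpotency gives W = 0, although W contains the nonzero centre.
  have hW : W = ⊥ := by
    refine eq_bot_of_le_span_lie (K := K) hnil fun w hw => ?_
    have hmem : β.smulRight w ∈ relDer α T := by
      refine ⟨by simp [hβT], fun x y hx hy => ?_⟩
      simp only [LinearMap.smulRight_apply, hβ x y hx hy, zero_smul, smul_lie, lie_smul]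
      rw [hWT w hw y hy, ← lie_skew x w, hWT w hw x hx]
      module
    obtain ⟨-, v, hv⟩ := hZB hmem
    have hvW : v ∈ W := fun x hx hx' => by
      rw [← hv x hx, LinearMap.smulRight_apply, hx', zero_smul]
    have h1 := hv T₂ hT₂
    rw [LinearMap.smulRight_apply, hβT₂, one_smul] at h1
    rw [h1, ← lie_skew]
    exact neg_mem (Submodule.subset_span ⟨T₂, v, hvW, rfl⟩)
  have hnt : Nontrivial g := nontrivial_of_finrank_pos (R := K) (by omega)
  have hc : Nontrivial (LieAlgebra.center K g) := by
    exact LieAlgebra.non_trivial_center_of_isNilpotent (R := K) (L := g)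
  obtain ⟨⟨c, hc⟩, hc0⟩ := exists_ne (0 : LieAlgebra.center K g)
  have hcW : c ∈ W := fun x _ _ => by
    rw [← lie_skew, (LieModule.mem_maxTrivSubmodule K g g c).mp hc x, neg_zero]
  rw [hW, Submodule.mem_bot] at hcW
  exact hc0 (Subtype.ext hcW)

end Rigidity

end RigidLie

namespace RigidLie

open Module

/-! ### Consequences of nilpotency -/

section NilpotentLemmas

variable {K N : Type*} [Field K] [LieRing N] [LieAlgebra K N]

/-- If c ≠ 0, the span of v and ⁅y, v⁆ is contained in the brackets with itself. -/
theorem eq_zero_of_lie_lie_eq_smul (hnil : LieRing.IsNilpotent N) {x y v : N} {c : K}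
    (hv : v ≠ 0) (h : ⁅x, ⁅y, v⁆⁆ = c • v) : c = 0 := by
  by_contra hc
  have hW := eq_bot_of_le_span_lie (K := K) hnil (W := Submodule.span K {v, ⁅y, v⁆}) (by
    refine Submodule.span_le.mpr ?_
    have h1 : v ∈ Submodule.span K {v, ⁅y, v⁆} := Submodule.subset_span (by simp)
    have h2 : ⁅y, v⁆ ∈ Submodule.span K {v, ⁅y, v⁆} := Submodule.subset_span (by simp)
    rintro z (rfl | hz)
    · have h3 : c⁻¹ • ⁅x, ⁅y, z⁆⁆ ∈ Submodule.span K
          {u | ∃ x : N, ∃ w ∈ Submodule.span K {z, ⁅y, z⁆}, ⁅x, w⁆ = u} :=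
        Submodule.smul_mem _ _ (Submodule.subset_span ⟨x, _, h2, rfl⟩)
      rwa [h, inv_smul_smul₀ hc] at h3
    · rw [Set.mem_singleton_iff] at hz
      rw [hz]
      exact Submodule.subset_span ⟨y, v, h1, rfl⟩)
  have h1 : v ∈ Submodule.span K {v, ⁅y, v⁆} := Submodule.subset_span (by simp)
  rw [hW, Submodule.mem_bot] at h1
  exact hv h1

theorem eq_zero_of_lie_eq_smul (hnil : LieRing.IsNilpotent N) {x v : N} {c : K}
    (hv : v ≠ 0) (h : ⁅x, v⁆ = c • v) : c = 0 := by
  have h1 : ⁅x, ⁅x, v⁆⁆ = (c * c) • v := by rw [h, lie_smul, h, smul_smul]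
  exact mul_self_eq_zero.mp (eq_zero_of_lie_lie_eq_smul hnil hv h1)

/-- The span of the brackets of elements of `A`. -/
def lieSpan (A : Submodule K N) : Submodule K N :=
  Submodule.span K {z | ∃ x ∈ A, ∃ y ∈ A, ⁅x, y⁆ = z}

theorem lie_mem_lieSpan {A : Submodule K N} {x y : N} (hx : x ∈ A) (hy : y ∈ A) :
    ⁅x, y⁆ ∈ lieSpan A := Submodule.subset_span ⟨x, hx, y, hy, rfl⟩

theorem lieSpan_le {A B : Submodule K N} (h : ∀ x ∈ A, ∀ y ∈ A, ⁅x, y⁆ ∈ B) : lieSpan A ≤ B := by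
  refine Submodule.span_le.mpr ?_
  rintro _ ⟨x, hx, y, hy, rfl⟩
  exact h x hx y hy

/-- When P = A the vector is q = 0, so the bound on the codimension drops by one without a separate
case. -/
theorem exists_le_sup_span_singleton {V : Type*} [AddCommGroup V] [Module K V]
    [FiniteDimensional K V] {P A : Submodule K V} {n : ℕ} (hPA : P ≤ A)
    (h : finrank K A ≤ finrank K P + (n + 1)) :
    ∃ q ∈ A, P ⊔ Submodule.span K {q} ≤ A ∧
      finrank K A ≤ finrank K (P ⊔ Submodule.span K {q} : Submodule K V) + n := by
  by_cases hE : P = A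
  · subst hE
    refine ⟨0, zero_mem _, by simp, ?_⟩
    rw [Submodule.span_zero_singleton, sup_bot_eq]
    omega
  · obtain ⟨q, hqA, hqP⟩ := SetLike.exists_of_lt (lt_of_le_of_ne hPA hE)
    have hle : P ⊔ Submodule.span K {q} ≤ A :=
      sup_le hPA ((Submodule.span_singleton_le_iff_mem q A).mpr hqA)
    refine ⟨q, hqA, hle, ?_⟩
    have hlt : P < P ⊔ Submodule.span K {q} := by
      refine lt_of_le_of_ne le_sup_left fun h => hqP ?_
      rw [h]
      exact Submodule.mem_sup_right (Submodule.mem_span_singleton_self q)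
    have := Submodule.finrank_lt_finrank_of_lt hlt
    omega

theorem exists_le_sup_span_singleton_of_finrank_le {V : Type*} [AddCommGroup V] [Module K V]
    [FiniteDimensional K V] {P A : Submodule K V} (hPA : P ≤ A)
    (h : finrank K A ≤ finrank K P + 1) :
    ∃ q ∈ A, A ≤ P ⊔ Submodule.span K {q} := by
  obtain ⟨q, hq, hle, hf⟩ := exists_le_sup_span_singleton (n := 0) hPA h
  exact ⟨q, hq, (Submodule.eq_of_le_of_finrank_le hle hf).ge⟩

/-- If A were ⁅A, A⁆ plus a line, the bracket of that line with itself would vanish, so ⁅A, A⁆ ⊆ ⁅A,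
⁅A, A⁆⁆, contrary to nilpotency. -/
theorem finrank_lieSpan_add_two_le (hnil : LieRing.IsNilpotent N) [FiniteDimensional K N]
    {A : Submodule K N} (hA : lieSpan A ≤ A) (h0 : lieSpan A ≠ ⊥) :
    finrank K (lieSpan A) + 2 ≤ finrank K A := by
  by_contra hcon
  obtain ⟨q, hq, hle⟩ := exists_le_sup_span_singleton_of_finrank_le hA (by omega)
  refine h0 (eq_bot_of_le_span_lie (K := K) hnil ?_)
  refine lieSpan_le fun x hx y hy => ?_
  obtain ⟨u, hu, c, hc, rfl⟩ := Submodule.mem_sup.mp (hle hx)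
  obtain ⟨v, hv, d, hd, rfl⟩ := Submodule.mem_sup.mp (hle hy)
  obtain ⟨c, rfl⟩ := Submodule.mem_span_singleton.mp hc
  obtain ⟨d, rfl⟩ := Submodule.mem_span_singleton.mp hd
  have h1 : ⁅u + c • q, v + d • q⁆ = ⁅u + c • q, v⁆ - d • ⁅q, u⁆ := by
    simp only [lie_add, add_lie, lie_smul, smul_lie, lie_self]
    rw [← lie_skew u q]
    module
  rw [h1]
  exact sub_mem (Submodule.subset_span ⟨_, v, hv, rfl⟩)
    (Submodule.smul_mem _ _ (Submodule.subset_span ⟨_, u, hu, rfl⟩))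

end NilpotentLemmas

/-- A real structure `σ` on a seven-dimensional complex nilpotent Lie algebra together with a
semisimple derivation `T` that anticommutes with `σ`, such that every derivation commuting with `T` is a
multiple of `T` up to an inner derivation. -/
structure SkewTorus {N : Type*} [LieRing N] [LieAlgebra ℂ N] (T : Module.End ℂ N) (σ : N → N) :
    Prop where
  finrank_eq : finrank ℂ N = 7
  nil : LieRing.IsNilpotent N
  der : IsDer T
  semisimple : T.IsSemisimple
  conj_add : ∀ x y, σ (x + y) = σ x + σ y
  conj_smul : ∀ (c : ℂ) x, σ (c • x) = (starRingEnd ℂ) c • σ x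
  conj_lie : ∀ x y : N, σ ⁅x, y⁆ = ⁅σ x, σ y⁆
  conj_conj : ∀ x, σ (σ x) = x
  map_conj : ∀ x, T (σ x) = -σ (T x)
  inner : ∀ D : Module.End ℂ N, IsDer D → (∀ x, D (T x) = T (D x)) →
    ∃ (a : ℂ) (y : N), ∀ x, D x = a • T x + ⁅y, x⁆

/-- `v` is a weight vector of `T` of real weight `s`. -/
def HasWeight {N : Type*} [AddCommGroup N] [Module ℂ N] (T : Module.End ℂ N) (s : ℝ) (v : N) :
    Prop := T v = (s : ℂ) • v

/-! ### Bases of weight vectors -/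

section Basis

variable {N : Type*} [AddCommGroup N] [Module ℂ N] {T : Module.End ℂ N}
  {ι : Type*}

theorem HasWeight.exists_coeff [Fintype ι] (B : Basis ι ℂ N) {lam : ι → ℝ}
    (hT : ∀ i, HasWeight T (lam i) (B i)) {v : N} {μ : ℝ} (hv : HasWeight T μ v) :
    ∃ c : ι → ℂ, v = ∑ i, c i • B i ∧ ∀ i, lam i ≠ μ → c i = 0 := by
  refine ⟨fun i => B.repr v i, (B.sum_repr v).symm, fun i hi => ?_⟩
  have h1 : T v = ∑ i, (B.repr v i * (lam i : ℂ)) • B i := by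
    conv_lhs => rw [← B.sum_repr v]
    rw [map_sum]
    refine Finset.sum_congr rfl fun i _ => ?_
    rw [map_smul, hT i, smul_smul]
  have h2 : B.repr (T v) i = B.repr v i * (lam i : ℂ) := by
    rw [h1, B.repr_sum_self]
  rw [hv, map_smul, Finsupp.smul_apply, smul_eq_mul] at h2
  have h3 : ((μ : ℂ) - lam i) * B.repr v i = 0 := by linear_combination h2
  rcases mul_eq_zero.mp h3 with h | h
  · exact absurd (by exact_mod_cast (sub_eq_zero.mp h).symm) hi
  · exact h

theorem exists_projection_ker (B : Basis ι ℂ N) {lam : ι → ℝ}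
    (hT : ∀ i, HasWeight T (lam i) (B i)) :
    ∃ π : Module.End ℂ N, (∀ x, T (π x) = 0) ∧ (∀ x, π (T x) = 0) ∧ (∀ x, T x = 0 → π x = x) ∧
      ∀ x, ∃ y, x - π x = T y := by
  classical
  let π : Module.End ℂ N := B.constr ℂ fun i => if lam i = 0 then B i else 0
  -- ρ inverts T off its kernel; by the convention 0⁻¹ = 0 it vanishes on the basis vectors of
  -- weight zero.
  let ρ : Module.End ℂ N := B.constr ℂ fun i => ((lam i : ℂ)⁻¹) • B i
  have hπ : ∀ i, π (B i) = if lam i = 0 then B i else 0 := fun i => B.constr_basis ℂ _ i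
  have hρ : ∀ i, ρ (B i) = ((lam i : ℂ)⁻¹) • B i := fun i => B.constr_basis ℂ _ i
  have h1 : T ∘ₗ π = 0 := B.ext fun i => by
    rw [LinearMap.comp_apply, hπ, LinearMap.zero_apply]
    split_ifs with h
    · rw [hT i, h, Complex.ofReal_zero, zero_smul]
    · exact map_zero T
  have h2 : π ∘ₗ T = 0 := B.ext fun i => by
    rw [LinearMap.comp_apply, hT i, map_smul, hπ, LinearMap.zero_apply]
    split_ifs with h
    · rw [h, Complex.ofReal_zero, zero_smul]
    · exact smul_zero _
  have h3 : LinearMap.id - π = ρ ∘ₗ T := B.ext fun i => by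
    rw [LinearMap.comp_apply, hT i, map_smul, hρ, LinearMap.sub_apply, hπ, LinearMap.id_apply]
    split_ifs with h
    · rw [h, Complex.ofReal_zero, zero_smul, sub_self]
    · rw [sub_zero, smul_inv_smul₀ (by exact_mod_cast h)]
  have h4 : LinearMap.id - π = T ∘ₗ ρ := B.ext fun i => by
    rw [LinearMap.comp_apply, hρ i, map_smul, hT i, LinearMap.sub_apply, hπ, LinearMap.id_apply]
    split_ifs with h
    · rw [h, Complex.ofReal_zero, zero_smul, smul_zero, sub_self]
    · rw [sub_zero, inv_smul_smul₀ (by exact_mod_cast h)]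
  refine ⟨π, LinearMap.congr_fun h1, LinearMap.congr_fun h2, fun x hx => ?_,
    fun x => ⟨ρ x, LinearMap.congr_fun h4 x⟩⟩
  have := LinearMap.congr_fun h3 x
  rw [LinearMap.comp_apply, hx, map_zero, LinearMap.sub_apply, sub_eq_zero] at this
  exact this.symm

end Basis

/-! ### Weights, conjugation, and the obstruction coming from gradings -/

namespace SkewTorus

variable {N : Type*} [LieRing N] [LieAlgebra ℂ N] {T : Module.End ℂ N} {σ : N → N}

theorem conj_zero (H : SkewTorus T σ) : σ 0 = 0 := by
  have := H.conj_smul 0 0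
  rwa [zero_smul, map_zero, zero_smul] at this

theorem conj_ne_zero (H : SkewTorus T σ) {v : N} (hv : v ≠ 0) : σ v ≠ 0 := fun h => hv (by
  rw [← H.conj_conj v, h, H.conj_zero])

theorem conj_neg (H : SkewTorus T σ) (v : N) : σ (-v) = -σ v := by
  have := H.conj_smul (-1) v
  simpa using this

theorem weight_lie (H : SkewTorus T σ) {s t : ℝ} {u v : N} (hu : HasWeight T s u)
    (hv : HasWeight T t v) : HasWeight T (s + t) ⁅u, v⁆ := by
  rw [HasWeight, H.der, hu, hv, smul_lie, lie_smul, ← add_smul, Complex.ofReal_add]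

theorem weight_conj (H : SkewTorus T σ) {s : ℝ} {u : N} (hu : HasWeight T s u) :
    HasWeight T (-s) (σ u) := by
  rw [HasWeight, H.map_conj, hu, H.conj_smul, Complex.conj_ofReal, Complex.ofReal_neg, neg_smul]

/-- A derivation commuting with `T` has opposite eigenvalues on weight vectors of opposite
weight. -/
theorem add_eq_zero_of_eigen (H : SkewTorus T σ) {D : Module.End ℂ N} (hD : IsDer D)
    (hDT : ∀ x, D (T x) = T (D x)) {s t : ℝ} {v w : N} (hv : HasWeight T s v)
    (hw : HasWeight T t w) (hst : s + t = 0) (hv0 : v ≠ 0) (hw0 : w ≠ 0) {d d' : ℂ}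
    (hdv : D v = d • v) (hdw : D w = d' • w) : d + d' = 0 := by
  obtain ⟨a, y, h⟩ := H.inner D hD hDT
  -- From D = aT + ad y, the vector v is an eigenvector of ad y with eigenvalue d - as, which
  -- nilpotency forces to be zero.
  have key : ∀ (s : ℝ) (v : N) (d : ℂ), HasWeight T s v → v ≠ 0 → D v = d • v → d = a * s := by
    intro s v d hv hv0 hdv
    have h1 : ⁅y, v⁆ = (d - a * s) • v := by
      have := h v
      rw [hdv, hv] at this
      rw [sub_smul, this, smul_smul]
      abel
    exact sub_eq_zero.mp (eq_zero_of_lie_eq_smul H.nil hv0 h1)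
  rw [key s v d hv hv0 hdv, key t w d' hw hw0 hdw, ← mul_add]
  have : ((s : ℂ) + t) = 0 := by exact_mod_cast hst
  rw [this, mul_zero]

theorem finiteDimensional (H : SkewTorus T σ) : FiniteDimensional ℂ N :=
  FiniteDimensional.of_finrank_pos (by rw [H.finrank_eq]; norm_num)

/-- A spanning family of seven vectors, as a basis. -/
noncomputable def basis (H : SkewTorus T σ) {b : Fin 7 → N}
    (hspan : ⊤ ≤ Submodule.span ℂ (Set.range b)) : Basis (Fin 7) ℂ N :=
  have := H.finiteDimensional
  basisOfTopLeSpanOfCardEqFinrank b hspan (by rw [H.finrank_eq, Fintype.card_fin])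

theorem basis_apply (H : SkewTorus T σ) {b : Fin 7 → N}
    (hspan : ⊤ ≤ Submodule.span ℂ (Set.range b)) (i : Fin 7) : H.basis hspan i = b i := by
  have := H.finiteDimensional
  simp [basis]

theorem exists_coeff (H : SkewTorus T σ) {b : Fin 7 → N}
    (hspan : ⊤ ≤ Submodule.span ℂ (Set.range b)) {lam : Fin 7 → ℝ}
    (hT : ∀ i, HasWeight T (lam i) (b i)) {v : N} {μ : ℝ} (hv : HasWeight T μ v) :
    ∃ c : Fin 7 → ℂ, v = ∑ i, c i • b i ∧ ∀ i, lam i ≠ μ → c i = 0 := by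
  obtain ⟨c, h⟩ := HasWeight.exists_coeff (H.basis hspan)
    (fun i => by rw [H.basis_apply]; exact hT i) hv
  simp only [H.basis_apply] at h
  exact ⟨c, h⟩

/-- There is no grading of the Lie algebra compatible with the weights in which two weight vectors
of opposite weights have degrees with nonzero sum. -/
theorem false_of_grading (H : SkewTorus T σ) {b : Fin 7 → N}
    (hspan : ⊤ ≤ Submodule.span ℂ (Set.range b)) {lam : Fin 7 → ℝ}
    (hT : ∀ i, HasWeight T (lam i) (b i)) (d : Fin 7 → ℂ)
    (hbr : ∀ D : Module.End ℂ N, (∀ i, D (b i) = d i • b i) → ∀ i j, i < j →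
      D ⁅b i, b j⁆ = (d i + d j) • ⁅b i, b j⁆)
    (i j : Fin 7) (hij : lam i + lam j = 0) (hd : d i + d j ≠ 0) : False := by
  have hB := H.basis_apply hspan
  let D : Module.End ℂ N := (H.basis hspan).constr ℂ fun i => d i • b i
  have hD : ∀ i, D (b i) = d i • b i := fun i => by
    rw [← hB i]
    exact ((H.basis hspan).constr_basis ℂ _ i).trans (by rw [hB])
  have h0 : ∀ i, b i ≠ 0 := fun i => by rw [← hB i]; exact (H.basis hspan).ne_zero i
  have hpair : ∀ i j, D ⁅b i, b j⁆ = (d i + d j) • ⁅b i, b j⁆ := by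
    intro i j
    rcases lt_trichotomy i j with h | rfl | h
    · exact hbr D hD i j h
    · rw [lie_self, map_zero, smul_zero]
    · rw [← lie_skew, map_neg, hbr D hD j i h, smul_neg, add_comm]
  have hmem : ∀ x, x ∈ Submodule.span ℂ (Set.range b) := fun x => hspan trivial
  have hder : IsDer D := by
    have h1 : ∀ i y, D ⁅b i, y⁆ = ⁅D (b i), y⁆ + ⁅b i, D y⁆ := by
      intro i y
      induction hmem y using Submodule.span_induction with
      | mem x hx =>
        obtain ⟨j, rfl⟩ := hx
        rw [hpair, hD, hD, smul_lie, lie_smul, add_smul]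
      | zero => simp
      | add x y _ _ hx hy => simp only [lie_add, map_add, hx, hy]; abel
      | smul c x _ hx => simp only [lie_smul, map_smul, hx, smul_add]
    intro x y
    induction hmem x using Submodule.span_induction with
    | mem x hx =>
      obtain ⟨j, rfl⟩ := hx
      exact h1 j y
    | zero => simp
    | add x z _ _ hx hz => simp only [add_lie, map_add, hx, hz]; abel
    | smul c x _ hx => simp only [smul_lie, map_smul, hx, smul_add]
  have hcomm : ∀ x, D (T x) = T (D x) := by
    intro x
    induction hmem x using Submodule.span_induction with
    | mem x hx =>
      obtain ⟨j, rfl⟩ := hx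
      rw [hT j, hD, map_smul, map_smul, hD, hT j, smul_comm]
    | zero => simp
    | add x z _ _ hx hz => simp only [map_add, hx, hz]
    | smul c x _ hx => simp only [map_smul, hx]
  exact hd (H.add_eq_zero_of_eigen hder hcomm (hT i) (hT j) hij (h0 i) (h0 j) (hD i) (hD j))

end SkewTorus

end RigidLie

/-! ### Three distinct positive weights -/

namespace RigidLie

open Module

namespace SkewTorus

variable {N : Type*} [LieRing N] [LieAlgebra ℂ N] {T : Module.End ℂ N} {σ : N → N}

theorem hasWeight_frame {v₀ v₁ v₂ v₃ v₄ v₅ v₆ : N} {l₀ l₁ l₂ l₃ l₄ l₅ l₆ : ℝ}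
    (h₀ : HasWeight T l₀ v₀) (h₁ : HasWeight T l₁ v₁) (h₂ : HasWeight T l₂ v₂)
    (h₃ : HasWeight T l₃ v₃) (h₄ : HasWeight T l₄ v₄) (h₅ : HasWeight T l₅ v₅)
    (h₆ : HasWeight T l₆ v₆) (i : Fin 7) :
    HasWeight T (![l₀, l₁, l₂, l₃, l₄, l₅, l₆] i) (![v₀, v₁, v₂, v₃, v₄, v₅, v₆] i) := by
  fin_cases i <;> assumption

theorem eq_zero_of_weight (H : SkewTorus T σ) {b : Fin 7 → N}
    (hspan : ⊤ ≤ Submodule.span ℂ (Set.range b)) {lam : Fin 7 → ℝ}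
    (hT : ∀ i, HasWeight T (lam i) (b i)) {v : N} {μ : ℝ} (hv : HasWeight T μ v)
    (h : ∀ i, lam i ≠ μ) : v = 0 := by
  obtain ⟨c, rfl, hc⟩ := H.exists_coeff hspan hT hv
  exact Finset.sum_eq_zero fun i _ => by rw [hc i (h i), zero_smul]

theorem exists_smul_of_weight (H : SkewTorus T σ) {b : Fin 7 → N}
    (hspan : ⊤ ≤ Submodule.span ℂ (Set.range b)) {lam : Fin 7 → ℝ}
    (hT : ∀ i, HasWeight T (lam i) (b i)) {v : N} {μ : ℝ} (hv : HasWeight T μ v) (i₀ : Fin 7)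
    (h : ∀ i, i ≠ i₀ → lam i ≠ μ) : ∃ c : ℂ, v = c • b i₀ := by
  obtain ⟨c, rfl, hc⟩ := H.exists_coeff hspan hT hv
  exact ⟨c i₀, Finset.sum_eq_single i₀ (fun i _ hi => by rw [hc i (h i hi), zero_smul])
    (fun h => absurd (Finset.mem_univ _) h)⟩

theorem exists_smul_add_of_weight (H : SkewTorus T σ) {b : Fin 7 → N}
    (hspan : ⊤ ≤ Submodule.span ℂ (Set.range b)) {lam : Fin 7 → ℝ}
    (hT : ∀ i, HasWeight T (lam i) (b i)) {v : N} {μ : ℝ} (hv : HasWeight T μ v) (i₀ i₁ : Fin 7)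
    (h₀₁ : i₀ ≠ i₁) (h : ∀ i, i ≠ i₀ → i ≠ i₁ → lam i ≠ μ) :
    ∃ c d : ℂ, v = c • b i₀ + d • b i₁ := by
  obtain ⟨c, rfl, hc⟩ := H.exists_coeff hspan hT hv
  refine ⟨c i₀, c i₁, ?_⟩
  rw [← Finset.sum_pair (f := fun i => c i • b i) h₀₁]
  symm
  refine Finset.sum_subset (Finset.subset_univ _) fun i _ hi => ?_
  rw [Finset.mem_insert, Finset.mem_singleton, not_or] at hi
  rw [hc i (h i hi.1 hi.2), zero_smul]

theorem lie_conj_eq (H : SkewTorus T σ) {u v w : N} {c : ℂ} (h : ⁅u, v⁆ = c • w) :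
    ⁅σ u, σ v⁆ = starRingEnd ℂ c • σ w := by
  rw [← H.conj_lie, h, H.conj_smul]

theorem lie_conj_eq_zero (H : SkewTorus T σ) {u v : N} (h : ⁅u, v⁆ = 0) : ⁅σ u, σ v⁆ = 0 := by
  rw [← H.conj_lie, h, H.conj_zero]

theorem lie_conj_swap (H : SkewTorus T σ) {u v w : N} {c : ℂ} (h : ⁅u, σ v⁆ = c • w) :
    ⁅v, σ u⁆ = -(starRingEnd ℂ c • σ w) := by
  have h1 := congrArg σ h
  rw [H.conj_lie, H.conj_conj, H.conj_smul] at h1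
  rw [← lie_skew, h1]

theorem lie_conj_swap_eq_zero (H : SkewTorus T σ) {u v : N} (h : ⁅u, σ v⁆ = 0) :
    ⁅v, σ u⁆ = 0 := by
  rw [H.lie_conj_swap (w := 0) (c := 0) (by rw [h, zero_smul]), map_zero, zero_smul, neg_zero]

/-- Conjugating the relation gives ⁅u, ⁅σ u, e⁆⁆ = |κ|² e, so κ = 0 by nilpotency. -/
theorem lie_conj_eq_zero_of_eq_smul (H : SkewTorus T σ) {e u : N} {κ : ℂ} (he : e ≠ 0)
    (h : ⁅e, σ u⁆ = κ • σ e) : ⁅e, σ u⁆ = 0 := by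
  have h1 := H.lie_conj_swap h
  rw [H.conj_conj] at h1
  have h2 : ⁅u, ⁅σ u, e⁆⁆ = (κ * starRingEnd ℂ κ) • e := by
    rw [← lie_skew (σ u) e, h, lie_neg, lie_smul, h1, smul_neg, neg_neg, smul_smul]
  have h3 := eq_zero_of_lie_lie_eq_smul H.nil he h2
  rw [Complex.mul_conj, Complex.ofReal_eq_zero, Complex.normSq_eq_zero] at h3
  rw [h, h3, zero_smul]

/-- With κ = 0 the degrees 1 for each uᵢ and its conjugate and 2 for X give a grading. With κ ≠ 0,
u₃ and its conjugate must have degree 2, which is possible because Jacobi then kills ⁅u₃, σ u₃⁆. -/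
theorem false_of_triple_of_eq_zero (H : SkewTorus T σ) {u₁ u₂ u₃ X : N} {w₁ w₂ w₃ : ℝ}
    (hspan : ⊤ ≤ Submodule.span ℂ (Set.range ![u₁, u₂, u₃, σ u₁, σ u₂, σ u₃, X]))
    (t₁ : HasWeight T w₁ u₁) (t₂ : HasWeight T w₂ u₂) (t₃ : HasWeight T w₃ u₃)
    (tX : HasWeight T 0 X) (hX : ∀ y : N, ⁅y, X⁆ = 0) {κ h₁ h₂ h₃ : ℂ}
    (h12 : ⁅u₁, u₂⁆ = κ • σ u₃) (h13 : ⁅u₁, u₃⁆ = 0) (h23 : ⁅u₂, u₃⁆ = 0)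
    (k12 : ⁅u₁, σ u₂⁆ = 0) (k13 : ⁅u₁, σ u₃⁆ = 0) (k23 : ⁅u₂, σ u₃⁆ = 0)
    (k11 : ⁅u₁, σ u₁⁆ = h₁ • X) (k22 : ⁅u₂, σ u₂⁆ = h₂ • X) (k33 : ⁅u₃, σ u₃⁆ = h₃ • X) :
    False := by
  have hT := hasWeight_frame t₁ t₂ t₃ (H.weight_conj t₁) (H.weight_conj t₂) (H.weight_conj t₃) tX
  have k21 := H.lie_conj_swap_eq_zero k12
  have k31 := H.lie_conj_swap_eq_zero k13
  have k32 := H.lie_conj_swap_eq_zero k23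
  have s12 := H.lie_conj_eq h12
  rw [H.conj_conj] at s12
  have s13 := H.lie_conj_eq_zero h13
  have s23 := H.lie_conj_eq_zero h23
  by_cases hκ : κ = 0
  · rw [hκ, zero_smul] at h12
    rw [hκ, map_zero, zero_smul] at s12
    -- The offending pair is X with itself: weight 0 + 0, degree 2 + 2.
    refine H.false_of_grading hspan hT ![1, 1, 1, 1, 1, 1, 2] ?_ 6 6 (by simp) (by simp)
    intro D hD i j hij
    have d6 : D X = (2 : ℂ) • X := hD 6
    fin_cases i <;> fin_cases j <;> first
      | exact absurd hij (by decide)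
      | (simp [h12, h13, h23, k12, k13, k23, k21, k31, k32, s12, s13, s23, k11, k22, k33, hX, d6]
         try module)
  · have k33' : ⁅u₃, σ u₃⁆ = 0 := by
      have h1 : κ • ⁅σ u₃, u₃⁆ = 0 := by
        rw [← smul_lie, ← h12, lie_lie, h23, h13, lie_zero, lie_zero, sub_zero]
      rw [← lie_skew, (smul_eq_zero.mp h1).resolve_left hκ, neg_zero]
    refine H.false_of_grading hspan hT ![1, 1, 2, 1, 1, 2, 2] ?_ 6 6 (by simp) (by simp)
    intro D hD i j hij
    have d2 : D u₃ = (2 : ℂ) • u₃ := hD 2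
    have d5 : D (σ u₃) = (2 : ℂ) • σ u₃ := hD 5
    have d6 : D X = (2 : ℂ) • X := hD 6
    fin_cases i <;> fin_cases j <;> first
      | exact absurd hij (by decide)
      | (simp [h12, h13, h23, k12, k13, k23, k21, k31, k32, s12, s13, s23, k11, k22, k33', hX, d2,
          d5, d6]
         try module)

/-- At most one of κ, λ, μ is nonzero: with two of them, composing brackets with c and σ c would
scale a vector a by a nonzero factor. A permutation of the uᵢ then puts the remaining one first. -/
theorem false_of_triple (H : SkewTorus T σ) {u₁ u₂ u₃ X : N} {w₁ w₂ w₃ : ℝ}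
    (hspan : ⊤ ≤ Submodule.span ℂ (Set.range ![u₁, u₂, u₃, σ u₁, σ u₂, σ u₃, X]))
    (n₁ : u₁ ≠ 0) (n₂ : u₂ ≠ 0)
    (t₁ : HasWeight T w₁ u₁) (t₂ : HasWeight T w₂ u₂) (t₃ : HasWeight T w₃ u₃)
    (tX : HasWeight T 0 X) (hX : ∀ y : N, ⁅y, X⁆ = 0) {κ lam μ h₁ h₂ h₃ : ℂ}
    (h12 : ⁅u₁, u₂⁆ = κ • σ u₃) (h13 : ⁅u₁, u₃⁆ = lam • σ u₂) (h23 : ⁅u₂, u₃⁆ = μ • σ u₁)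
    (k12 : ⁅u₁, σ u₂⁆ = 0) (k13 : ⁅u₁, σ u₃⁆ = 0) (k23 : ⁅u₂, σ u₃⁆ = 0)
    (k11 : ⁅u₁, σ u₁⁆ = h₁ • X) (k22 : ⁅u₂, σ u₂⁆ = h₂ • X) (k33 : ⁅u₃, σ u₃⁆ = h₃ • X) :
    False := by
  have key : ∀ {a b c : N} {x y : ℂ}, a ≠ 0 → ⁅b, c⁆ = x • σ a → ⁅a, c⁆ = y • σ b →
      x = 0 ∨ y = 0 := by
    intro a b c x y ha h h'
    have h1 := H.lie_conj_eq h
    rw [H.conj_conj] at h1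
    have h2 : ⁅σ c, ⁅c, a⁆⁆ = (y * starRingEnd ℂ x) • a := by
      rw [← lie_skew c a, h', lie_neg, lie_smul, ← lie_skew (σ c), h1, smul_neg, neg_neg,
        smul_smul]
    have h3 := eq_zero_of_lie_lie_eq_smul H.nil ha h2
    rcases mul_eq_zero.mp h3 with h | h
    · exact Or.inr h
    · exact Or.inl ((map_eq_zero _).mp h)
  have h21 : ⁅u₂, u₁⁆ = (-κ) • σ u₃ := by rw [← lie_skew, h12, neg_smul]
  have h31 : ⁅u₃, u₁⁆ = (-lam) • σ u₂ := by rw [← lie_skew, h13, neg_smul]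
  have h32 : ⁅u₃, u₂⁆ = (-μ) • σ u₁ := by rw [← lie_skew, h23, neg_smul]
  have hlm := key n₁ h23 h13
  have hκm := key n₁ h32 h12
  have hκl := key n₂ h31 h21
  simp only [neg_eq_zero] at hlm hκm hκl
  have k21 := H.lie_conj_swap_eq_zero k12
  have k31 := H.lie_conj_swap_eq_zero k13
  have k32 := H.lie_conj_swap_eq_zero k23
  by_cases hκ : κ = 0
  · by_cases hl : lam = 0
    · rw [hκ, zero_smul] at h12
      rw [hl, neg_zero, zero_smul] at h31
      rw [hl, zero_smul] at h13
      refine H.false_of_triple_of_eq_zero (u₁ := u₂) (u₂ := u₃) (u₃ := u₁) (hspan.trans ?_)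
        t₂ t₃ t₁ tX hX h23 (by rw [← lie_skew, h12, neg_zero]) h31 k23 k21 k31
        k22 k33 k11
      refine Submodule.span_mono ?_
      rintro _ ⟨i, rfl⟩
      fin_cases i <;> simp
    · have hμ : μ = 0 := by tauto
      rw [hκ, zero_smul] at h12
      rw [hμ, zero_smul] at h23
      refine H.false_of_triple_of_eq_zero (u₁ := u₁) (u₂ := u₃) (u₃ := u₂) (hspan.trans ?_)
        t₁ t₃ t₂ tX hX h13 h12 (by rw [← lie_skew, h23, neg_zero]) k13 k12 k32
        k11 k33 k22
      refine Submodule.span_mono ?_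
      rintro _ ⟨i, rfl⟩
      fin_cases i <;> simp
  · have hμ : μ = 0 := by tauto
    have hl : lam = 0 := by tauto
    rw [hl, zero_smul] at h13
    rw [hμ, zero_smul] at h23
    exact H.false_of_triple_of_eq_zero hspan t₁ t₂ t₃ tX hX h12 h13 h23 k12 k13 k23 k11 k22 k33

theorem lie_eq_zero_of_span {b : Fin 7 → N}
    (hspan : ⊤ ≤ Submodule.span ℂ (Set.range b)) {X : N} (h : ∀ i, ⁅b i, X⁆ = 0) (y : N) :
    ⁅y, X⁆ = 0 := by
  have hy : y ∈ Submodule.span ℂ (Set.range b) := hspan trivial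
  induction hy using Submodule.span_induction with
  | mem x hx =>
    obtain ⟨i, rfl⟩ := hx
    exact h i
  | zero => exact zero_lie X
  | add x y _ _ hx hy => rw [add_lie, hx, hy, add_zero]
  | smul c x _ hx => rw [smul_lie, hx, smul_zero]

/-- Since p < q < r, X annihilates the weight lines and is central. Apart from brackets of conjugate
pairs, nonzero brackets occur only when r = p + q. Coincidences such as q = 2p send a vector to a
multiple of its own conjugate, and such a multiple is zero. -/
theorem false_of_distinct_weights (H : SkewTorus T σ) {e₁ e₂ e₃ X : N} {p q r : ℝ}
    (hspan : ⊤ ≤ Submodule.span ℂ (Set.range ![e₁, e₂, e₃, σ e₁, σ e₂, σ e₃, X]))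
    (n₁ : e₁ ≠ 0) (n₂ : e₂ ≠ 0) (n₃ : e₃ ≠ 0) (hp : 0 < p) (hpq : p < q) (hqr : q < r)
    (t₁ : HasWeight T p e₁) (t₂ : HasWeight T q e₂) (t₃ : HasWeight T r e₃)
    (tX : HasWeight T 0 X) : False := by
  have hT := hasWeight_frame t₁ t₂ t₃ (H.weight_conj t₁) (H.weight_conj t₂) (H.weight_conj t₃) tX
  have x₁ : ⁅X, e₁⁆ = 0 := by
    obtain ⟨c, hc⟩ := H.exists_smul_of_weight hspan hT (H.weight_lie tX t₁) 0 (by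
      intro i hi; fin_cases i <;> first | exact absurd rfl hi | (intro h; dsimp at h; linarith))
    change _ = c • e₁ at hc
    rw [hc, eq_zero_of_lie_eq_smul H.nil n₁ hc, zero_smul]
  have x₂ : ⁅X, e₂⁆ = 0 := by
    obtain ⟨c, hc⟩ := H.exists_smul_of_weight hspan hT (H.weight_lie tX t₂) 1 (by
      intro i hi; fin_cases i <;> first | exact absurd rfl hi | (intro h; dsimp at h; linarith))
    change _ = c • e₂ at hc
    rw [hc, eq_zero_of_lie_eq_smul H.nil n₂ hc, zero_smul]
  have x₃ : ⁅X, e₃⁆ = 0 := by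
    obtain ⟨c, hc⟩ := H.exists_smul_of_weight hspan hT (H.weight_lie tX t₃) 2 (by
      intro i hi; fin_cases i <;> first | exact absurd rfl hi | (intro h; dsimp at h; linarith))
    change _ = c • e₃ at hc
    rw [hc, eq_zero_of_lie_eq_smul H.nil n₃ hc, zero_smul]
  have hzero : ∀ {v : N}, HasWeight T 0 v → ∃ c : ℂ, v = c • X := fun hv =>
    H.exists_smul_of_weight hspan hT hv 6 (by
      intro i hi; fin_cases i <;> first | exact absurd rfl hi | (intro h; dsimp at h; linarith))
  obtain ⟨ε, hε⟩ := hzero (by simpa using H.weight_conj tX)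
  have hXσ : ∀ {e : N}, ⁅X, e⁆ = 0 → ⁅X, σ e⁆ = 0 := fun {e} h => by
    have h1 : ⁅σ X, e⁆ = 0 := by rw [hε, smul_lie, h, smul_zero]
    simpa only [H.conj_conj] using H.lie_conj_eq_zero h1
  have hX : ∀ y : N, ⁅y, X⁆ = 0 := lie_eq_zero_of_span hspan (by
    intro i
    rw [← lie_skew, neg_eq_zero]
    fin_cases i
    · exact x₁
    · exact x₂
    · exact x₃
    · exact hXσ x₁
    · exact hXσ x₂
    · exact hXσ x₃
    · exact lie_self X)
  obtain ⟨h₁, k11⟩ := hzero (v := ⁅e₁, σ e₁⁆) (by simpa using H.weight_lie t₁ (H.weight_conj t₁))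
  obtain ⟨h₂, k22⟩ := hzero (v := ⁅e₂, σ e₂⁆) (by simpa using H.weight_lie t₂ (H.weight_conj t₂))
  obtain ⟨h₃, k33⟩ := hzero (v := ⁅e₃, σ e₃⁆) (by simpa using H.weight_lie t₃ (H.weight_conj t₃))
  have h13 : ⁅e₁, e₃⁆ = 0 := H.eq_zero_of_weight hspan hT (H.weight_lie t₁ t₃) (by
    intro i; fin_cases i <;> (intro h; dsimp at h; linarith))
  have h23 : ⁅e₂, e₃⁆ = 0 := H.eq_zero_of_weight hspan hT (H.weight_lie t₂ t₃) (by
    intro i; fin_cases i <;> (intro h; dsimp at h; linarith))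
  obtain ⟨κ, h12⟩ : ∃ κ : ℂ, ⁅e₁, e₂⁆ = κ • e₃ :=
    H.exists_smul_of_weight hspan hT (H.weight_lie t₁ t₂) 2 (by
      intro i hi; fin_cases i <;> first | exact absurd rfl hi | (intro h; dsimp at h; linarith))
  have k12 : ⁅e₁, σ e₂⁆ = 0 := by
    obtain ⟨c, hc⟩ := H.exists_smul_of_weight hspan hT (H.weight_lie t₁ (H.weight_conj t₂)) 3 (by
      intro i hi; fin_cases i <;> first | exact absurd rfl hi | (intro h; dsimp at h; linarith))
    exact H.lie_conj_eq_zero_of_eq_smul n₁ hc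
  -- If r = p + q the bracket has weight -q. Otherwise only the weight -p could occur, and then the
  -- multiple of σ e₁ vanishes.
  obtain ⟨lam, k13⟩ : ∃ lam : ℂ, ⁅e₁, σ e₃⁆ = lam • σ e₂ := by
    by_cases hr : r = p + q
    · exact H.exists_smul_of_weight hspan hT (H.weight_lie t₁ (H.weight_conj t₃)) 4 (by
        intro i hi; fin_cases i <;> first | exact absurd rfl hi | (intro h; dsimp at h; linarith))
    · obtain ⟨c, hc⟩ := H.exists_smul_of_weight hspan hT (H.weight_lie t₁ (H.weight_conj t₃)) 3 (by
        intro i hi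
        fin_cases i <;> first
          | exact absurd rfl hi
          | (intro h; dsimp at h; first | linarith | exact hr (by linarith)))
      exact ⟨0, by rw [zero_smul]; exact H.lie_conj_eq_zero_of_eq_smul n₁ hc⟩
  obtain ⟨μ, k23⟩ : ∃ μ : ℂ, ⁅e₂, σ e₃⁆ = μ • σ e₁ := by
    by_cases hr : r = p + q
    · exact H.exists_smul_of_weight hspan hT (H.weight_lie t₂ (H.weight_conj t₃)) 3 (by
        intro i hi; fin_cases i <;> first | exact absurd rfl hi | (intro h; dsimp at h; linarith))
    · obtain ⟨c, hc⟩ := H.exists_smul_of_weight hspan hT (H.weight_lie t₂ (H.weight_conj t₃)) 4 (by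
        intro i hi
        fin_cases i <;> first
          | exact absurd rfl hi
          | (intro h; dsimp at h; first | linarith | exact hr (by linarith)))
      exact ⟨0, by rw [zero_smul]; exact H.lie_conj_eq_zero_of_eq_smul n₂ hc⟩
  -- Using σ e₃ as third vector makes the bracket relations symmetric in the three vectors.
  refine H.false_of_triple (u₁ := e₁) (u₂ := e₂) (u₃ := σ e₃) (X := X) ?_ n₁ n₂
    t₁ t₂ (H.weight_conj t₃) tX hX (κ := κ) ?_ k13 k23 k12 ?_ ?_
    k11 k22 (h₃ := -h₃) ?_
  · refine hspan.trans (Submodule.span_mono ?_)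
    rintro _ ⟨i, rfl⟩
    fin_cases i <;> simp [H.conj_conj]
  · rw [H.conj_conj, h12]
  · rw [H.conj_conj, h13]
  · rw [H.conj_conj, h23]
  · rw [H.conj_conj, ← lie_skew, k33, neg_smul]

end SkewTorus

end RigidLie

/-! ### Three equal positive weights -/

namespace RigidLie

open Module

theorem finrank_span_pair_le {K V : Type*} [Field K] [AddCommGroup V] [Module K V] (a₁ a₂ : V) :
    finrank K (Submodule.span K {a₁, a₂}) ≤ 2 := by
  have h := finrank_range_le_card (R := K) ![a₁, a₂]
  rwa [Set.finrank, Matrix.range_cons_cons_empty, Fintype.card_fin] at h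

/-- By nilpotency the brackets of S with the plane span a proper subspace, hence at most a line.
Take u₁ on that line if it is nonzero, and keep the given pair otherwise. -/
theorem exists_flag_of_isNilpotent {K N : Type*} [Field K] [LieRing N] [LieAlgebra K N]
    [FiniteDimensional K N] (hnil : LieRing.IsNilpotent N) {a₁ a₂ : N} (ha : a₁ ≠ 0) {S : Set N}
    (hS : ∀ x ∈ S, ∀ u ∈ Submodule.span K {a₁, a₂}, ⁅x, u⁆ ∈ Submodule.span K {a₁, a₂}) :
    ∃ u₁ u₂ : N, u₁ ≠ 0 ∧ Submodule.span K {a₁, a₂} = Submodule.span K {u₁, u₂} ∧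
      ∀ x ∈ S, ⁅x, u₁⁆ = 0 ∧ ∀ u ∈ Submodule.span K {a₁, a₂}, ∃ c : K, ⁅x, u⁆ = c • u₁ := by
  let V := Submodule.span K {a₁, a₂}
  let W := Submodule.span K {z | ∃ x ∈ S, ∃ u ∈ V, ⁅x, u⁆ = z}
  have haV : a₁ ∈ V := Submodule.subset_span (by simp)
  have hmemW : ∀ x ∈ S, ∀ u ∈ V, ⁅x, u⁆ ∈ W := fun x hx u hu =>
    Submodule.subset_span ⟨x, hx, u, hu, rfl⟩
  have hWV : W ≤ V := by
    refine Submodule.span_le.mpr ?_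
    rintro _ ⟨x, hx, u, hu, rfl⟩
    exact hS x hx u hu
  have hWV' : W < V := by
    refine lt_of_le_of_ne hWV fun h => ?_
    have h0 : V = ⊥ := by
      refine eq_bot_of_le_span_lie (K := K) hnil ?_
      conv_lhs => rw [← h]
      refine Submodule.span_mono ?_
      rintro _ ⟨x, -, u, hu, rfl⟩
      exact ⟨x, u, hu, rfl⟩
    rw [h0, Submodule.mem_bot] at haV
    exact ha haV
  have hV2 : finrank K V ≤ 2 := finrank_span_pair_le a₁ a₂
  have hW1 := Submodule.finrank_lt_finrank_of_lt hWV'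
  by_cases hW0 : W = ⊥
  · have h0 : ∀ x ∈ S, ∀ u ∈ V, ⁅x, u⁆ = 0 := fun x hx u hu => by
      have := hmemW x hx u hu
      rwa [hW0, Submodule.mem_bot] at this
    exact ⟨a₁, a₂, ha, rfl, fun x hx => ⟨h0 x hx a₁ haV, fun u hu =>
      ⟨0, by rw [zero_smul, h0 x hx u hu]⟩⟩⟩
  · obtain ⟨u₁, hu₁, hu₁0⟩ := Submodule.exists_mem_ne_zero_of_ne_bot hW0
    have hle : Submodule.span K {u₁} ≤ W := (Submodule.span_singleton_le_iff_mem u₁ W).mpr hu₁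
    have hWu : W = Submodule.span K {u₁} := by
      refine (Submodule.eq_of_le_of_finrank_le hle ?_).symm
      rw [finrank_span_singleton hu₁0]
      omega
    obtain ⟨u₂, hu₂, hVle⟩ := exists_le_sup_span_singleton_of_finrank_le hWV (by
      rw [hWu, finrank_span_singleton hu₁0]
      omega)
    have hmul : ∀ x ∈ S, ∀ u ∈ V, ∃ c : K, ⁅x, u⁆ = c • u₁ := fun x hx u hu => by
      have := hmemW x hx u hu
      rw [hWu, Submodule.mem_span_singleton] at this
      exact this.imp fun c hc => hc.symm
    refine ⟨u₁, u₂, hu₁0, ?_, fun x hx => ⟨?_, hmul x hx⟩⟩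
    · rw [Submodule.span_insert u₁, ← hWu]
      exact le_antisymm hVle (sup_le hWV ((Submodule.span_singleton_le_iff_mem _ _).mpr hu₂))
    · obtain ⟨c, hc⟩ := hmul x hx u₁ (hWV hu₁)
      rw [hc, eq_zero_of_lie_eq_smul hnil hu₁0 hc, zero_smul]

theorem span_pair_eq_of_ne {K V : Type*} [Field K] [AddCommGroup V] [Module K V]
    {a₁ a₂ u₁ u₂ : V} (h₁ : u₁ ∈ Submodule.span K {a₁, a₂}) (h₂ : u₂ ∈ Submodule.span K {a₁, a₂})
    (hu₁ : u₁ ≠ 0) (hu₂ : ∀ t : K, u₂ ≠ t • u₁) :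
    Submodule.span K {a₁, a₂} = Submodule.span K {u₁, u₂} := by
  have hle : Submodule.span K {u₁, u₂} ≤ Submodule.span K {a₁, a₂} :=
    Submodule.span_le.mpr (by
      rintro x (rfl | hx)
      · exact h₁
      · rw [Set.mem_singleton_iff] at hx
        rw [hx]
        exact h₂)
  have hfd : FiniteDimensional K (Submodule.span K {a₁, a₂}) :=
    FiniteDimensional.span_of_finite K (by simp)
  refine (Submodule.eq_of_le_of_finrank_le hle ?_).symm
  have hli : LinearIndependent K ![u₁, u₂] :=
    (LinearIndependent.pair_iff' hu₁).mpr fun t h => hu₂ t h.symm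
  have h2 := finrank_span_eq_card hli
  rw [Matrix.range_cons_cons_empty, Fintype.card_fin] at h2
  rw [h2]
  exact finrank_span_pair_le a₁ a₂

namespace SkewTorus

variable {N : Type*} [LieRing N] [LieAlgebra ℂ N] {T : Module.End ℂ N} {σ : N → N}

theorem conj_mem_span (H : SkewTorus T σ) {S : Set N} {a : N} (h : a ∈ Submodule.span ℂ S) :
    σ a ∈ Submodule.span ℂ (σ '' S) := by
  induction h using Submodule.span_induction with
  | mem x hx => exact Submodule.subset_span ⟨x, hx, rfl⟩
  | zero =>
    rw [H.conj_zero]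
    exact zero_mem _
  | add x y _ _ hx hy =>
    rw [H.conj_add]
    exact add_mem hx hy
  | smul c x _ hx =>
    rw [H.conj_smul]
    exact Submodule.smul_mem _ _ hx

/-- The conjugate-linear operator u ↦ ⁅w, σ u⁆ has no nonzero eigenvalue: conjugating gives ⁅w, ⁅σ
w, u⁆⁆ = |c|² u. -/
theorem eq_zero_of_lie_conj_eq_smul (H : SkewTorus T σ) {w u : N} {c : ℂ} (hu : u ≠ 0)
    (h : ⁅w, σ u⁆ = c • u) : c = 0 := by
  have h1 := H.lie_conj_eq h
  rw [H.conj_conj] at h1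
  have h2 : ⁅w, ⁅σ w, u⁆⁆ = (starRingEnd ℂ c * c) • u := by rw [h1, lie_smul, h, smul_smul]
  have h3 := eq_zero_of_lie_lie_eq_smul H.nil hu h2
  rcases mul_eq_zero.mp h3 with h | h
  · exact (map_eq_zero _).mp h
  · exact h

theorem HasWeight.lie_zero_left (H : SkewTorus T σ) {s : ℝ} {X u : N} (hX : HasWeight T 0 X)
    (hu : HasWeight T s u) : HasWeight T s ⁅X, u⁆ := by
  simpa using H.weight_lie hX hu

/-- The conjugate of the action of a vector spanning a `σ`-stable line. -/
theorem exists_lie_conj_eq (H : SkewTorus T σ) {X u v : N} {c ε : ℂ} (hX : X ≠ 0)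
    (hε : σ X = ε • X) (h : ⁅X, u⁆ = c • v) :
    ∃ c' : ℂ, ⁅X, σ u⁆ = c' • σ v ∧ (c ≠ 0 → c' ≠ 0) := by
  have hε0 : ε ≠ 0 := by
    rintro rfl
    rw [zero_smul] at hε
    exact H.conj_ne_zero hX hε
  have h1 := H.lie_conj_eq h
  rw [hε, smul_lie] at h1
  refine ⟨ε⁻¹ * starRingEnd ℂ c, ?_, fun hc => ?_⟩
  · rw [mul_smul, ← h1, inv_smul_smul₀ hε0]
  · exact mul_ne_zero (inv_ne_zero hε0) (by simpa using hc)

/-- Degree 1 for e₂, e₃, degree 2 for X and degree 3 for c, and likewise for conjugates: the only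
nonzero brackets are eᵢ with σ eⱼ into ℂX, and X with eᵢ, σ eᵢ into ℂc, ℂσ c. -/
theorem false_of_equal_weights_of_noncentral (H : SkewTorus T σ) {c e₂ e₃ X : N} {p : ℝ} {ε : ℂ}
    (hspan : ⊤ ≤ Submodule.span ℂ (Set.range ![c, e₂, e₃, σ c, σ e₂, σ e₃, X]))
    (tc : HasWeight T p c) (t₂ : HasWeight T p e₂) (t₃ : HasWeight T p e₃)
    (tX : HasWeight T 0 X) (hX : X ≠ 0) (hε : σ X = ε • X)
    (hEE : ∀ u v : N, HasWeight T p u → HasWeight T p v → ⁅u, v⁆ = 0)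
    (hEF : ∀ u v : N, HasWeight T p u → HasWeight T (-p) v → ∃ h : ℂ, ⁅u, v⁆ = h • X)
    (hXE : ∀ u : N, HasWeight T p u → ∃ α : ℂ, ⁅X, u⁆ = α • c)
    (hXc : ⁅X, c⁆ = 0) (hcF : ∀ v : N, HasWeight T (-p) v → ⁅c, v⁆ = 0) : False := by
  have sc := H.weight_conj tc
  have s₂ := H.weight_conj t₂
  have s₃ := H.weight_conj t₃
  obtain ⟨α₂, x₂⟩ := hXE e₂ t₂
  obtain ⟨α₃, x₃⟩ := hXE e₃ t₃
  obtain ⟨β₂, y₂, -⟩ := H.exists_lie_conj_eq hX hε x₂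
  obtain ⟨β₃, y₃, -⟩ := H.exists_lie_conj_eq hX hε x₃
  obtain ⟨β₁, y₁, -⟩ := H.exists_lie_conj_eq (c := 0) (v := 0) hX hε (by rw [hXc, zero_smul])
  rw [H.conj_zero, smul_zero] at y₁
  obtain ⟨h22, k22⟩ := hEF _ _ t₂ s₂
  obtain ⟨h23, k23⟩ := hEF _ _ t₂ s₃
  obtain ⟨h32, k32⟩ := hEF _ _ t₃ s₂
  obtain ⟨h33, k33⟩ := hEF _ _ t₃ s₃
  have kc1 := hcF _ sc
  have kc2 := hcF _ s₂
  have kc3 := hcF _ s₃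
  have k2c := H.lie_conj_swap_eq_zero kc2
  have k3c := H.lie_conj_swap_eq_zero kc3
  have hc2 := hEE _ _ tc t₂
  have hc3 := hEE _ _ tc t₃
  have h23' := hEE _ _ t₂ t₃
  have gc2 := H.lie_conj_eq_zero hc2
  have gc3 := H.lie_conj_eq_zero hc3
  have g23 := H.lie_conj_eq_zero h23'
  rw [← lie_skew, neg_eq_zero] at hXc y₁
  rw [← lie_skew, neg_eq_iff_eq_neg] at x₂ x₃ y₂ y₃
  have hT := hasWeight_frame tc t₂ t₃ sc s₂ s₃ tX
  refine H.false_of_grading hspan hT ![3, 1, 1, 3, 1, 1, 2] ?_ 6 6 (by simp) (by simp)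
  intro D hD i j hij
  have d0 : D c = (3 : ℂ) • c := hD 0
  have d3 : D (σ c) = (3 : ℂ) • σ c := hD 3
  have d6 : D X = (2 : ℂ) • X := hD 6
  fin_cases i <;> fin_cases j <;> first
    | exact absurd hij (by decide)
    | (simp [hXc, y₁, x₂, x₃, y₂, y₃, k22, k23, k32, k33, kc1, kc2, kc3, k2c, k3c, hc2, hc3, h23',
        gc2, gc3, g23, d0, d3, d6]
       try module)

theorem false_of_equal_weights (H : SkewTorus T σ) {e₁ e₂ e₃ X : N} {p : ℝ}
    (hspan : ⊤ ≤ Submodule.span ℂ (Set.range ![e₁, e₂, e₃, σ e₁, σ e₂, σ e₃, X]))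
    (hX : X ≠ 0) (hp : 0 < p)
    (t₁ : HasWeight T p e₁) (t₂ : HasWeight T p e₂) (t₃ : HasWeight T p e₃)
    (tX : HasWeight T 0 X) : False := by
  have s₁ := H.weight_conj t₁
  have s₂ := H.weight_conj t₂
  have s₃ := H.weight_conj t₃
  have hT := hasWeight_frame t₁ t₂ t₃ s₁ s₂ s₃ tX
  have hzero : ∀ {v : N}, HasWeight T 0 v → ∃ c : ℂ, v = c • X := fun hv =>
    H.exists_smul_of_weight hspan hT hv 6 (by
      intro i hi; fin_cases i <;> first | exact absurd rfl hi | (intro h; dsimp at h; linarith))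
  obtain ⟨ε, hε⟩ := hzero (by simpa using H.weight_conj tX)
  have hEE : ∀ u v : N, HasWeight T p u → HasWeight T p v → ⁅u, v⁆ = 0 := fun u v hu hv =>
    H.eq_zero_of_weight hspan hT (H.weight_lie hu hv) (by
      intro i; fin_cases i <;> (intro h; dsimp at h; linarith))
  have hEF : ∀ u v : N, HasWeight T p u → HasWeight T (-p) v → ∃ h : ℂ, ⁅u, v⁆ = h • X :=
    fun u v hu hv => hzero (by simpa using H.weight_lie hu hv)
  have hE : ∀ v, HasWeight T p v → ∃ x y z : ℂ, v = x • e₁ + y • e₂ + z • e₃ := by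
    intro v hv
    obtain ⟨c, hc, hc'⟩ := H.exists_coeff hspan hT hv
    refine ⟨c 0, c 1, c 2, ?_⟩
    have z3 := hc' 3 (by intro h; dsimp at h; linarith)
    have z4 := hc' 4 (by intro h; dsimp at h; linarith)
    have z5 := hc' 5 (by intro h; dsimp at h; linarith)
    have z6 := hc' 6 (by intro h; dsimp at h; linarith)
    rw [Fin.sum_univ_seven, z3, z4, z5, z6] at hc
    simpa using hc
  have k11 := hEF _ _ t₁ s₁
  have k12 := hEF _ _ t₁ s₂
  have k13 := hEF _ _ t₁ s₃
  have k21 := hEF _ _ t₂ s₁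
  have k22 := hEF _ _ t₂ s₂
  have k23 := hEF _ _ t₂ s₃
  have k31 := hEF _ _ t₃ s₁
  have k32 := hEF _ _ t₃ s₂
  have k33 := hEF _ _ t₃ s₃
  have h12 := hEE _ _ t₁ t₂
  have h13 := hEE _ _ t₁ t₃
  have h23 := hEE _ _ t₂ t₃
  have g12 := H.lie_conj_eq_zero h12
  have g13 := H.lie_conj_eq_zero h13
  have g23 := H.lie_conj_eq_zero h23
  by_cases hcen : ∀ u, HasWeight T p u → ⁅X, u⁆ = 0
  · have hcen' : ∀ u, HasWeight T p u → ⁅u, X⁆ = 0 := fun u hu => by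
      rw [← lie_skew, hcen u hu, neg_zero]
    have hcen'' : ∀ u, HasWeight T p u → ⁅σ u, X⁆ = 0 := fun u hu => by
      obtain ⟨c, hc, -⟩ := H.exists_lie_conj_eq (c := 0) (v := 0) hX hε
        (by rw [hcen u hu, zero_smul])
      rw [← lie_skew, hc, H.conj_zero, smul_zero, neg_zero]
    obtain ⟨_, k11⟩ := k11
    obtain ⟨_, k12⟩ := k12
    obtain ⟨_, k13⟩ := k13
    obtain ⟨_, k21⟩ := k21
    obtain ⟨_, k22⟩ := k22
    obtain ⟨_, k23⟩ := k23
    obtain ⟨_, k31⟩ := k31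
    obtain ⟨_, k32⟩ := k32
    obtain ⟨_, k33⟩ := k33
    refine H.false_of_grading hspan hT ![1, 1, 1, 1, 1, 1, 2] ?_ 6 6 (by simp) (by simp)
    intro D hD i j hij
    have d6 : D X = (2 : ℂ) • X := hD 6
    fin_cases i <;> fin_cases j <;> first
      | exact absurd hij (by decide)
      | (simp [k11, k12, k13, k21, k22, k23, k31, k32, k33, h12, h13, h23, g12, g13, g23,
          hcen' _ t₁, hcen' _ t₂, hcen' _ t₃, hcen'' _ t₁, hcen'' _ t₂, hcen'' _ t₃, d6]
         try module)
  -- If the spaces of weight p and -p commute, X may be given degree 0 and the rest degree 1; the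
  -- offending pair is then e₁, σ e₁.
  by_cases hEF0 : ∀ u v : N, HasWeight T p u → HasWeight T (-p) v → ⁅u, v⁆ = 0
  · refine H.false_of_grading hspan hT ![1, 1, 1, 1, 1, 1, 0] ?_ 0 3 (by simp) (by simp)
    intro D hD i j hij
    have hDp : ∀ u, HasWeight T p u → D u = u := by
      intro u hu
      obtain ⟨x, y, z, rfl⟩ := hE u hu
      have d0 : D e₁ = (1 : ℂ) • e₁ := hD 0
      have d1 : D e₂ = (1 : ℂ) • e₂ := hD 1
      have d2 : D e₃ = (1 : ℂ) • e₃ := hD 2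
      simp only [map_add, map_smul, d0, d1, d2, one_smul]
    have hDm : ∀ u, HasWeight T p u → D (σ u) = σ u := by
      intro u hu
      obtain ⟨x, y, z, rfl⟩ := hE u hu
      have d0 : D (σ e₁) = (1 : ℂ) • σ e₁ := hD 3
      have d1 : D (σ e₂) = (1 : ℂ) • σ e₂ := hD 4
      have d2 : D (σ e₃) = (1 : ℂ) • σ e₃ := hD 5
      simp only [H.conj_add, H.conj_smul, map_add, map_smul, d0, d1, d2, one_smul]
    have hDX : ∀ u, HasWeight T p u → D ⁅u, X⁆ = ⁅u, X⁆ := fun u hu => by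
      rw [← lie_skew, map_neg, hDp _ (HasWeight.lie_zero_left H tX hu)]
    have hDX' : ∀ u, HasWeight T p u → D ⁅σ u, X⁆ = ⁅σ u, X⁆ := fun u hu => by
      have h1 : HasWeight T p ⁅σ X, u⁆ := by
        simpa using H.weight_lie (H.weight_conj tX) hu
      have h2 : ⁅σ u, X⁆ = σ (-⁅σ X, u⁆) := by
        rw [lie_skew, H.conj_lie, H.conj_conj]
      rw [h2, H.conj_neg, map_neg, hDm _ h1]
    have hm : ∀ u v : N, HasWeight T p u → HasWeight T p v → ⁅u, σ v⁆ = 0 := fun u v hu hv =>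
      hEF0 _ _ hu (H.weight_conj hv)
    fin_cases i <;> fin_cases j <;> first
      | exact absurd hij (by decide)
      | (simp [h12, h13, h23, g12, g13, g23, hDX _ t₁, hDX _ t₂, hDX _ t₃, hDX' _ t₁, hDX' _ t₂,
          hDX' _ t₃, hm _ _ t₁ t₁, hm _ _ t₁ t₂, hm _ _ t₁ t₃, hm _ _ t₂ t₁, hm _ _ t₂ t₂,
          hm _ _ t₂ t₃, hm _ _ t₃ t₁, hm _ _ t₃ t₂, hm _ _ t₃ t₃])
  push Not at hEF0
  obtain ⟨u₀, v₀, hu₀, hv₀, huv⟩ := hEF0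
  obtain ⟨h₀, hh₀⟩ := hEF _ _ hu₀ hv₀
  have hh₀0 : h₀ ≠ 0 := by
    rintro rfl
    exact huv (by rw [hh₀, zero_smul])
  -- Jacobi for u₀, v₀, u. As h₀ ≠ 0, it shows that ad X has rank one on the weight-p space, with
  -- image spanned by c = ⁅X, u₀⁆.
  have hXE : ∀ u : N, HasWeight T p u → ∀ h : ℂ, ⁅u, v₀⁆ = h • X → h₀ • ⁅X, u⁆ = h • ⁅X, u₀⁆ := by
    intro u hu h huh
    rw [← smul_lie, ← hh₀, lie_lie, hEE _ _ hu₀ hu, lie_zero, sub_zero, ← lie_skew v₀ u, huh,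
      lie_neg, lie_smul, ← lie_skew X u₀, smul_neg]
  have hXE' : ∀ u : N, HasWeight T p u → ∃ α : ℂ, ⁅X, u⁆ = α • ⁅X, u₀⁆ := by
    intro u hu
    obtain ⟨h, hh⟩ := hEF _ _ hu hv₀
    exact ⟨h₀⁻¹ * h, by rw [mul_smul, ← hXE u hu h hh, inv_smul_smul₀ hh₀0]⟩
  have hc0 : ⁅X, u₀⁆ ≠ 0 := by
    intro h
    refine hcen fun u hu => ?_
    obtain ⟨α, hα⟩ := hXE' u hu
    rw [hα, h, smul_zero]
  have tc := HasWeight.lie_zero_left H tX hu₀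
  generalize hc : ⁅X, u₀⁆ = c at *
  have hXc : ⁅X, c⁆ = 0 := by
    obtain ⟨α, hα⟩ := hXE' c tc
    rw [hα, eq_zero_of_lie_eq_smul H.nil hc0 hα, zero_smul]
  -- The same identity with c in place of u: X kills c, so the coefficient of ⁅c, v⁆ must vanish.
  have hcF : ∀ v : N, HasWeight T (-p) v → ⁅c, v⁆ = 0 := by
    intro v hv
    obtain ⟨h, hh⟩ := hEF _ _ tc hv
    obtain ⟨k, hk⟩ := hEF _ _ hu₀ hv
    have h1 : h • ⁅X, u₀⁆ = k • ⁅X, c⁆ := by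
      rw [← smul_lie, ← hh, lie_lie, hEE _ _ tc hu₀, lie_zero, sub_zero, ← lie_skew v u₀, hk,
        lie_neg, lie_smul, ← lie_skew X c, smul_neg]
    rw [hc, hXc, smul_zero] at h1
    rw [hh, (smul_eq_zero.mp h1).resolve_right hc0, zero_smul]
  obtain ⟨x, y, z, hxyz⟩ := hE c tc
  have main : ∀ a₂ a₃ : N, HasWeight T p a₂ → HasWeight T p a₃ →
      e₁ ∈ Submodule.span ℂ {c, a₂, a₃} → e₂ ∈ Submodule.span ℂ {c, a₂, a₃} →
      e₃ ∈ Submodule.span ℂ {c, a₂, a₃} → False := by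
    intro a₂ a₃ ha₂ ha₃ m₁ m₂ m₃
    refine H.false_of_equal_weights_of_noncentral (hspan.trans (Submodule.span_le.mpr ?_)) tc ha₂
      ha₃ tX hX hε hEE hEF hXE' hXc hcF
    have hsub : Submodule.span ℂ {c, a₂, a₃} ≤
        Submodule.span ℂ (Set.range ![c, a₂, a₃, σ c, σ a₂, σ a₃, X]) := by
      refine Submodule.span_mono ?_
      rintro x (rfl | rfl | rfl)
      exacts [⟨0, rfl⟩, ⟨1, rfl⟩, ⟨2, rfl⟩]
    have hsub' : Submodule.span ℂ (σ '' {c, a₂, a₃}) ≤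
        Submodule.span ℂ (Set.range ![c, a₂, a₃, σ c, σ a₂, σ a₃, X]) := by
      refine Submodule.span_mono ?_
      rintro _ ⟨x, rfl | rfl | rfl, rfl⟩
      exacts [⟨3, rfl⟩, ⟨4, rfl⟩, ⟨5, rfl⟩]
    rintro _ ⟨i, rfl⟩
    fin_cases i
    · exact hsub m₁
    · exact hsub m₂
    · exact hsub m₃
    · exact hsub' (H.conj_mem_span m₁)
    · exact hsub' (H.conj_mem_span m₂)
    · exact hsub' (H.conj_mem_span m₃)
    · exact Submodule.subset_span ⟨6, rfl⟩
  have hmem : ∀ {a₁ a₂ a₃ : N} {x y z : ℂ}, x ≠ 0 → c = x • a₁ + y • a₂ + z • a₃ →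
      a₁ ∈ Submodule.span ℂ {c, a₂, a₃} := by
    intro a₁ a₂ a₃ x y z hx h
    have h4 : a₁ = x⁻¹ • c + (-(x⁻¹ * y)) • a₂ + (-(x⁻¹ * z)) • a₃ := by
      rw [h, smul_add, smul_add, inv_smul_smul₀ hx]
      module
    rw [h4]
    refine add_mem (add_mem ?_ ?_) ?_ <;>
      exact Submodule.smul_mem _ _ (Submodule.subset_span (by simp))
  obtain ⟨x, y, z, hxyz⟩ := hE c tc
  by_cases hx : x = 0
  · by_cases hy : y = 0
    · have hz : z ≠ 0 := by
        rintro rfl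
        rw [hx, hy] at hxyz
        exact hc0 (by simpa using hxyz)
      exact main e₁ e₂ t₁ t₂ (Submodule.subset_span (by simp)) (Submodule.subset_span (by simp))
        (hmem (y := x) (z := y) hz (by rw [hxyz]; abel))
    · exact main e₁ e₃ t₁ t₃ (Submodule.subset_span (by simp))
        (hmem (y := x) (z := z) hy (by rw [hxyz]; abel)) (Submodule.subset_span (by simp))
  · exact main e₂ e₃ t₂ t₃ (hmem hx hxyz) (Submodule.subset_span (by simp))
      (Submodule.subset_span (by simp))

end SkewTorus

end RigidLie

/-! ### Two equal positive weights and a third different one -/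

namespace RigidLie

open Module

namespace SkewTorus

variable {N : Type*} [LieRing N] [LieAlgebra ℂ N] {T : Module.End ℂ N} {σ : N → N}

theorem span_replace_pair (H : SkewTorus T σ) {a₁ a₂ u₁ u₂ x y z : N}
    (hspan : ⊤ ≤ Submodule.span ℂ (Set.range ![a₁, a₂, x, σ a₁, σ a₂, y, z]))
    (h : Submodule.span ℂ {a₁, a₂} = Submodule.span ℂ {u₁, u₂}) :
    ⊤ ≤ Submodule.span ℂ (Set.range ![u₁, u₂, x, σ u₁, σ u₂, y, z]) := by
  have m₁ : a₁ ∈ Submodule.span ℂ {u₁, u₂} := h ▸ Submodule.subset_span (by simp)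
  have m₂ : a₂ ∈ Submodule.span ℂ {u₁, u₂} := h ▸ Submodule.subset_span (by simp)
  have hsub : Submodule.span ℂ {u₁, u₂} ≤
      Submodule.span ℂ (Set.range ![u₁, u₂, x, σ u₁, σ u₂, y, z]) := by
    refine Submodule.span_mono ?_
    rintro _ (rfl | rfl)
    exacts [⟨0, rfl⟩, ⟨1, rfl⟩]
  have hsub' : Submodule.span ℂ (σ '' {u₁, u₂}) ≤
      Submodule.span ℂ (Set.range ![u₁, u₂, x, σ u₁, σ u₂, y, z]) := by
    refine Submodule.span_mono ?_
    rintro _ ⟨x, rfl | rfl, rfl⟩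
    exacts [⟨3, rfl⟩, ⟨4, rfl⟩]
  refine hspan.trans (Submodule.span_le.mpr ?_)
  rintro _ ⟨i, rfl⟩
  fin_cases i
  · exact hsub m₁
  · exact hsub m₂
  · exact Submodule.subset_span ⟨2, rfl⟩
  · exact hsub' (H.conj_mem_span m₁)
  · exact hsub' (H.conj_mem_span m₂)
  · exact Submodule.subset_span ⟨5, rfl⟩
  · exact Submodule.subset_span ⟨6, rfl⟩

/-- Bracket relations in the case where the weights are `±p` (twice), `±r` (once) and `0`. -/
structure PairRelations (T : Module.End ℂ N) (σ : N → N) (p r : ℝ) (w X : N) (ε : ℂ) : Prop where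
  ne_zero : X ≠ 0
  weight_w : HasWeight T r w
  weight_X : HasWeight T 0 X
  conj_X : σ X = ε • X
  zero : ∀ v, HasWeight T 0 v → ∃ c : ℂ, v = c • X
  lie_pos : ∀ u v, HasWeight T p u → HasWeight T p v → ∃ κ : ℂ, ⁅u, v⁆ = κ • w
  lie_w : ∀ u, HasWeight T p u → ⁅u, w⁆ = 0
  X_w : ⁅X, w⁆ = 0
  w_neg : ∀ u, HasWeight T p u → HasWeight T p ⁅w, σ u⁆

theorem pairRelations (H : SkewTorus T σ) {a₁ a₂ w X : N} {p r : ℝ}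
    (hspan : ⊤ ≤ Submodule.span ℂ (Set.range ![a₁, a₂, w, σ a₁, σ a₂, σ w, X]))
    (hX : X ≠ 0) (hw : w ≠ 0) (hp : 0 < p) (hr : 0 < r) (hpr : p ≠ r)
    (t₁ : HasWeight T p a₁) (t₂ : HasWeight T p a₂) (tw : HasWeight T r w)
    (tX : HasWeight T 0 X) : ∃ ε, PairRelations T σ p r w X ε := by
  have hT := hasWeight_frame t₁ t₂ tw (H.weight_conj t₁) (H.weight_conj t₂) (H.weight_conj tw) tX
  have hpr' : r ≠ p := hpr.symm
  have hzero : ∀ v : N, HasWeight T 0 v → ∃ c : ℂ, v = c • X := fun v hv =>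
    H.exists_smul_of_weight hspan hT hv 6 (by
      intro i hi; fin_cases i <;> first | exact absurd rfl hi | (intro h; dsimp at h; linarith))
  obtain ⟨ε, hε⟩ := hzero (σ X) (by simpa using H.weight_conj tX)
  refine ⟨ε, hX, tw, tX, hε, hzero, fun u v hu hv => ?_, fun u hu => ?_, ?_, fun u hu => ?_⟩
  · exact H.exists_smul_of_weight hspan hT (H.weight_lie hu hv) 2 (by
      intro i hi; fin_cases i <;> first | exact absurd rfl hi | (intro h; dsimp at h; linarith))
  · exact H.eq_zero_of_weight hspan hT (H.weight_lie hu tw) (by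
      intro i; fin_cases i <;> (intro h; dsimp at h; linarith))
  · obtain ⟨c, hc⟩ := H.exists_smul_of_weight hspan hT (HasWeight.lie_zero_left H tX tw) 2 (by
      intro i hi
      fin_cases i <;> first
        | exact absurd rfl hi
        | (intro h; dsimp at h; first | linarith | exact hpr h))
    change _ = c • w at hc
    rw [hc, eq_zero_of_lie_eq_smul H.nil hw hc, zero_smul]
  · have h1 := H.weight_lie tw (H.weight_conj hu)
    -- The weight r - p equals p exactly when r = 2p. Otherwise it can at most equal -r, giving a
    -- multiple of σ w, which vanishes.
    by_cases h2 : r = 2 * p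
    · have h3 : r + -p = p := by linarith
      rwa [h3] at h1
    · obtain ⟨c, hc⟩ := H.exists_smul_of_weight hspan hT h1 5 (by
        intro i hi
        fin_cases i <;> first
          | exact absurd rfl hi
          | (intro h; dsimp at h; first | linarith | exact h2 (by linarith) |
              exact hpr (by linarith)))
      rw [H.lie_conj_eq_zero_of_eq_smul hw hc, HasWeight, map_zero, smul_zero]

/-- Two gradings according to ⁅e₁, σ e₂⁆ = b X. If b = 0, e₁ has degree 2, e₂ and w degree 1, X
degree 2. If b ≠ 0, the degrees 3, 1, 2, 4 of e₁, e₂, w, X work once the X-component of ⁅e₂, σ e₂⁆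
is removed. -/
theorem false_of_pair_central_of_lie_w (H : SkewTorus T σ) {e₁ e₂ w X : N} {p r : ℝ} {ε : ℂ}
    (P : PairRelations T σ p r w X ε)
    (hspan : ⊤ ≤ Submodule.span ℂ (Set.range ![e₁, e₂, w, σ e₁, σ e₂, σ w, X]))
    (t₁ : HasWeight T p e₁) (t₂ : HasWeight T p e₂) (hX : ∀ y : N, ⁅y, X⁆ = 0)
    (h : ⁅e₁, e₂⁆ = 0) (w1 : ⁅w, σ e₁⁆ = 0) (w2 : ⁅w, σ e₂⁆ = e₁) : False := by
  have s₁ := H.weight_conj t₁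
  have s₂ := H.weight_conj t₂
  have sw := H.weight_conj P.weight_w
  have hT := hasWeight_frame t₁ t₂ P.weight_w s₁ s₂ sw P.weight_X
  have hEF : ∀ u v : N, HasWeight T p u → HasWeight T (-p) v → ∃ h : ℂ, ⁅u, v⁆ = h • X :=
    fun u v hu hv => P.zero _ (by simpa using H.weight_lie hu hv)
  have g := H.lie_conj_eq_zero h
  have h1w := P.lie_w _ t₁
  have h2w := P.lie_w _ t₂
  have g1w := H.lie_conj_eq_zero h1w
  have g2w := H.lie_conj_eq_zero h2w
  have v1 := H.lie_conj_swap_eq_zero w1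
  have v2 := H.lie_conj_swap (w := e₁) (c := 1) (by rw [w2, one_smul])
  rw [map_one, one_smul] at v2
  have k11 : ⁅e₁, σ e₁⁆ = 0 := by
    have g' : ⁅σ e₂, σ e₁⁆ = 0 := by rw [← lie_skew, g, neg_zero]
    have h0 : ⁅⁅w, σ e₂⁆, σ e₁⁆ = 0 := by rw [lie_lie, w1, g', lie_zero, lie_zero, sub_zero]
    rwa [w2] at h0
  obtain ⟨b, k12⟩ := hEF _ _ t₁ s₂
  obtain ⟨c, k22⟩ := hEF _ _ t₂ s₂
  obtain ⟨ν, kww⟩ := P.zero ⁅w, σ w⁆ (by simpa using H.weight_lie P.weight_w sw)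
  obtain ⟨b', k21⟩ := hEF _ _ t₂ s₁
  by_cases hb : b = 0
  · rw [hb, zero_smul] at k12
    replace k21 := H.lie_conj_swap_eq_zero k12
    refine H.false_of_grading hspan hT ![2, 1, 1, 2, 1, 1, 2] ?_ 6 6 (by simp) (by simp)
    intro D hD i j hij
    have d0 : D e₁ = (2 : ℂ) • e₁ := hD 0
    have d3 : D (σ e₁) = (2 : ℂ) • σ e₁ := hD 3
    have d6 : D X = (2 : ℂ) • X := hD 6
    fin_cases i <;> fin_cases j <;> first
      | exact absurd hij (by decide)
      | (simp [k11, k12, k21, k22, kww, h, g, h1w, h2w, g1w, g2w, w1, w2, v1, v2, hX, d0, d3, d6]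
         try module)
  -- Only e₂ is changed, while σ e₂ stays: a grading does not need a σ-symmetric basis.
  · have hspan' : ⊤ ≤ Submodule.span ℂ
        (Set.range ![e₁, e₂ - (b⁻¹ * c) • e₁, w, σ e₁, σ e₂, σ w, X]) := by
      refine hspan.trans (Submodule.span_le.mpr ?_)
      generalize b⁻¹ * c = γ
      have m₀ : e₁ ∈ Submodule.span ℂ
          (Set.range ![e₁, e₂ - γ • e₁, w, σ e₁, σ e₂, σ w, X]) :=
        Submodule.subset_span ⟨0, rfl⟩
      have m₁ : e₂ - γ • e₁ ∈ Submodule.span ℂ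
          (Set.range ![e₁, e₂ - γ • e₁, w, σ e₁, σ e₂, σ w, X]) :=
        Submodule.subset_span ⟨1, rfl⟩
      have m₁' := add_mem m₁ (Submodule.smul_mem _ γ m₀)
      rw [sub_add_cancel] at m₁'
      have m : ∀ {v : N}, (∃ i, ![e₁, e₂ - γ • e₁, w, σ e₁, σ e₂, σ w, X] i = v) →
          v ∈ Submodule.span ℂ (Set.range ![e₁, e₂ - γ • e₁, w, σ e₁, σ e₂, σ w, X]) :=
        fun h => Submodule.subset_span h
      have m₂ : w ∈ _ := m ⟨2, rfl⟩
      have m₃ : σ e₁ ∈ _ := m ⟨3, rfl⟩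
      have m₄ : σ e₂ ∈ _ := m ⟨4, rfl⟩
      have m₅ : σ w ∈ _ := m ⟨5, rfl⟩
      have m₆ : X ∈ _ := m ⟨6, rfl⟩
      rintro _ ⟨i, rfl⟩
      fin_cases i
      exacts [m₀, m₁', m₂, m₃, m₄, m₅, m₆]
    have t₂' : HasWeight T p (e₂ - (b⁻¹ * c) • e₁) := by
      rw [HasWeight, map_sub, map_smul, t₁, t₂]
      module
    have k22' : ⁅e₂ - (b⁻¹ * c) • e₁, σ e₂⁆ = 0 := by
      rw [sub_lie, smul_lie, k12, k22, smul_smul, mul_comm, mul_inv_cancel_left₀ hb, sub_self]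
    have k21' : ⁅e₂ - (b⁻¹ * c) • e₁, σ e₁⁆ = b' • X := by
      rw [sub_lie, smul_lie, k11, smul_zero, sub_zero, k21]
    have h' : ⁅e₁, e₂ - (b⁻¹ * c) • e₁⁆ = 0 := by
      rw [lie_sub, lie_smul, lie_self, h, smul_zero, sub_zero]
    have h2w' : ⁅e₂ - (b⁻¹ * c) • e₁, w⁆ = 0 := by
      rw [sub_lie, smul_lie, h1w, h2w, smul_zero, sub_zero]
    have v2' : ⁅e₂ - (b⁻¹ * c) • e₁, σ w⁆ = -σ e₁ := by
      rw [sub_lie, smul_lie, v1, v2, smul_zero, sub_zero]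
    generalize e₂ - (b⁻¹ * c) • e₁ = e at *
    refine H.false_of_grading hspan' (hasWeight_frame t₁ t₂' P.weight_w s₁ s₂ sw P.weight_X)
      ![3, 1, 2, 3, 1, 2, 4] ?_ 6 6 (by simp) (by simp)
    intro D hD i j hij
    have d0 : D e₁ = (3 : ℂ) • e₁ := hD 0
    have d3 : D (σ e₁) = (3 : ℂ) • σ e₁ := hD 3
    have d6 : D X = (4 : ℂ) • X := hD 6
    fin_cases i <;> fin_cases j <;> first
      | exact absurd hij (by decide)
      | (simp [k11, k12, k21', k22', kww, h', g, h1w, h2w', g1w, g2w, w1, w2, v1, v2', hX, d0, d3,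
          d6]
         try module)

/-- If ⁅e₁, e₂⁆ is a nonzero multiple of w, Jacobi makes w commute with the vectors of weight -p and
with σ w, and w can have degree 2. If it is zero, the brackets depend on the conjugate-linear
operator A : u ↦ ⁅w, σ u⁆ on the weight-p plane: either A = 0, or A is nilpotent with A u₂ = u₁ and
A u₁ = 0. -/
theorem false_of_pair_central (H : SkewTorus T σ) {e₁ e₂ w X : N} {p r : ℝ} {ε : ℂ}
    (P : PairRelations T σ p r w X ε)
    (hspan : ⊤ ≤ Submodule.span ℂ (Set.range ![e₁, e₂, w, σ e₁, σ e₂, σ w, X]))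
    (hE : ∀ v, HasWeight T p v → v ∈ Submodule.span ℂ {e₁, e₂})
    (t₁ : HasWeight T p e₁) (t₂ : HasWeight T p e₂) (hX : ∀ y : N, ⁅y, X⁆ = 0) : False := by
  have s₁ := H.weight_conj t₁
  have s₂ := H.weight_conj t₂
  have sw := H.weight_conj P.weight_w
  have hT := hasWeight_frame t₁ t₂ P.weight_w s₁ s₂ sw P.weight_X
  have hEF : ∀ u v : N, HasWeight T p u → HasWeight T (-p) v → ∃ h : ℂ, ⁅u, v⁆ = h • X :=
    fun u v hu hv => P.zero _ (by simpa using H.weight_lie hu hv)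
  obtain ⟨h11, k11⟩ := hEF _ _ t₁ s₁
  obtain ⟨h12, k12⟩ := hEF _ _ t₁ s₂
  obtain ⟨h21, k21⟩ := hEF _ _ t₂ s₁
  obtain ⟨h22, k22⟩ := hEF _ _ t₂ s₂
  obtain ⟨ν, kww⟩ := P.zero ⁅w, σ w⁆ (by simpa using H.weight_lie P.weight_w sw)
  obtain ⟨κ, h⟩ := P.lie_pos _ _ t₁ t₂
  have g := H.lie_conj_eq h
  have h1w := P.lie_w _ t₁
  have h2w := P.lie_w _ t₂
  have g1w := H.lie_conj_eq_zero h1w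
  have g2w := H.lie_conj_eq_zero h2w
  have hw' : ∀ u : N, ⁅u, σ w⁆ = 0 → ⁅w, σ u⁆ = 0 := fun u hu => H.lie_conj_swap_eq_zero hu
  by_cases hκ : κ = 0
  · rw [hκ, zero_smul] at h
    rw [hκ, map_zero, zero_smul] at g
    by_cases hA : ∀ u, HasWeight T p u → ⁅w, σ u⁆ = 0
    · have w1 := hA _ t₁
      have w2 := hA _ t₂
      have v1 := H.lie_conj_swap_eq_zero w1
      have v2 := H.lie_conj_swap_eq_zero w2
      refine H.false_of_grading hspan hT ![1, 1, 1, 1, 1, 1, 2] ?_ 6 6 (by simp) (by simp)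
      intro D hD i j hij
      have d6 : D X = (2 : ℂ) • X := hD 6
      fin_cases i <;> fin_cases j <;> first
        | exact absurd hij (by decide)
        | (simp [k11, k12, k21, k22, kww, h, g, h1w, h2w, g1w, g2w, w1, w2, v1, v2, hX, d6]
           try module)
    · push Not at hA
      obtain ⟨u₂, ht₂, hu⟩ := hA
      generalize hu₁ : ⁅w, σ u₂⁆ = u₁ at hu
      have ht₁ : HasWeight T p u₁ := hu₁ ▸ P.w_neg _ ht₂
      -- Otherwise u₂ would be an eigenvector of A with nonzero eigenvalue t⁻¹.
      have hu₂ : ∀ t : ℂ, u₂ ≠ t • u₁ := by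
        rintro t ht
        have ht0 : t ≠ 0 := by
          rintro rfl
          rw [ht, zero_smul, H.conj_zero, lie_zero] at hu₁
          exact hu hu₁.symm
        have h0 : u₂ ≠ 0 := by
          rw [ht]
          exact smul_ne_zero ht0 hu
        refine inv_ne_zero ht0 (H.eq_zero_of_lie_conj_eq_smul (w := w) h0 ?_)
        rw [hu₁, ht, inv_smul_smul₀ ht0]
      have hEeq := span_pair_eq_of_ne (hE _ ht₁) (hE _ ht₂) hu hu₂
      obtain ⟨α, β, h0⟩ := Submodule.mem_span_pair.mp (hEeq ▸ hE _ (P.w_neg _ ht₁))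
      have hEE : ⁅u₁, u₂⁆ = 0 := by
        obtain ⟨c₁, d₁, hc₁⟩ := Submodule.mem_span_pair.mp (hE _ ht₁)
        obtain ⟨c₂, d₂, hc₂⟩ := Submodule.mem_span_pair.mp (hE _ ht₂)
        have h' : ⁅e₂, e₁⁆ = 0 := by rw [← lie_skew, h, neg_zero]
        rw [← hc₁, ← hc₂]
        simp [h, h']
      -- If β ≠ 0, then u₁, u₂ and their conjugates are all obtained by bracketing their own span
      -- with w and σ w, against nilpotency.
      have hβ : β = 0 := by
        by_contra hβ
        have g₁ := H.lie_conj_eq (u := w) (v := σ u₂) (c := 1) (w := u₁) (by rw [hu₁, one_smul])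
        rw [map_one, one_smul, H.conj_conj] at g₁
        have hW := eq_bot_of_le_span_lie (K := ℂ) H.nil
          (W := Submodule.span ℂ {u₁, u₂, σ u₁, σ u₂}) (by
          have m : ∀ (x v : N), v ∈ Submodule.span ℂ {u₁, u₂, σ u₁, σ u₂} →
              ⁅x, v⁆ ∈ Submodule.span ℂ {z | ∃ x : N, ∃ v ∈ Submodule.span ℂ
                {u₁, u₂, σ u₁, σ u₂}, ⁅x, v⁆ = z} :=
            fun x v hv => Submodule.subset_span ⟨x, v, hv, rfl⟩
          have q₁ := m w (σ u₂) (Submodule.subset_span (by simp))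
          have q₃ := m (σ w) u₂ (Submodule.subset_span (by simp))
          rw [hu₁] at q₁
          rw [g₁] at q₃
          have q₂ : u₂ ∈ Submodule.span ℂ {z | ∃ x : N, ∃ v ∈ Submodule.span ℂ
              {u₁, u₂, σ u₁, σ u₂}, ⁅x, v⁆ = z} := by
            have h1 : u₂ = β⁻¹ • (⁅w, σ u₁⁆ - α • u₁) := by
              rw [← h0, add_sub_cancel_left, inv_smul_smul₀ hβ]
            have h2 := Submodule.smul_mem _ β⁻¹ (sub_mem
              (m w (σ u₁) (Submodule.subset_span (by simp))) (Submodule.smul_mem _ α q₁))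
            rwa [← h1] at h2
          have q₄ : σ u₂ ∈ Submodule.span ℂ {z | ∃ x : N, ∃ v ∈ Submodule.span ℂ
              {u₁, u₂, σ u₁, σ u₂}, ⁅x, v⁆ = z} := by
            have hβ' : starRingEnd ℂ β ≠ 0 := by simpa using hβ
            have h3 : σ (α • u₁ + β • u₂) = ⁅σ w, u₁⁆ := by rw [h0, H.conj_lie, H.conj_conj]
            rw [H.conj_add, H.conj_smul, H.conj_smul] at h3
            have h1 : σ u₂ = (starRingEnd ℂ β)⁻¹ • (⁅σ w, u₁⁆ - starRingEnd ℂ α • σ u₁) := by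
              rw [← h3, add_sub_cancel_left, inv_smul_smul₀ hβ']
            have h2 := Submodule.smul_mem _ (starRingEnd ℂ β)⁻¹ (sub_mem
              (m (σ w) u₁ (Submodule.subset_span (by simp)))
              (Submodule.smul_mem _ (starRingEnd ℂ α) q₃))
            rwa [← h1] at h2
          refine Submodule.span_le.mpr ?_
          rintro _ (rfl | rfl | rfl | rfl)
          exacts [q₁, q₂, q₃, q₄])
        have m₁ : u₁ ∈ Submodule.span ℂ {u₁, u₂, σ u₁, σ u₂} := Submodule.subset_span (by simp)
        rw [hW, Submodule.mem_bot] at m₁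
        exact hu m₁
      rw [hβ, zero_smul, add_zero] at h0
      have hα := H.eq_zero_of_lie_conj_eq_smul hu h0.symm
      rw [hα, zero_smul] at h0
      exact H.false_of_pair_central_of_lie_w P (H.span_replace_pair hspan hEeq) ht₁ ht₂ hX hEE
        h0.symm hu₁
  · have hwσ : ∀ v, HasWeight T (-p) v → ⁅w, v⁆ = 0 := by
      intro v hv
      obtain ⟨c, hc⟩ := hEF _ _ t₁ hv
      obtain ⟨d, hd⟩ := hEF _ _ t₂ hv
      have h1 : κ • ⁅w, v⁆ = 0 := by
        rw [← smul_lie, ← h, lie_lie, hc, hd, lie_smul, lie_smul, hX, hX, smul_zero, smul_zero,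
          sub_zero]
      exact (smul_eq_zero.mp h1).resolve_left hκ
    have w1 := hwσ _ s₁
    have w2 := hwσ _ s₂
    have v1 := H.lie_conj_swap_eq_zero w1
    have v2 := H.lie_conj_swap_eq_zero w2
    have kww' : ⁅w, σ w⁆ = 0 := by
      have h1 : κ • ⁅w, σ w⁆ = 0 := by
        rw [← smul_lie, ← h, lie_lie, v1, v2, lie_zero, lie_zero, sub_zero]
      exact (smul_eq_zero.mp h1).resolve_left hκ
    refine H.false_of_grading hspan hT ![1, 1, 2, 1, 1, 2, 2] ?_ 6 6 (by simp) (by simp)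
    intro D hD i j hij
    have d2 : D w = (2 : ℂ) • w := hD 2
    have d5 : D (σ w) = (2 : ℂ) • σ w := hD 5
    have d6 : D X = (2 : ℂ) • X := hD 6
    fin_cases i <;> fin_cases j <;> first
      | exact absurd hij (by decide)
      | (simp [k11, k12, k21, k22, kww', h, g, h1w, h2w, g1w, g2w, w1, w2, v1, v2, hX, d2, d5, d6]
         try module)

/-- Jacobi and nilpotency make e₁ commute with σ e₁ and σ e₂, and w with σ e₁ and σ w. Moreover κ s
= 0 for ⁅e₁, e₂⁆ = κ w and ⁅w, σ e₂⁆ = s e₁. With degrees 3, 1, 2 for e₁, e₂, X, the degree of w is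
2 if κ = 0 and 4 otherwise. -/
theorem false_of_pair_noncentral (H : SkewTorus T σ) {e₁ e₂ w X : N} {p r : ℝ} {ε χ : ℂ}
    (P : PairRelations T σ p r w X ε)
    (hspan : ⊤ ≤ Submodule.span ℂ (Set.range ![e₁, e₂, w, σ e₁, σ e₂, σ w, X]))
    (hE : ∀ v, HasWeight T p v → v ∈ Submodule.span ℂ {e₁, e₂}) (n₁ : e₁ ≠ 0)
    (t₁ : HasWeight T p e₁) (t₂ : HasWeight T p e₂) (x₁ : ⁅X, e₁⁆ = 0) (x₂ : ⁅X, e₂⁆ = χ • e₁)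
    (hχ : χ ≠ 0) : False := by
  have s₁ := H.weight_conj t₁
  have s₂ := H.weight_conj t₂
  have sw := H.weight_conj P.weight_w
  have hT := hasWeight_frame t₁ t₂ P.weight_w s₁ s₂ sw P.weight_X
  have hEF : ∀ u v : N, HasWeight T p u → HasWeight T (-p) v → ∃ h : ℂ, ⁅u, v⁆ = h • X :=
    fun u v hu hv => P.zero _ (by simpa using H.weight_lie hu hv)
  obtain ⟨χ', y₂, hχ'⟩ := H.exists_lie_conj_eq P.ne_zero P.conj_X x₂
  replace hχ' := hχ' hχ
  obtain ⟨_, y₁, -⟩ := H.exists_lie_conj_eq (c := 0) (v := 0) P.ne_zero P.conj_X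
    (by rw [x₁, zero_smul])
  rw [H.conj_zero, smul_zero] at y₁
  obtain ⟨_, yw, -⟩ := H.exists_lie_conj_eq (c := 0) (v := 0) P.ne_zero P.conj_X
    (by rw [P.X_w, zero_smul])
  rw [H.conj_zero, smul_zero] at yw
  have k11 : ⁅e₁, σ e₁⁆ = 0 := by
    obtain ⟨h, hh⟩ := hEF _ _ t₂ s₁
    have h1 : ⁅X, ⁅e₂, σ e₁⁆⁆ = χ • ⁅e₁, σ e₁⁆ := by
      rw [leibniz_lie, y₁, x₂, lie_zero, add_zero, smul_lie]
    rw [hh, lie_smul, lie_self, smul_zero] at h1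
    exact (smul_eq_zero.mp h1.symm).resolve_left hχ
  have k12 : ⁅e₁, σ e₂⁆ = 0 := by
    obtain ⟨h, hh⟩ := hEF _ _ t₁ s₂
    have h1 : ⁅e₂, ⁅σ e₂, e₁⁆⁆ = (h * χ) • e₁ := by
      rw [← lie_skew (σ e₂) e₁, hh, lie_neg, lie_smul, ← lie_skew e₂ X, x₂, smul_neg, neg_neg,
        smul_smul]
    have h2 := (mul_eq_zero.mp (eq_zero_of_lie_lie_eq_smul H.nil n₁ h1)).resolve_right hχ
    rw [hh, h2, zero_smul]
  have k21 := H.lie_conj_swap_eq_zero k12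
  obtain ⟨h22, k22⟩ := hEF _ _ t₂ s₂
  obtain ⟨κ, h⟩ := P.lie_pos _ _ t₁ t₂
  have g := H.lie_conj_eq h
  have h1w := P.lie_w _ t₁
  have h2w := P.lie_w _ t₂
  have g1w := H.lie_conj_eq_zero h1w
  have g2w := H.lie_conj_eq_zero h2w
  obtain ⟨s, s', hs⟩ := Submodule.mem_span_pair.mp (hE _ (P.w_neg _ t₂))
  have w1 : ⁅w, σ e₁⁆ = (χ'⁻¹ * (s' * χ)) • e₁ := by
    have h1 : ⁅X, ⁅w, σ e₂⁆⁆ = χ' • ⁅w, σ e₁⁆ := by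
      rw [leibniz_lie, P.X_w, zero_lie, zero_add, y₂, lie_smul]
    rw [← hs, lie_add, lie_smul, lie_smul, x₁, x₂, smul_zero, zero_add] at h1
    rw [mul_smul, mul_smul, h1, inv_smul_smul₀ hχ']
  have hs'0 := H.eq_zero_of_lie_conj_eq_smul n₁ w1
  rw [hs'0, zero_smul] at w1
  have hs' : s' = 0 := by
    rcases mul_eq_zero.mp hs'0 with h | h
    · exact absurd h (inv_ne_zero hχ')
    · exact (mul_eq_zero.mp h).resolve_right hχ
  have w2 : ⁅w, σ e₂⁆ = s • e₁ := by rw [← hs, hs', zero_smul, add_zero]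
  have v1 := H.lie_conj_swap_eq_zero w1
  have v2 := H.lie_conj_swap w2
  have kww : ⁅w, σ w⁆ = 0 := by
    obtain ⟨ν, hν⟩ := P.zero ⁅w, σ w⁆ (by simpa using H.weight_lie P.weight_w sw)
    have h1 : (ν * χ) • e₁ = 0 := by
      rw [mul_smul, ← x₂, ← smul_lie, ← hν, lie_lie, ← lie_skew (σ w) e₂, v2, ← lie_skew w e₂,
        h2w, neg_zero, lie_zero, sub_zero, neg_neg, lie_smul, w1, smul_zero]
    have h2 := ((smul_eq_zero.mp h1).resolve_right n₁)
    rw [hν, (mul_eq_zero.mp h2).resolve_right hχ, zero_smul]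
  have hκs : κ * s = 0 := by
    have h1 : (κ * s) • e₁ = 0 := by
      rw [mul_smul, ← w2, ← smul_lie, ← h, lie_lie, k22, k12, lie_zero, sub_zero, lie_smul,
        ← lie_skew, x₁, neg_zero, smul_zero]
    exact (smul_eq_zero.mp h1).resolve_right n₁
  have x₁' : ⁅e₁, X⁆ = 0 := by rw [← lie_skew, x₁, neg_zero]
  have x₂' : ⁅e₂, X⁆ = -(χ • e₁) := by rw [← lie_skew, x₂]
  have y₁' : ⁅σ e₁, X⁆ = 0 := by rw [← lie_skew, y₁, neg_zero]
  have y₂' : ⁅σ e₂, X⁆ = -(χ' • σ e₁) := by rw [← lie_skew, y₂]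
  have xw : ⁅w, X⁆ = 0 := by rw [← lie_skew, P.X_w, neg_zero]
  have yw' : ⁅σ w, X⁆ = 0 := by rw [← lie_skew, yw, neg_zero]
  have v2' : ⁅σ e₂, w⁆ = -(s • e₁) := by rw [← lie_skew, w2]
  by_cases hκ : κ = 0
  · rw [hκ, zero_smul] at h
    rw [hκ, map_zero, zero_smul] at g
    refine H.false_of_grading hspan hT ![3, 1, 2, 3, 1, 2, 2] ?_ 6 6 (by simp) (by simp)
    intro D hD i j hij
    have d0 : D e₁ = (3 : ℂ) • e₁ := hD 0
    have d3 : D (σ e₁) = (3 : ℂ) • σ e₁ := hD 3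
    have d6 : D X = (2 : ℂ) • X := hD 6
    fin_cases i <;> fin_cases j <;> first
      | exact absurd hij (by decide)
      | (simp [k11, k12, k21, k22, kww, h, g, h1w, h2w, g1w, g2w, w1, w2, v1, v2, x₁', x₂', y₁',
          y₂', xw, yw', d0, d3, d6]
         try module)
  · rw [(mul_eq_zero.mp hκs).resolve_left hκ] at w2 v2
    rw [zero_smul] at w2
    rw [map_zero, zero_smul, neg_zero] at v2
    refine H.false_of_grading hspan hT ![3, 1, 4, 3, 1, 4, 2] ?_ 6 6 (by simp) (by simp)
    intro D hD i j hij
    have d0 : D e₁ = (3 : ℂ) • e₁ := hD 0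
    have d2 : D w = (4 : ℂ) • w := hD 2
    have d3 : D (σ e₁) = (3 : ℂ) • σ e₁ := hD 3
    have d5 : D (σ w) = (4 : ℂ) • σ w := hD 5
    have d6 : D X = (2 : ℂ) • X := hD 6
    fin_cases i <;> fin_cases j <;> first
      | exact absurd hij (by decide)
      | (simp [k11, k12, k21, k22, kww, h, g, h1w, h2w, g1w, g2w, w1, w2, v1, v2, x₁', x₂', y₁',
          y₂', xw, yw', d0, d2, d3, d5, d6]
         try module)

/-- In a basis of the weight-p plane adapted to ad X, the single coefficient χ decides whether X is
central. -/
theorem false_of_pair (H : SkewTorus T σ) {a₁ a₂ w X : N} {p r : ℝ}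
    (hspan : ⊤ ≤ Submodule.span ℂ (Set.range ![a₁, a₂, w, σ a₁, σ a₂, σ w, X]))
    (hX : X ≠ 0) (hw : w ≠ 0) (ha : a₁ ≠ 0) (hp : 0 < p) (hr : 0 < r) (hpr : p ≠ r)
    (t₁ : HasWeight T p a₁) (t₂ : HasWeight T p a₂) (tw : HasWeight T r w)
    (tX : HasWeight T 0 X) : False := by
  have := H.finiteDimensional
  obtain ⟨ε, P⟩ := H.pairRelations hspan hX hw hp hr hpr t₁ t₂ tw tX
  have hT := hasWeight_frame t₁ t₂ tw (H.weight_conj t₁) (H.weight_conj t₂) (H.weight_conj tw) tX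
  have hE : ∀ v, HasWeight T p v → v ∈ Submodule.span ℂ {a₁, a₂} := by
    intro v hv
    obtain ⟨c, d, hcd⟩ := H.exists_smul_add_of_weight hspan hT hv 0 1 (by decide) (by
      intro i hi hi'
      fin_cases i <;> first
        | exact absurd rfl hi
        | exact absurd rfl hi'
        | (intro h; dsimp at h; first | linarith | exact hpr h.symm))
    exact Submodule.mem_span_pair.mpr ⟨c, d, hcd.symm⟩
  have hE' : ∀ v ∈ Submodule.span ℂ {a₁, a₂}, HasWeight T p v := by
    intro v hv
    obtain ⟨c, d, rfl⟩ := Submodule.mem_span_pair.mp hv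
    rw [HasWeight, map_add, map_smul, map_smul, t₁, t₂]
    module
  obtain ⟨u₁, u₂, hu₁, heq, hu⟩ := exists_flag_of_isNilpotent (K := ℂ) H.nil (a₂ := a₂) ha
    (S := {X}) (by
      rintro x rfl u hu
      exact hE _ (HasWeight.lie_zero_left H tX (hE' u hu)))
  obtain ⟨x₁, hx⟩ := hu X rfl
  have m₁ : HasWeight T p u₁ := hE' _ (heq ▸ Submodule.subset_span (by simp))
  have m₂ : HasWeight T p u₂ := hE' _ (heq ▸ Submodule.subset_span (by simp))
  obtain ⟨χ, x₂⟩ := hx u₂ (hE _ m₂)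
  have hspan' := H.span_replace_pair hspan heq
  by_cases hχ : χ = 0
  · rw [hχ, zero_smul] at x₂
    have hc : ∀ {u : N}, ⁅X, u⁆ = 0 → ⁅X, σ u⁆ = 0 := fun {u} h => by
      obtain ⟨_, h', -⟩ := H.exists_lie_conj_eq (c := 0) (v := 0) P.ne_zero P.conj_X
        (by rw [h, zero_smul])
      rw [h', H.conj_zero, smul_zero]
    refine H.false_of_pair_central P hspan' (heq ▸ hE) m₁ m₂ (lie_eq_zero_of_span hspan' fun i => ?_)
    rw [← lie_skew, neg_eq_zero]
    fin_cases i
    exacts [x₁, x₂, P.X_w, hc x₁, hc x₂, hc P.X_w, lie_self X]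
  · exact H.false_of_pair_noncentral P hspan' (heq ▸ hE) hu₁ m₁ m₂ x₁ x₂ hχ

end SkewTorus

end RigidLie

/-! ### The two-step obstruction, and two positive weights with trivial action of ker T -/

namespace RigidLie

open Module

namespace SkewTorus

variable {N : Type*} [LieRing N] [LieAlgebra ℂ N] {T : Module.End ℂ N} {σ : N → N}

theorem weight_zero_conj (H : SkewTorus T σ) {x : N} (hx : HasWeight T 0 x) :
    HasWeight T 0 (σ x) := by
  simpa using H.weight_conj hx

theorem weight_zero_lie (H : SkewTorus T σ) {x y : N} (hx : HasWeight T 0 x)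
    (hy : HasWeight T 0 y) : HasWeight T 0 ⁅x, y⁆ := by
  simpa using H.weight_lie hx hy

theorem mem_ker_iff_hasWeight {x : N} : x ∈ LinearMap.ker T ↔ HasWeight T 0 x := by
  rw [LinearMap.mem_ker, HasWeight, Complex.ofReal_zero, zero_smul]

/-- Let P project onto the derived algebra along a T-stable complement. Since brackets are central,
1 + P is a derivation commuting with T, with eigenvalues 1 and 2, while on vectors of weight zero
its eigenvalues should vanish. -/
theorem false_of_two_step (H : SkewTorus T σ) (h : ∀ x y z : N, ⁅x, ⁅y, z⁆⁆ = 0) {x : N}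
    (hx : HasWeight T 0 x) (hx0 : x ≠ 0) : False := by
  let C : Submodule ℂ N := lieSpan ⊤
  have hCz : ∀ c ∈ C, ∀ y : N, ⁅y, c⁆ = 0 := by
    intro c hc y
    have hle : C ≤ LinearMap.ker (LieAlgebra.ad ℂ N y : N →ₗ[ℂ] N) := lieSpan_le fun u _ v _ => h y u v
    exact hle hc
  have hCT : C ≤ C.comap T := lieSpan_le fun u _ v _ => by
    rw [Submodule.mem_comap, H.der]
    exact add_mem (lie_mem_lieSpan trivial trivial) (lie_mem_lieSpan trivial trivial)
  obtain ⟨q, hqT, hcompl⟩ := Module.End.isSemisimple_iff.mp H.semisimple C hCT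
  let P : Module.End ℂ N := C.subtype ∘ₗ C.projectionOnto q hcompl
  have hPC : ∀ c ∈ C, P c = c := fun c hc => by
    exact congrArg Subtype.val (Submodule.projectionOnto_apply_left hcompl ⟨c, hc⟩)
  have hPq : ∀ y ∈ q, P y = 0 := fun y hy => by
    have := (Submodule.projectionOnto_apply_eq_zero_iff hcompl (x := y)).mpr hy
    exact congrArg Subtype.val this
  have hPmem : ∀ y, P y ∈ C := fun y => (C.projectionOnto q hcompl y).2
  have hsum : ∀ y, ∃ c ∈ C, ∃ d ∈ q, c + d = y := fun y =>
    Submodule.mem_sup.mp (hcompl.sup_eq_top ▸ Submodule.mem_top)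
  have hPT : ∀ y, P (T y) = T (P y) := by
    intro y
    obtain ⟨c, hc, d, hd, rfl⟩ := hsum y
    rw [map_add, map_add, map_add, hPC _ (hCT hc), hPq _ (hqT hd), hPC _ hc, hPq _ hd, add_zero,
      add_zero]
  have hder : IsDer (LinearMap.id + P : Module.End ℂ N) := by
    intro u v
    have h1 : ⁅P u, v⁆ = 0 := by rw [← lie_skew, hCz _ (hPmem u), neg_zero]
    simp only [LinearMap.add_apply, LinearMap.id_apply, add_lie, lie_add, h1, hCz _ (hPmem v)]
    rw [hPC _ (lie_mem_lieSpan trivial trivial)]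
    abel
  have hcomm : ∀ y, (LinearMap.id + P : Module.End ℂ N) (T y) =
      T ((LinearMap.id + P : Module.End ℂ N) y) := fun y => by
    simp only [LinearMap.add_apply, LinearMap.id_apply, map_add, hPT]
  obtain ⟨c, hc, d, hd, rfl⟩ := hsum x
  rw [← mem_ker_iff_hasWeight, LinearMap.mem_ker, map_add] at hx
  have hTc : T c = 0 := by
    refine Submodule.disjoint_def.mp hcompl.disjoint _ (hCT hc) ?_
    rw [eq_neg_of_add_eq_zero_left hx]
    exact neg_mem (hqT hd)
  have hTd : T d = 0 := by rwa [hTc, zero_add] at hx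
  by_cases hc0 : c = 0
  · have hd0 : d ≠ 0 := fun h => hx0 (by rw [hc0, h, add_zero])
    have hDd : (LinearMap.id + P : Module.End ℂ N) d = (1 : ℂ) • d := by
      rw [LinearMap.add_apply, hPq d hd, add_zero, one_smul, LinearMap.id_apply]
    have := H.add_eq_zero_of_eigen hder hcomm (mem_ker_iff_hasWeight.mp hTd)
      (mem_ker_iff_hasWeight.mp hTd) (add_zero 0) hd0 hd0 hDd hDd
    norm_num at this
  · have hDc : (LinearMap.id + P : Module.End ℂ N) c = (2 : ℂ) • c := by
      rw [LinearMap.add_apply, hPC c hc, two_smul, LinearMap.id_apply]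
    have := H.add_eq_zero_of_eigen hder hcomm (mem_ker_iff_hasWeight.mp hTc)
      (mem_ker_iff_hasWeight.mp hTc) (add_zero 0) hc0 hc0 hDc hDc
    norm_num at this

theorem lie_lie_eq_zero_of_span {b : Fin 7 → N} (hspan : ⊤ ≤ Submodule.span ℂ (Set.range b))
    (h : ∀ i j, i < j → ∀ k, ⁅b k, ⁅b i, b j⁆⁆ = 0) (x y z : N) : ⁅x, ⁅y, z⁆⁆ = 0 := by
  have h1 : ∀ i j, ∀ x : N, ⁅x, ⁅b i, b j⁆⁆ = 0 := by
    intro i j x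
    rcases lt_trichotomy i j with hij | rfl | hij
    · exact lie_eq_zero_of_span hspan (h i j hij) x
    · rw [lie_self, lie_zero]
    · rw [← lie_skew (b i), lie_neg, lie_eq_zero_of_span hspan (h j i hij) x, neg_zero]
  have h2 : ∀ i, ∀ z x : N, ⁅x, ⁅b i, z⁆⁆ = 0 := by
    intro i z x
    have hz : z ∈ Submodule.span ℂ (Set.range b) := hspan trivial
    induction hz using Submodule.span_induction with
    | mem z hz =>
      obtain ⟨j, rfl⟩ := hz
      exact h1 i j x
    | zero => simp
    | add u v _ _ hu hv => rw [lie_add, lie_add, hu, hv, add_zero]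
    | smul c u _ hu => rw [lie_smul, lie_smul, hu, smul_zero]
  have hy : y ∈ Submodule.span ℂ (Set.range b) := hspan trivial
  induction hy using Submodule.span_induction with
  | mem y hy =>
    obtain ⟨j, rfl⟩ := hy
    exact h2 j z x
  | zero => simp
  | add u v _ _ hu hv => rw [add_lie, lie_add, hu, hv, add_zero]
  | smul c u _ hu => rw [smul_lie, lie_smul, hu, smul_zero]

/-- If `ker T` has dimension at most three, it is nilpotent of class at most two. -/
theorem lie_lie_eq_zero_of_finrank_ker_le (H : SkewTorus T σ)
    (hk : finrank ℂ (LinearMap.ker T) ≤ 3) {x y z : N} (hx : HasWeight T 0 x)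
    (hy : HasWeight T 0 y) (hz : HasWeight T 0 z) : ⁅x, ⁅y, z⁆⁆ = 0 := by
  have := H.finiteDimensional
  have hA : lieSpan (LinearMap.ker T) ≤ LinearMap.ker T := lieSpan_le fun u hu v hv => by
    rw [mem_ker_iff_hasWeight] at *
    exact H.weight_zero_lie hu hv
  by_cases h0 : lieSpan (LinearMap.ker T) = ⊥
  · have h1 := lie_mem_lieSpan (mem_ker_iff_hasWeight.mpr hy) (mem_ker_iff_hasWeight.mpr hz)
    rw [h0, Submodule.mem_bot] at h1
    rw [h1, lie_zero]
  · by_contra hne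
    -- The derived algebra of ker T is then a line, stable under ad x and hence killed by it.
    have hf := finrank_lieSpan_add_two_le H.nil hA h0
    have hyz0 : ⁅y, z⁆ ≠ 0 := fun h => hne (by rw [h, lie_zero])
    have hyz := lie_mem_lieSpan (mem_ker_iff_hasWeight.mpr hy) (mem_ker_iff_hasWeight.mpr hz)
    have hxyz := lie_mem_lieSpan (mem_ker_iff_hasWeight.mpr hx) (hA hyz)
    have hle : Submodule.span ℂ {⁅y, z⁆} ≤ lieSpan (LinearMap.ker T) :=
      (Submodule.span_singleton_le_iff_mem _ _).mpr hyz
    rw [← Submodule.eq_of_le_of_finrank_le hle (by rw [finrank_span_singleton hyz0]; omega),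
      Submodule.mem_span_singleton] at hxyz
    obtain ⟨c, hc⟩ := hxyz
    rw [← hc, eq_zero_of_lie_eq_smul H.nil hyz0 hc.symm, zero_smul] at hne
    exact hne rfl

/-- Every bracket of basis vectors lies in ker T and is annihilated by ker T, by Jacobi or because
ker T has class at most two. So the whole algebra is two-step. -/
theorem false_of_two_weights_central (H : SkewTorus T σ) {e₁ e₂ x₁ x₂ x₃ : N}
    (hspan : ⊤ ≤ Submodule.span ℂ (Set.range ![e₁, e₂, x₁, σ e₁, σ e₂, x₂, x₃]))
    (hk : finrank ℂ (LinearMap.ker T) ≤ 3) (hx₁ : HasWeight T 0 x₁) (hx₂ : HasWeight T 0 x₂)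
    (hx₃ : HasWeight T 0 x₃) (hx0 : x₁ ≠ 0) (h₁ : ∀ x, HasWeight T 0 x → ⁅x, e₁⁆ = 0)
    (h₂ : ∀ x, HasWeight T 0 x → ⁅x, e₂⁆ = 0) (h12 : ⁅e₁, e₂⁆ = 0)
    (w11 : HasWeight T 0 ⁅e₁, σ e₁⁆) (w12 : HasWeight T 0 ⁅e₁, σ e₂⁆)
    (w21 : HasWeight T 0 ⁅e₂, σ e₁⁆) (w22 : HasWeight T 0 ⁅e₂, σ e₂⁆) : False := by
  have hconj : ∀ {e : N}, (∀ x, HasWeight T 0 x → ⁅x, e⁆ = 0) →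
      ∀ x, HasWeight T 0 x → ⁅x, σ e⁆ = 0 := fun {e} h x hx => by
    have h1 := H.lie_conj_eq_zero (h (σ x) (H.weight_zero_conj hx))
    rwa [H.conj_conj] at h1
  have g₁ := hconj h₁
  have g₂ := hconj h₂
  have g12 := H.lie_conj_eq_zero h12
  have hswap : ∀ {u v : N}, ⁅u, v⁆ = 0 → ⁅v, u⁆ = 0 := fun {u v} h => by
    rw [← lie_skew, h, neg_zero]
  have hcen : ∀ z : N, HasWeight T 0 z → (∀ x, HasWeight T 0 x → ⁅x, z⁆ = 0) → ∀ k,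
      ⁅![e₁, e₂, x₁, σ e₁, σ e₂, x₂, x₃] k, z⁆ = 0 := by
    intro z hz hz' k
    fin_cases k
    exacts [hswap (h₁ z hz), hswap (h₂ z hz), hz' _ hx₁, hswap (g₁ z hz), hswap (g₂ z hz),
      hz' _ hx₂, hz' _ hx₃]
  have hef : ∀ {u v : N}, HasWeight T 0 ⁅u, v⁆ → (∀ x, HasWeight T 0 x → ⁅x, u⁆ = 0) →
      (∀ x, HasWeight T 0 x → ⁅x, v⁆ = 0) → ∀ k,
      ⁅![e₁, e₂, x₁, σ e₁, σ e₂, x₂, x₃] k, ⁅u, v⁆⁆ = 0 := by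
    intro u v hw hu hv
    refine hcen _ hw fun x hx => ?_
    rw [leibniz_lie, hu x hx, hv x hx, zero_lie, lie_zero, add_zero]
  have hxx : ∀ {u v : N}, HasWeight T 0 u → HasWeight T 0 v → ∀ k,
      ⁅![e₁, e₂, x₁, σ e₁, σ e₂, x₂, x₃] k, ⁅u, v⁆⁆ = 0 := by
    intro u v hu hv
    exact hcen _ (H.weight_zero_lie hu hv) fun x hx =>
      H.lie_lie_eq_zero_of_finrank_ker_le hk hx hu hv
  have h0 : ∀ {u v : N}, ⁅u, v⁆ = 0 → ∀ k,
      ⁅![e₁, e₂, x₁, σ e₁, σ e₂, x₂, x₃] k, ⁅u, v⁆⁆ = 0 := fun {u v} h k => by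
    rw [h, lie_zero]
  refine H.false_of_two_step (lie_lie_eq_zero_of_span hspan ?_) hx₁ hx0
  intro i j hij
  fin_cases i <;> fin_cases j <;> first
    | exact absurd hij (by decide)
    | exact h0 h12
    | exact h0 g12
    | exact h0 (hswap (h₁ _ ‹_›))
    | exact h0 (hswap (h₂ _ ‹_›))
    | exact h0 (hswap (g₁ _ ‹_›))
    | exact h0 (hswap (g₂ _ ‹_›))
    | exact h0 (g₁ _ ‹_›)
    | exact h0 (g₂ _ ‹_›)
    | exact hef w11 h₁ g₁
    | exact hef w12 h₁ g₂
    | exact hef w21 h₂ g₁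
    | exact hef w22 h₂ g₂
    | exact hxx ‹_› ‹_›

end SkewTorus

end RigidLie

/-! ### Two positive weights: reduction, and the equal case -/

namespace RigidLie

open Module

namespace SkewTorus

variable {N : Type*} [LieRing N] [LieAlgebra ℂ N] {T : Module.End ℂ N} {σ : N → N}

/-- Distinct weights have one-dimensional weight spaces, on which the nilpotent action of ker T is
trivial. If q = 2p, the possible value of ⁅e₁, σ e₂⁆ in ℂ σ e₁ is excluded by conjugation. -/
theorem false_of_two_distinct_weights (H : SkewTorus T σ) {e₁ e₂ x₁ x₂ x₃ : N} {p q : ℝ}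
    (hspan : ⊤ ≤ Submodule.span ℂ (Set.range ![e₁, e₂, x₁, σ e₁, σ e₂, x₂, x₃]))
    (hk : finrank ℂ (LinearMap.ker T) ≤ 3) (hx₁ : HasWeight T 0 x₁) (hx₂ : HasWeight T 0 x₂)
    (hx₃ : HasWeight T 0 x₃) (hx0 : x₁ ≠ 0) (n₁ : e₁ ≠ 0) (n₂ : e₂ ≠ 0) (hp : 0 < p) (hpq : p < q)
    (t₁ : HasWeight T p e₁) (t₂ : HasWeight T q e₂) : False := by
  have s₁ := H.weight_conj t₁
  have s₂ := H.weight_conj t₂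
  have hT := hasWeight_frame t₁ t₂ hx₁ s₁ s₂ hx₂ hx₃
  have h₁ : ∀ x, HasWeight T 0 x → ⁅x, e₁⁆ = 0 := by
    intro x hx
    obtain ⟨c, hc⟩ := H.exists_smul_of_weight hspan hT (HasWeight.lie_zero_left H hx t₁) 0 (by
      intro i hi; fin_cases i <;> first | exact absurd rfl hi | (intro h; dsimp at h; linarith))
    change _ = c • e₁ at hc
    rw [hc, eq_zero_of_lie_eq_smul H.nil n₁ hc, zero_smul]
  have h₂ : ∀ x, HasWeight T 0 x → ⁅x, e₂⁆ = 0 := by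
    intro x hx
    obtain ⟨c, hc⟩ := H.exists_smul_of_weight hspan hT (HasWeight.lie_zero_left H hx t₂) 1 (by
      intro i hi; fin_cases i <;> first | exact absurd rfl hi | (intro h; dsimp at h; linarith))
    change _ = c • e₂ at hc
    rw [hc, eq_zero_of_lie_eq_smul H.nil n₂ hc, zero_smul]
  have h12 : ⁅e₁, e₂⁆ = 0 := H.eq_zero_of_weight hspan hT (H.weight_lie t₁ t₂) (by
    intro i; fin_cases i <;> (intro h; dsimp at h; linarith))
  have k12 : ⁅e₁, σ e₂⁆ = 0 := by
    obtain ⟨c, hc⟩ := H.exists_smul_of_weight hspan hT (H.weight_lie t₁ s₂) 3 (by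
      intro i hi; fin_cases i <;> first | exact absurd rfl hi | (intro h; dsimp at h; linarith))
    exact H.lie_conj_eq_zero_of_eq_smul n₁ hc
  have k21 := H.lie_conj_swap_eq_zero k12
  have h0 : HasWeight T 0 (0 : N) := by rw [HasWeight, map_zero, smul_zero]
  exact H.false_of_two_weights_central hspan hk hx₁ hx₂ hx₃ hx0 h₁ h₂ h12
    (by simpa using H.weight_lie t₁ s₁) (k12 ▸ h0) (k21 ▸ h0) (by simpa using H.weight_lie t₂ s₂)

/-- Bracket relations in the case where the weights are `±p` (twice) and `0` (three times), and
`ker T` does not act trivially. -/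
structure TwoPairRelations (T : Module.End ℂ N) (σ : N → N) (e₁ e₂ : N) (p : ℝ)
    (χ χ' : N → ℂ) : Prop where
  finrank_ker : finrank ℂ (LinearMap.ker T) ≤ 3
  ne_zero : e₁ ≠ 0
  weight₁ : HasWeight T p e₁
  weight₂ : HasWeight T p e₂
  lie₁ : ∀ x, HasWeight T 0 x → ⁅x, e₁⁆ = 0
  lie₂ : ∀ x, HasWeight T 0 x → ⁅x, e₂⁆ = χ x • e₁
  conj₁ : ∀ x, HasWeight T 0 x → ⁅x, σ e₁⁆ = 0
  conj₂ : ∀ x, HasWeight T 0 x → ⁅x, σ e₂⁆ = χ' x • σ e₁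
  lie₁₂ : ⁅e₁, e₂⁆ = 0
  exists_ne : ∃ x, HasWeight T 0 x ∧ χ x ≠ 0 ∧ χ' x ≠ 0

namespace TwoPairRelations

variable {e₁ e₂ : N} {p : ℝ} {χ χ' : N → ℂ}

theorem weight_lie_conj (H : SkewTorus T σ) {u v : N} (hu : HasWeight T p u)
    (hv : HasWeight T p v) : HasWeight T 0 ⁅u, σ v⁆ := by
  simpa using H.weight_lie hu (H.weight_conj hv)

theorem lie_b (P : TwoPairRelations T σ e₁ e₂ p χ χ') {x : N} (hx : HasWeight T 0 x) :
    ⁅x, ⁅e₁, σ e₂⁆⁆ = χ' x • ⁅e₁, σ e₁⁆ := by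
  rw [leibniz_lie, P.lie₁ x hx, P.conj₂ x hx, zero_lie, lie_smul, zero_add]

theorem lie_b' (P : TwoPairRelations T σ e₁ e₂ p χ χ') {x : N} (hx : HasWeight T 0 x) :
    ⁅x, ⁅e₂, σ e₁⁆⁆ = χ x • ⁅e₁, σ e₁⁆ := by
  rw [leibniz_lie, P.lie₂ x hx, P.conj₁ x hx, lie_zero, smul_lie, add_zero]

theorem lie_c (P : TwoPairRelations T σ e₁ e₂ p χ χ') {x : N} (hx : HasWeight T 0 x) :
    ⁅x, ⁅e₂, σ e₂⁆⁆ = χ x • ⁅e₁, σ e₂⁆ + χ' x • ⁅e₂, σ e₁⁆ := by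
  rw [leibniz_lie, P.lie₂ x hx, P.conj₂ x hx, smul_lie, lie_smul]

/-- Applying ad x twice to ⁅e₂, σ e₂⁆ gives 2 χ(x) χ'(x) ⁅e₁, σ e₁⁆, which is zero because ker T has
class at most two. -/
theorem a_eq_zero (H : SkewTorus T σ) (P : TwoPairRelations T σ e₁ e₂ p χ χ') :
    ⁅e₁, σ e₁⁆ = 0 := by
  obtain ⟨x, hx, hχ, hχ'⟩ := P.exists_ne
  have h1 := H.lie_lie_eq_zero_of_finrank_ker_le P.finrank_ker hx hx
    (weight_lie_conj H P.weight₂ P.weight₂)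
  rw [P.lie_c hx, lie_add, lie_smul, lie_smul, P.lie_b hx, P.lie_b' hx, smul_smul, smul_smul,
    ← add_smul] at h1
  refine (smul_eq_zero.mp h1).resolve_left ?_
  have : χ x * χ' x + χ' x * χ x = 2 * (χ x * χ' x) := by ring
  rw [this]
  exact mul_ne_zero two_ne_zero (mul_ne_zero hχ hχ')

theorem lie_b_eq_zero (H : SkewTorus T σ) (P : TwoPairRelations T σ e₁ e₂ p χ χ') {x : N}
    (hx : HasWeight T 0 x) : ⁅x, ⁅e₁, σ e₂⁆⁆ = 0 := by
  rw [P.lie_b hx, P.a_eq_zero H, smul_zero]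

theorem lie_b'_eq_zero (H : SkewTorus T σ) (P : TwoPairRelations T σ e₁ e₂ p χ χ') {x : N}
    (hx : HasWeight T 0 x) : ⁅x, ⁅e₂, σ e₁⁆⁆ = 0 := by
  rw [P.lie_b' hx, P.a_eq_zero H, smul_zero]

theorem b'_eq (H : SkewTorus T σ) : ⁅e₂, σ e₁⁆ = -σ ⁅e₁, σ e₂⁆ := by
  rw [H.conj_lie, H.conj_conj, lie_skew]

theorem b_lie_e₂ (H : SkewTorus T σ) (P : TwoPairRelations T σ e₁ e₂ p χ χ') :
    ⁅⁅e₁, σ e₂⁆, e₂⁆ = 0 := by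
  rw [lie_lie, P.lie₁₂, lie_zero, sub_zero, ← lie_skew (σ e₂), lie_neg, lie_skew,
    P.lie₁ _ (weight_lie_conj H P.weight₂ P.weight₂)]

/-- Put b = ⁅e₁, σ e₂⁆. As b commutes with ⁅e₂, σ e₂⁆ and χ(b) = 0, Jacobi leaves χ'(b) ⁅e₂, σ e₁⁆ =
0; the last bracket is -σ b, so χ'(b) = 0 or b = 0. -/
theorem b_lie_conj (H : SkewTorus T σ) (P : TwoPairRelations T σ e₁ e₂ p χ χ') :
    ⁅⁅e₁, σ e₂⁆, σ e₂⁆ = 0 := by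
  have hb := weight_lie_conj H P.weight₁ P.weight₂
  have hc := weight_lie_conj H P.weight₂ P.weight₂
  have h1 := P.lie_c hb
  rw [← lie_skew, P.lie_b_eq_zero H hc, neg_zero] at h1
  have h2 : χ ⁅e₁, σ e₂⁆ = 0 := by
    have := P.lie₂ _ hb
    rw [P.b_lie_e₂ H] at this
    exact (smul_eq_zero.mp this.symm).resolve_right P.ne_zero
  rw [h2, zero_smul, zero_add] at h1
  rcases smul_eq_zero.mp h1.symm with h | h
  · rw [P.conj₂ _ hb, h, zero_smul]
  · rw [b'_eq H, neg_eq_zero] at h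
    have h3 : ⁅e₁, σ e₂⁆ = 0 := by rw [← H.conj_conj ⁅e₁, σ e₂⁆, h, H.conj_zero]
    rw [h3, zero_lie]

/-- Either `ker T` is abelian, or its centre is at most a line. -/
theorem abelian_or_exists_eq_smul (H : SkewTorus T σ) (P : TwoPairRelations T σ e₁ e₂ p χ χ') :
    (∀ x y, HasWeight T 0 x → HasWeight T 0 y → ⁅x, y⁆ = 0) ∨
    ∀ z z', HasWeight T 0 z → HasWeight T 0 z' → (∀ x, HasWeight T 0 x → ⁅x, z⁆ = 0) →
      (∀ x, HasWeight T 0 x → ⁅x, z'⁆ = 0) → z ≠ 0 → ∃ c : ℂ, z' = c • z := by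
  have := H.finiteDimensional
  by_cases hab : ∀ x y, HasWeight T 0 x → HasWeight T 0 y → ⁅x, y⁆ = 0
  · exact Or.inl hab
  refine Or.inr fun z z' hz hz' hcz hcz' hz0 => ?_
  by_contra hcon
  push Not at hcon
  have hli : LinearIndependent ℂ ![z, z'] :=
    (LinearIndependent.pair_iff' hz0).mpr fun t h => hcon t h.symm
  have h2 := finrank_span_eq_card hli
  rw [Matrix.range_cons_cons_empty, Fintype.card_fin] at h2
  have hle : Submodule.span ℂ {z, z'} ≤ LinearMap.ker T := Submodule.span_le.mpr (by
    rintro u (rfl | hu)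
    · exact mem_ker_iff_hasWeight.mpr hz
    · rw [Set.mem_singleton_iff] at hu
      rw [hu]
      exact mem_ker_iff_hasWeight.mpr hz')
  -- Two independent central vectors leave at most one further generator of ker T, which commutes
  -- with itself.
  obtain ⟨q, hq, hAq⟩ := exists_le_sup_span_singleton_of_finrank_le hle
    (by have := P.finrank_ker; omega)
  have hcen : ∀ u ∈ Submodule.span ℂ {z, z'}, ∀ x, HasWeight T 0 x → ⁅x, u⁆ = 0 := by
    intro u hu x hx
    obtain ⟨c, d, rfl⟩ := Submodule.mem_span_pair.mp hu
    rw [lie_add, lie_smul, lie_smul, hcz x hx, hcz' x hx, smul_zero, smul_zero, add_zero]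
  refine hab fun x y hx hy => ?_
  obtain ⟨u, hu, c, hc, rfl⟩ := Submodule.mem_sup.mp (hAq (mem_ker_iff_hasWeight.mpr hx))
  obtain ⟨v, hv, d, hd, rfl⟩ := Submodule.mem_sup.mp (hAq (mem_ker_iff_hasWeight.mpr hy))
  obtain ⟨c, rfl⟩ := Submodule.mem_span_singleton.mp hc
  obtain ⟨d, rfl⟩ := Submodule.mem_span_singleton.mp hd
  have h1 := hcen u hu _ (mem_ker_iff_hasWeight.mp hq)
  rw [← lie_skew, neg_eq_zero] at h1
  rw [lie_add, hcen v hv _ hx, zero_add, add_lie, lie_smul, lie_smul, smul_lie, lie_self, h1]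
  simp

/-- Degrees 3 for e₁, 1 for e₂ (and their conjugates) and 2 for ker T: the nonzero brackets are
those of ker T with e₂, σ e₂ and ⁅e₂, σ e₂⁆. -/
theorem false_of_b_eq_zero_of_abelian (H : SkewTorus T σ)
    (P : TwoPairRelations T σ e₁ e₂ p χ χ') {x₁ x₂ x₃ : N}
    (hspan : ⊤ ≤ Submodule.span ℂ (Set.range ![e₁, e₂, x₁, σ e₁, σ e₂, x₂, x₃]))
    (hx₁ : HasWeight T 0 x₁) (hx₂ : HasWeight T 0 x₂) (hx₃ : HasWeight T 0 x₃)
    (hker : ∀ x, HasWeight T 0 x → ∃ c₁ c₂ c₃ : ℂ, x = c₁ • x₁ + c₂ • x₂ + c₃ • x₃)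
    (hab : ∀ x y, HasWeight T 0 x → HasWeight T 0 y → ⁅x, y⁆ = 0) (hb : ⁅e₁, σ e₂⁆ = 0) :
    False := by
  have hT := hasWeight_frame P.weight₁ P.weight₂ hx₁ (H.weight_conj P.weight₁)
    (H.weight_conj P.weight₂) hx₂ hx₃
  have h12 := P.lie₁₂
  have g12 := H.lie_conj_eq_zero h12
  have k11 := P.a_eq_zero H
  have k21 := H.lie_conj_swap_eq_zero hb
  obtain ⟨c₁, c₂, c₃, k22⟩ := hker _ (weight_lie_conj H P.weight₂ P.weight₂)
  have a12 := hab _ _ hx₁ hx₂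
  have a13 := hab _ _ hx₁ hx₃
  have a23 := hab _ _ hx₂ hx₃
  have hl₁ : ∀ x, HasWeight T 0 x → ⁅e₁, x⁆ = 0 := fun x hx => by
    rw [← lie_skew, P.lie₁ x hx, neg_zero]
  have hl₂ : ∀ x, HasWeight T 0 x → ⁅e₂, x⁆ = -(χ x • e₁) := fun x hx => by
    rw [← lie_skew, P.lie₂ x hx]
  have hm₁ : ∀ x, HasWeight T 0 x → ⁅σ e₁, x⁆ = 0 := fun x hx => by
    rw [← lie_skew, P.conj₁ x hx, neg_zero]
  have hm₂ : ∀ x, HasWeight T 0 x → ⁅σ e₂, x⁆ = -(χ' x • σ e₁) := fun x hx => by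
    rw [← lie_skew, P.conj₂ x hx]
  refine H.false_of_grading hspan hT ![3, 1, 2, 3, 1, 2, 2] ?_ 2 2 (by simp) (by simp)
  intro D hD i j hij
  have d0 : D e₁ = (3 : ℂ) • e₁ := hD 0
  have d2 : D x₁ = (2 : ℂ) • x₁ := hD 2
  have d3 : D (σ e₁) = (3 : ℂ) • σ e₁ := hD 3
  have d5 : D x₂ = (2 : ℂ) • x₂ := hD 5
  have d6 : D x₃ = (2 : ℂ) • x₃ := hD 6
  fin_cases i <;> fin_cases j <;> first
    | exact absurd hij (by decide)
    | (simp [h12, g12, k11, k21, k22, hb, a12, a13, a23, hl₁ _ hx₁, hl₁ _ hx₂, hl₁ _ hx₃,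
        hl₂ _ hx₁, hl₂ _ hx₂, hl₂ _ hx₃, P.conj₁ _ hx₁, P.conj₂ _ hx₁, hm₁ _ hx₂, hm₁ _ hx₃,
        hm₂ _ hx₂, hm₂ _ hx₃, d0, d2, d3, d5, d6]
       try module)

/-- The centre of ker T is the line of a nonzero bracket ⁅y, y'⁆, and it contains ⁅e₂, σ e₂⁆. All
brackets are therefore central, and the two-step obstruction applies. -/
theorem false_of_b_eq_zero_of_line (H : SkewTorus T σ)
    (P : TwoPairRelations T σ e₁ e₂ p χ χ') {x₁ x₂ x₃ : N}
    (hspan : ⊤ ≤ Submodule.span ℂ (Set.range ![e₁, e₂, x₁, σ e₁, σ e₂, x₂, x₃]))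
    (hx₁ : HasWeight T 0 x₁) (hx₂ : HasWeight T 0 x₂) (hx₃ : HasWeight T 0 x₃) (hx0 : x₁ ≠ 0)
    (hab : ¬ ∀ x y, HasWeight T 0 x → HasWeight T 0 y → ⁅x, y⁆ = 0)
    (hb : ⁅e₁, σ e₂⁆ = 0) : False := by
  have hline := (P.abelian_or_exists_eq_smul H).resolve_left hab
  push Not at hab
  obtain ⟨y, y', hy, hy', hyy⟩ := hab
  have k11 := P.a_eq_zero H
  have k21 := H.lie_conj_swap_eq_zero hb
  have g12 := H.lie_conj_eq_zero P.lie₁₂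
  have hswap : ∀ {u v : N}, ⁅u, v⁆ = 0 → ⁅v, u⁆ = 0 := fun {u v} h => by
    rw [← lie_skew, h, neg_zero]
  have hxx : ∀ x x' : N, HasWeight T 0 x → HasWeight T 0 x' → ∀ k,
      ⁅![e₁, e₂, x₁, σ e₁, σ e₂, x₂, x₃] k, ⁅x, x'⁆⁆ = 0 := by
    intro x x' hx hx' k
    have h2 : ∀ z, HasWeight T 0 z → ⁅z, ⁅x, x'⁆⁆ = 0 := fun z hz =>
      H.lie_lie_eq_zero_of_finrank_ker_le P.finrank_ker hz hx hx'
    have hw := H.weight_zero_lie hx hx'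
    fin_cases k
    · exact hswap (P.lie₁ _ hw)
    · refine hswap (u := ⁅x, x'⁆) ?_
      change ⁅⁅x, x'⁆, e₂⁆ = 0
      rw [lie_lie, P.lie₂ x hx, P.lie₂ x' hx', lie_smul, lie_smul, P.lie₁ x hx, P.lie₁ x' hx',
        smul_zero, smul_zero, sub_zero]
    · exact h2 _ hx₁
    · exact hswap (P.conj₁ _ hw)
    · refine hswap (u := ⁅x, x'⁆) ?_
      change ⁅⁅x, x'⁆, σ e₂⁆ = 0
      rw [lie_lie, P.conj₂ x hx, P.conj₂ x' hx', lie_smul, lie_smul, P.conj₁ x hx,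
        P.conj₁ x' hx', smul_zero, smul_zero, sub_zero]
    · exact h2 _ hx₂
    · exact h2 _ hx₃
  have hc : ∀ k, ⁅![e₁, e₂, x₁, σ e₁, σ e₂, x₂, x₃] k, ⁅e₂, σ e₂⁆⁆ = 0 := by
    obtain ⟨t, ht⟩ := hline ⁅y, y'⁆ ⁅e₂, σ e₂⁆ (H.weight_zero_lie hy hy')
      (weight_lie_conj H P.weight₂ P.weight₂)
      (fun x hx => H.lie_lie_eq_zero_of_finrank_ker_le P.finrank_ker hx hy hy')
      (fun x hx => by rw [P.lie_c hx, hb, k21, smul_zero, smul_zero, add_zero]) hyy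
    intro k
    rw [ht, lie_smul, hxx y y' hy hy', smul_zero]
  have he : ∀ k, ⁅![e₁, e₂, x₁, σ e₁, σ e₂, x₂, x₃] k, e₁⁆ = 0 := by
    intro k
    fin_cases k
    exacts [lie_self e₁, hswap P.lie₁₂, P.lie₁ _ hx₁, hswap k11, hswap hb, P.lie₁ _ hx₂,
      P.lie₁ _ hx₃]
  have hf : ∀ k, ⁅![e₁, e₂, x₁, σ e₁, σ e₂, x₂, x₃] k, σ e₁⁆ = 0 := by
    intro k
    fin_cases k
    exacts [k11, k21, P.conj₁ _ hx₁, lie_self _, hswap g12, P.conj₁ _ hx₂, P.conj₁ _ hx₃]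
  have h0 : ∀ {u v : N}, ⁅u, v⁆ = 0 → ∀ k,
      ⁅![e₁, e₂, x₁, σ e₁, σ e₂, x₂, x₃] k, ⁅u, v⁆⁆ = 0 := fun {u v} h k => by
    rw [h, lie_zero]
  have h1 : ∀ {u v w : N} {c : ℂ}, ⁅u, v⁆ = c • w →
      (∀ k, ⁅![e₁, e₂, x₁, σ e₁, σ e₂, x₂, x₃] k, w⁆ = 0) → ∀ k,
      ⁅![e₁, e₂, x₁, σ e₁, σ e₂, x₂, x₃] k, ⁅u, v⁆⁆ = 0 := fun {u v w c} h hw k => by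
    rw [h, lie_smul, hw, smul_zero]
  have hneg : ∀ {u v w : N} {c : ℂ}, ⁅v, u⁆ = c • w → ⁅u, v⁆ = (-c) • w := fun {u v w c} h => by
    rw [← lie_skew, h, neg_smul]
  refine H.false_of_two_step (lie_lie_eq_zero_of_span hspan ?_) hx₁ hx0
  intro i j hij
  fin_cases i <;> fin_cases j <;> first
    | exact absurd hij (by decide)
    | exact h0 P.lie₁₂
    | exact h0 g12
    | exact h0 k11
    | exact h0 k21
    | exact h0 hb
    | exact hc
    | exact h0 (hswap (P.lie₁ _ ‹_›))
    | exact h1 (hneg (P.lie₂ _ ‹_›)) he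
    | exact h0 (P.conj₁ _ ‹_›)
    | exact h1 (P.conj₂ _ ‹_›) hf
    | exact h0 (hswap (P.conj₁ _ ‹_›))
    | exact h1 (hneg (P.conj₂ _ ‹_›)) hf
    | exact hxx _ _ ‹_› ‹_›

/-- Degrees 3 for e₁, 1 for e, 4 for b = ⁅e₁, σ e₂⁆ and 2 for y₁, y₂; σ e₁ and σ e₂ have degrees 3
and 1. This needs ⁅e, σ e₂⁆ to have no b-component, which is why e replaces e₂ while σ e₂ stays. -/
theorem false_of_b_ne_zero (H : SkewTorus T σ) (P : TwoPairRelations T σ e₁ e₂ p χ χ')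
    {e y₁ y₂ : N} {s t β τ : ℂ}
    (hspan : ⊤ ≤ Submodule.span ℂ
      (Set.range ![e₁, e, y₁, σ e₁, σ e₂, y₂, ⁅e₁, σ e₂⁆]))
    (te : HasWeight T p e) (hy₁ : HasWeight T 0 y₁) (hy₂ : HasWeight T 0 y₂)
    (h12 : ⁅e₁, e⁆ = 0) (hel : ∀ x, HasWeight T 0 x → ⁅x, e⁆ = χ x • e₁)
    (hbe : ⁅⁅e₁, σ e₂⁆, e⁆ = 0)
    (k21 : ⁅e, σ e₁⁆ = β • ⁅e₁, σ e₂⁆) (k22 : ⁅e, σ e₂⁆ = s • y₁ + t • y₂)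
    (hyy : ⁅y₁, y₂⁆ = τ • ⁅e₁, σ e₂⁆) : False := by
  have hb := weight_lie_conj H P.weight₁ P.weight₂
  have hT := hasWeight_frame P.weight₁ te hy₁ (H.weight_conj P.weight₁)
    (H.weight_conj P.weight₂) hy₂ hb
  have g12 := H.lie_conj_eq_zero P.lie₁₂
  have k11 := P.a_eq_zero H
  have hl₁ : ∀ x, HasWeight T 0 x → ⁅e₁, x⁆ = 0 := fun x hx => by
    rw [← lie_skew, P.lie₁ x hx, neg_zero]
  have hl₂ : ∀ x, HasWeight T 0 x → ⁅e, x⁆ = -(χ x • e₁) := fun x hx => by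
    rw [← lie_skew, hel x hx]
  have hm₁ : ∀ x, HasWeight T 0 x → ⁅σ e₁, x⁆ = 0 := fun x hx => by
    rw [← lie_skew, P.conj₁ x hx, neg_zero]
  have hm₂ : ∀ x, HasWeight T 0 x → ⁅σ e₂, x⁆ = -(χ' x • σ e₁) := fun x hx => by
    rw [← lie_skew, P.conj₂ x hx]
  have hbe' : ⁅e, ⁅e₁, σ e₂⁆⁆ = 0 := by rw [← lie_skew, hbe, neg_zero]
  have hbf : ⁅σ e₂, ⁅e₁, σ e₂⁆⁆ = 0 := by rw [← lie_skew, P.b_lie_conj H, neg_zero]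
  have hl₁b := hl₁ _ hb
  have hm₁b := hm₁ _ hb
  have hb₁ := P.lie_b_eq_zero H hy₁
  have hb₂ := P.lie_b_eq_zero H hy₂
  have l₁y₁ := hl₁ _ hy₁
  have l₁y₂ := hl₁ _ hy₂
  have hc₁ := P.conj₁ _ hy₁
  have hc₂ := P.conj₂ _ hy₁
  generalize hbdef : ⁅e₁, σ e₂⁆ = b at *
  refine H.false_of_grading hspan hT ![3, 1, 2, 3, 1, 2, 4] ?_ 6 6 (by simp) (by simp)
  intro D hD i j hij
  have d0 : D e₁ = (3 : ℂ) • e₁ := hD 0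
  have d2 : D y₁ = (2 : ℂ) • y₁ := hD 2
  have d3 : D (σ e₁) = (3 : ℂ) • σ e₁ := hD 3
  have d5 : D y₂ = (2 : ℂ) • y₂ := hD 5
  have d6 : D b = (4 : ℂ) • b := hD 6
  fin_cases i <;> fin_cases j <;> first
    | exact absurd hij (by decide)
    | (simp [h12, g12, k11, k21, k22, hyy, hbdef, hbe', hbf, hl₁b, hm₁b, hb₁, hb₂, l₁y₁, l₁y₂,
        hl₂ _ hy₁, hl₂ _ hy₂, hc₁, hc₂, hm₁ _ hy₂, hm₂ _ hy₂, d0, d2, d3, d5, d6]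
       try module)

end TwoPairRelations

theorem false_of_two_equal_weights (H : SkewTorus T σ) {a₁ a₂ x₁ x₂ x₃ : N} {p : ℝ}
    (hspan : ⊤ ≤ Submodule.span ℂ (Set.range ![a₁, a₂, x₁, σ a₁, σ a₂, x₂, x₃]))
    (hk : finrank ℂ (LinearMap.ker T) ≤ 3) (hx₁ : HasWeight T 0 x₁) (hx₂ : HasWeight T 0 x₂)
    (hx₃ : HasWeight T 0 x₃) (hx0 : x₁ ≠ 0) (ha : a₁ ≠ 0) (hp : 0 < p)
    (t₁ : HasWeight T p a₁) (t₂ : HasWeight T p a₂) : False := by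
  have := H.finiteDimensional
  have hT := hasWeight_frame t₁ t₂ hx₁ (H.weight_conj t₁) (H.weight_conj t₂) hx₂ hx₃
  have hker : ∀ x, HasWeight T 0 x → ∃ c₁ c₂ c₃ : ℂ, x = c₁ • x₁ + c₂ • x₂ + c₃ • x₃ := by
    intro v hv
    obtain ⟨c, hc, hc'⟩ := H.exists_coeff hspan hT hv
    refine ⟨c 2, c 5, c 6, ?_⟩
    have z0 := hc' 0 (by intro h; dsimp at h; linarith)
    have z1 := hc' 1 (by intro h; dsimp at h; linarith)
    have z3 := hc' 3 (by intro h; dsimp at h; linarith)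
    have z4 := hc' 4 (by intro h; dsimp at h; linarith)
    rw [Fin.sum_univ_seven, z0, z1, z3, z4] at hc
    simpa using hc
  have hE : ∀ v, HasWeight T p v → v ∈ Submodule.span ℂ {a₁, a₂} := by
    intro v hv
    obtain ⟨c, d, hcd⟩ := H.exists_smul_add_of_weight hspan hT hv 0 1 (by decide) (by
      intro i hi hi'
      fin_cases i <;> first
        | exact absurd rfl hi
        | exact absurd rfl hi'
        | (intro h; dsimp at h; linarith))
    exact Submodule.mem_span_pair.mpr ⟨c, d, hcd.symm⟩
  have hE' : ∀ v ∈ Submodule.span ℂ {a₁, a₂}, HasWeight T p v := by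
    intro v hv
    obtain ⟨c, d, rfl⟩ := Submodule.mem_span_pair.mp hv
    rw [HasWeight, map_add, map_smul, map_smul, t₁, t₂]
    module
  have hEE : ∀ u v : N, HasWeight T p u → HasWeight T p v → ⁅u, v⁆ = 0 := fun u v hu hv =>
    H.eq_zero_of_weight hspan hT (H.weight_lie hu hv) (by
      intro i; fin_cases i <;> (intro h; dsimp at h; linarith))
  obtain ⟨u₁, u₂, hu₁, heq, hu⟩ := exists_flag_of_isNilpotent (K := ℂ) H.nil (a₂ := a₂) ha
    (S := {x | HasWeight T 0 x}) (fun x hx u hu =>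
      hE _ (HasWeight.lie_zero_left H hx (hE' u hu)))
  have m₁ : HasWeight T p u₁ := hE' _ (heq ▸ Submodule.subset_span (by simp))
  have m₂ : HasWeight T p u₂ := hE' _ (heq ▸ Submodule.subset_span (by simp))
  have hspan' := H.span_replace_pair hspan heq
  have hl₁ : ∀ x, HasWeight T 0 x → ⁅x, u₁⁆ = 0 := fun x hx => (hu x hx).1
  have hl₂ : ∀ x, HasWeight T 0 x → ∃ c : ℂ, ⁅x, u₂⁆ = c • u₁ := fun x hx =>
    (hu x hx).2 u₂ (hE _ m₂)
  choose! χ hχ using hl₂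
  have hc₁ : ∀ x, HasWeight T 0 x → ⁅x, σ u₁⁆ = 0 := fun x hx => by
    have h1 := H.lie_conj_eq_zero (hl₁ (σ x) (H.weight_zero_conj hx))
    rwa [H.conj_conj] at h1
  have hc₂ : ∀ x, HasWeight T 0 x → ⁅x, σ u₂⁆ = starRingEnd ℂ (χ (σ x)) • σ u₁ := fun x hx => by
    have h1 := H.lie_conj_eq (hχ (σ x) (H.weight_zero_conj hx))
    rwa [H.conj_conj] at h1
  by_cases hχ0 : ∀ x, HasWeight T 0 x → χ x = 0
  · exact H.false_of_two_weights_central hspan' hk hx₁ hx₂ hx₃ hx0 hl₁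
      (fun x hx => by rw [hχ x hx, hχ0 x hx, zero_smul]) (hEE _ _ m₁ m₂)
      (TwoPairRelations.weight_lie_conj H m₁ m₁) (TwoPairRelations.weight_lie_conj H m₁ m₂)
      (TwoPairRelations.weight_lie_conj H m₂ m₁) (TwoPairRelations.weight_lie_conj H m₂ m₂)
  push Not at hχ0
  obtain ⟨x, hx, hχx⟩ := hχ0
  -- If χ(σ x) = 0, the σ-fixed vector x + σ x has the same nonzero value of χ and serves both
  -- conditions.
  have hne : ∃ x, HasWeight T 0 x ∧ χ x ≠ 0 ∧ starRingEnd ℂ (χ (σ x)) ≠ 0 := by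
    by_cases h1 : χ (σ x) = 0
    · have hxs : HasWeight T 0 (x + σ x) := by
        have hx' := H.weight_zero_conj hx
        rw [HasWeight] at *
        rw [map_add, hx, hx', smul_add]
      have h2 : χ (x + σ x) = χ x := by
        have h3 := hχ _ hxs
        rw [add_lie, hχ x hx, hχ _ (H.weight_zero_conj hx), h1, zero_smul, add_zero] at h3
        exact smul_left_injective ℂ hu₁ h3.symm
      have h4 : σ (x + σ x) = x + σ x := by rw [H.conj_add, H.conj_conj, add_comm]
      exact ⟨x + σ x, hxs, by rwa [h2], by rw [h4, h2]; simpa using hχx⟩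
    · exact ⟨x, hx, hχx, by simpa using h1⟩
  have P : TwoPairRelations T σ u₁ u₂ p χ (fun x => starRingEnd ℂ (χ (σ x))) :=
    ⟨hk, hu₁, m₁, m₂, hl₁, hχ, hc₁, hc₂, hEE _ _ m₁ m₂, hne⟩
  by_cases hb : ⁅u₁, σ u₂⁆ = 0
  · by_cases hab : ∀ x y, HasWeight T 0 x → HasWeight T 0 y → ⁅x, y⁆ = 0
    · exact P.false_of_b_eq_zero_of_abelian H hspan' hx₁ hx₂ hx₃ hker hab hb
    · exact P.false_of_b_eq_zero_of_line H hspan' hx₁ hx₂ hx₃ hx0 hab hb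
  have wb := TwoPairRelations.weight_lie_conj H m₁ m₂
  have wc := TwoPairRelations.weight_lie_conj H m₂ m₂
  -- For abelian ker T, the vanishing of ⁅x, ⁅u₂, σ u₂⁆⁆ is a linear relation between the two
  -- brackets. Otherwise both are central in ker T, whose centre is at most a line.
  obtain ⟨β, hβ⟩ : ∃ β : ℂ, ⁅u₂, σ u₁⁆ = β • ⁅u₁, σ u₂⁆ := by
    rcases P.abelian_or_exists_eq_smul H with hab | hline
    · obtain ⟨x, hx, -, hx'⟩ := hne
      have h1 := P.lie_c hx
      rw [hab _ _ hx wc] at h1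
      refine ⟨-((starRingEnd ℂ (χ (σ x)))⁻¹ * χ x), ?_⟩
      rw [neg_smul, mul_smul, eq_neg_of_add_eq_zero_left h1.symm, smul_neg, neg_neg,
        inv_smul_smul₀ hx']
    · exact hline _ _ wb (TwoPairRelations.weight_lie_conj H m₂ m₁)
        (fun x hx => P.lie_b_eq_zero H hx) (fun x hx => P.lie_b'_eq_zero H hx) hb
  have hyy : ∀ y₁ y₂ : N, HasWeight T 0 y₁ → HasWeight T 0 y₂ →
      ∃ τ : ℂ, ⁅y₁, y₂⁆ = τ • ⁅u₁, σ u₂⁆ := by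
    intro y₁ y₂ h₁ h₂
    rcases P.abelian_or_exists_eq_smul H with hab | hline
    · exact ⟨0, by rw [hab _ _ h₁ h₂, zero_smul]⟩
    · exact hline _ _ wb (H.weight_zero_lie h₁ h₂) (fun x hx => P.lie_b_eq_zero H hx)
        (fun x hx => H.lie_lie_eq_zero_of_finrank_ker_le hk hx h₁ h₂) hb
  have hsp : ∀ (γ : ℂ) (y₁ y₂ : N),
      LinearMap.ker T ≤ Submodule.span ℂ {⁅u₁, σ u₂⁆, y₁, y₂} →
      ⊤ ≤ Submodule.span ℂ
        (Set.range ![u₁, u₂ - γ • u₁, y₁, σ u₁, σ u₂, y₂, ⁅u₁, σ u₂⁆]) := by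
    intro γ y₁ y₂ hle
    refine hspan'.trans (Submodule.span_le.mpr ?_)
    have m₀ : u₁ ∈ Submodule.span ℂ
        (Set.range ![u₁, u₂ - γ • u₁, y₁, σ u₁, σ u₂, y₂, ⁅u₁, σ u₂⁆]) :=
      Submodule.subset_span ⟨0, rfl⟩
    have m₁ : u₂ - γ • u₁ ∈ Submodule.span ℂ
        (Set.range ![u₁, u₂ - γ • u₁, y₁, σ u₁, σ u₂, y₂, ⁅u₁, σ u₂⁆]) :=
      Submodule.subset_span ⟨1, rfl⟩
    have m₁' := add_mem m₁ (Submodule.smul_mem _ γ m₀)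
    rw [sub_add_cancel] at m₁'
    have m₃ : σ u₁ ∈ Submodule.span ℂ
        (Set.range ![u₁, u₂ - γ • u₁, y₁, σ u₁, σ u₂, y₂, ⁅u₁, σ u₂⁆]) :=
      Submodule.subset_span ⟨3, rfl⟩
    have m₄ : σ u₂ ∈ Submodule.span ℂ
        (Set.range ![u₁, u₂ - γ • u₁, y₁, σ u₁, σ u₂, y₂, ⁅u₁, σ u₂⁆]) :=
      Submodule.subset_span ⟨4, rfl⟩
    have hle' : ∀ x, HasWeight T 0 x → x ∈ Submodule.span ℂ
        (Set.range ![u₁, u₂ - γ • u₁, y₁, σ u₁, σ u₂, y₂, ⁅u₁, σ u₂⁆]) := by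
      intro x hx
      refine Submodule.span_mono ?_ (hle (mem_ker_iff_hasWeight.mpr hx))
      rintro z (rfl | rfl | rfl)
      exacts [⟨6, rfl⟩, ⟨2, rfl⟩, ⟨5, rfl⟩]
    rintro _ ⟨i, rfl⟩
    fin_cases i
    exacts [m₀, m₁', hle' _ hx₁, m₃, m₄, hle' _ hx₂, hle' _ hx₃]
  have hle₁ : Submodule.span ℂ {⁅u₁, σ u₂⁆} ≤ LinearMap.ker T :=
    (Submodule.span_singleton_le_iff_mem _ _).mpr (mem_ker_iff_hasWeight.mpr wb)
  -- If ⁅u₂, σ u₂⁆ is a multiple of b, subtracting γ u₁ from u₂ removes it; if not, it can itself be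
  -- the basis vector y₁ of ker T.
  by_cases hc : ∃ γ : ℂ, ⁅u₂, σ u₂⁆ = γ • ⁅u₁, σ u₂⁆
  · obtain ⟨γ, hγ⟩ := hc
    obtain ⟨y₁, hy₁, hle₂, hf⟩ := exists_le_sup_span_singleton (n := 1) hle₁
      (by rw [finrank_span_singleton hb]; omega)
    obtain ⟨y₂, hy₂, hle₃⟩ := exists_le_sup_span_singleton_of_finrank_le hle₂ hf
    rw [mem_ker_iff_hasWeight] at hy₁ hy₂
    obtain ⟨τ, hτ⟩ := hyy _ _ hy₁ hy₂
    refine P.false_of_b_ne_zero H (e := u₂ - γ • u₁) (s := 0) (t := 0) (β := β)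
      (hsp γ y₁ y₂ (hle₃.trans ?_)) ?_ hy₁ hy₂ ?_ (fun x hx => ?_) ?_ ?_ ?_ hτ
    · rw [Submodule.span_insert, Submodule.span_insert, sup_assoc]
    · rw [HasWeight, map_sub, map_smul, m₁, m₂]
      module
    · rw [lie_sub, lie_smul, lie_self, P.lie₁₂, smul_zero, sub_zero]
    · rw [lie_sub, lie_smul, hl₁ x hx, smul_zero, sub_zero, hχ x hx]
    · rw [lie_sub, lie_smul, hl₁ _ wb, smul_zero, sub_zero, P.b_lie_e₂ H]
    · rw [sub_lie, smul_lie, P.a_eq_zero H, smul_zero, sub_zero, hβ]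
    · rw [sub_lie, smul_lie, hγ, sub_self, zero_smul, zero_smul, add_zero]
  · push Not at hc
    have hli : LinearIndependent ℂ ![⁅u₁, σ u₂⁆, ⁅u₂, σ u₂⁆] :=
      (LinearIndependent.pair_iff' hb).mpr fun t h => hc t h.symm
    have h2 := finrank_span_eq_card hli
    rw [Matrix.range_cons_cons_empty, Fintype.card_fin] at h2
    have hle₂ : Submodule.span ℂ {⁅u₁, σ u₂⁆, ⁅u₂, σ u₂⁆} ≤ LinearMap.ker T :=
      Submodule.span_le.mpr (by
        rintro u (rfl | hu)
        · exact mem_ker_iff_hasWeight.mpr wb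
        · rw [Set.mem_singleton_iff] at hu
          rw [hu]
          exact mem_ker_iff_hasWeight.mpr wc)
    obtain ⟨y, hy, hle₃⟩ := exists_le_sup_span_singleton_of_finrank_le hle₂ (by omega)
    rw [mem_ker_iff_hasWeight] at hy
    obtain ⟨τ, hτ⟩ := hyy _ _ wc hy
    have hsp0 := hsp 0 ⁅u₂, σ u₂⁆ y (hle₃.trans (by
      rw [Submodule.span_insert, Submodule.span_insert, Submodule.span_insert _ {y}, sup_assoc]))
    rw [zero_smul, sub_zero] at hsp0
    exact P.false_of_b_ne_zero H (e := u₂) (s := 1) (t := 0) (β := β) hsp0 m₂ wc hy P.lie₁₂ hχ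
      (P.b_lie_e₂ H) hβ (by rw [one_smul, zero_smul, add_zero]) hτ

end SkewTorus

end RigidLie

/-! ### A single positive weight -/

namespace RigidLie

open Module

theorem lie_mem_of_mem_sup_span_singleton {K N : Type*} [Field K] [LieRing N] [LieAlgebra K N]
    {Q S : Submodule K N} {q : N} (h₁ : ∀ u ∈ Q, ∀ v ∈ Q, ⁅u, v⁆ ∈ S) (h₂ : ∀ u ∈ Q, ⁅q, u⁆ ∈ S) :
    ∀ u ∈ Q ⊔ Submodule.span K {q}, ∀ v ∈ Q ⊔ Submodule.span K {q}, ⁅u, v⁆ ∈ S := by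
  intro u hu v hv
  obtain ⟨u, hu, c, hc, rfl⟩ := Submodule.mem_sup.mp hu
  obtain ⟨v, hv, d, hd, rfl⟩ := Submodule.mem_sup.mp hv
  obtain ⟨c, rfl⟩ := Submodule.mem_span_singleton.mp hc
  obtain ⟨d, rfl⟩ := Submodule.mem_span_singleton.mp hd
  have h3 : ⁅u + c • q, v + d • q⁆ = ⁅u, v⁆ + c • ⁅q, v⁆ - d • ⁅q, u⁆ := by
    simp only [lie_add, add_lie, lie_smul, smul_lie, lie_self]
    rw [← lie_skew u q]
    module
  rw [h3]
  exact sub_mem (add_mem (h₁ u (by assumption) v (by assumption))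
    (S.smul_mem c (h₂ v (by assumption)))) (S.smul_mem d (h₂ u (by assumption)))

namespace SkewTorus

variable {N : Type*} [LieRing N] [LieAlgebra ℂ N] {T : Module.End ℂ N} {σ : N → N}

/-- Let A = ker T and z = ⁅e, σ e⁆, which is central. If z = 0 or z is not in ⁅A, A⁆, a derivation
of degree 1 on e and σ e exists. Otherwise the maps φ ⊗ z, for functionals φ on A/⁅A, A⁆, are
derivations and must be inner. This yields many elements of A whose brackets with A lie in ℂz, and a
dimension count forces ⁅A, A⁆ ⊆ ℂz, the two-step case. -/
theorem false_of_single_weight (H : SkewTorus T σ) {e : N} {s : ℝ} (te : HasWeight T s e)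
    (he : e ≠ 0) (hs : s ≠ 0) (hline : ∀ v, HasWeight T s v → ∃ c : ℂ, v = c • e)
    (hdec : ∀ v, ∃ (α β : ℂ) (a : N), T a = 0 ∧ v = α • e + β • σ e + a)
    {π : Module.End ℂ N} (hπT : ∀ x, π (T x) = 0)
    (hπ : ∀ x, T x = 0 → π x = x) (hπ' : ∀ x, ∃ y, x - π x = T y)
    (hk : finrank ℂ (LinearMap.ker T) ≤ 5) : False := by
  have hfd := H.finiteDimensional
  have hwt : ∀ {x : N}, T x = 0 → HasWeight T 0 x := fun h => mem_ker_iff_hasWeight.mp h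
  have hsC : (s : ℂ) ≠ 0 := by exact_mod_cast hs
  have tf := H.weight_conj te
  have hf := H.conj_ne_zero he
  have hxe : ∀ x, T x = 0 → ⁅x, e⁆ = 0 := fun x hx => by
    obtain ⟨c, hc⟩ := hline _ (HasWeight.lie_zero_left H (hwt hx) te)
    rw [hc, eq_zero_of_lie_eq_smul H.nil he hc, zero_smul]
  have hxf : ∀ x, T x = 0 → ⁅x, σ e⁆ = 0 := fun x hx => by
    have h1 := H.lie_conj_eq_zero (hxe (σ x) (mem_ker_iff_hasWeight.mpr
      (H.weight_zero_conj (hwt hx))))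
    rwa [H.conj_conj] at h1
  have hswap : ∀ {u v : N}, ⁅u, v⁆ = 0 → ⁅v, u⁆ = 0 := fun {u v} h => by
    rw [← lie_skew, h, neg_zero]
  obtain ⟨z, hz⟩ : ∃ z : N, ⁅e, σ e⁆ = z := ⟨_, rfl⟩
  have hTz : T z = 0 := by
    have : HasWeight T 0 z := by simpa [hz] using H.weight_lie te tf
    exact mem_ker_iff_hasWeight.mpr this
  have hzc : ∀ y : N, ⁅y, z⁆ = 0 := by
    intro y
    obtain ⟨α, β, a, ha, rfl⟩ := hdec y
    have h1 : ⁅a, z⁆ = 0 := by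
      rw [← hz, leibniz_lie, hxe a ha, hxf a ha, zero_lie, lie_zero, add_zero]
    rw [add_lie, add_lie, smul_lie, smul_lie, h1, hswap (hxe z hTz), hswap (hxf z hTz)]
    simp
  have hbr : ∀ {α β γ δ : ℂ} {a b : N}, T a = 0 → T b = 0 →
      ⁅α • e + β • σ e + a, γ • e + δ • σ e + b⁆ = (α * δ - β * γ) • z + ⁅a, b⁆ := by
    intro α β γ δ a b ha hb
    simp only [add_lie, lie_add, smul_lie, lie_smul, lie_self, hxe a ha, hxf a ha,
      hswap (hxe b hb), hswap (hxf b hb), hz, ← lie_skew (σ e) e]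
    module
  have hTe : T e = (s : ℂ) • e := te
  have hTf : T (σ e) = -(s : ℂ) • σ e := by
    rw [tf]
    push_cast
    rfl
  have hπe : π e = 0 := by
    have := hπT e
    rw [hTe, map_smul] at this
    exact (smul_eq_zero.mp this).resolve_left hsC
  have hπf : π (σ e) = 0 := by
    have := hπT (σ e)
    rw [hTf, map_smul] at this
    exact (smul_eq_zero.mp this).resolve_left (neg_ne_zero.mpr hsC)
  have hTlie : ∀ {a b : N}, T a = 0 → T b = 0 → T ⁅a, b⁆ = 0 := fun {a b} ha hb => by
    rw [H.der, ha, hb, zero_lie, lie_zero, add_zero]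
  have hzP : ∀ y : N, ⁅z, y⁆ = 0 := fun y => hswap (hzc y)
  obtain ⟨A, hA⟩ : ∃ A : Submodule ℂ N, A = LinearMap.ker T := ⟨_, rfl⟩
  have hAm : ∀ {x}, x ∈ A ↔ T x = 0 := fun {x} => by rw [hA, LinearMap.mem_ker]
  have hKA : lieSpan A ≤ A := lieSpan_le fun u hu v hv => hAm.mpr (hTlie (hAm.mp hu) (hAm.mp hv))
  -- The condition on ψ z covers both z = 0 and ψ z = 1; it fails exactly when z is a nonzero
  -- element of ⁅A, A⁆.
  by_cases hψ : ∃ ψ : N →ₗ[ℂ] ℂ, (∀ x ∈ lieSpan A, ψ x = 0) ∧ ψ z • z = z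
  · obtain ⟨ψ, hψK, hψz⟩ := hψ
    let D : Module.End ℂ N := LinearMap.id - π + (2 : ℂ) • (ψ ∘ₗ π).smulRight z
    have hD : ∀ {α β : ℂ} {a : N}, T a = 0 →
        D (α • e + β • σ e + a) = α • e + β • σ e + (2 * ψ a) • z := by
      intro α β a ha
      have h1 : π (α • e + β • σ e + a) = a := by
        rw [map_add, map_add, map_smul, map_smul, hπe, hπf, hπ a ha]
        simp
      change (α • e + β • σ e + a) - π (α • e + β • σ e + a) +
        (2 : ℂ) • (ψ (π (α • e + β • σ e + a)) • z) = _
      rw [h1, smul_smul]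
      abel
    have hD0 : ∀ {a : N}, T a = 0 → D a = (2 * ψ a) • z := fun {a} ha => by
      simpa using hD (α := 0) (β := 0) ha
    have hder : IsDer D := by
      intro u v
      obtain ⟨α, β, a, ha, rfl⟩ := hdec u
      obtain ⟨γ, δ, b, hb, rfl⟩ := hdec v
      have hz1 : T ((2 * ψ a) • z) = 0 := by rw [map_smul, hTz, smul_zero]
      have hz2 : T ((2 * ψ b) • z) = 0 := by rw [map_smul, hTz, smul_zero]
      rw [hD ha, hD hb, hbr ha hb, hbr hz1 hb, hbr ha hz2, map_add, map_smul, hD0 hTz,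
        hD0 (hTlie ha hb), hψK _ (lie_mem_lieSpan (hAm.mpr ha) (hAm.mpr hb)), smul_lie, lie_smul,
        hzP, hzc, mul_smul 2 (ψ z), hψz]
      module
    have hcomm : ∀ x, D (T x) = T (D x) := by
      intro x
      obtain ⟨α, β, a, ha, rfl⟩ := hdec x
      have hz1 : T ((2 * ψ a) • z) = 0 := by rw [map_smul, hTz, smul_zero]
      have h1 : T (α • e + β • σ e + a) = (α * s) • e + (-(β * s)) • σ e + 0 := by
        rw [map_add, map_add, map_smul, map_smul, hTe, hTf, ha]
        module
      rw [hD ha, h1, hD (map_zero T), map_add, map_add, map_smul T α, map_smul T β, hTe, hTf,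
        hz1, map_zero]
      module
    have hDe : D e = (1 : ℂ) • e := by simpa using hD (α := 1) (β := 0) (map_zero T)
    have hDf : D (σ e) = (1 : ℂ) • σ e := by simpa using hD (α := 0) (β := 1) (map_zero T)
    have := H.add_eq_zero_of_eigen hder hcomm te tf (add_neg_cancel s) he hf hDe hDf
    norm_num at this
  have hz0 : z ≠ 0 := by
    rintro rfl
    exact hψ ⟨0, fun _ _ => rfl, by simp⟩
  have hzK : z ∈ lieSpan A := by
    by_contra hzK
    obtain ⟨f, hf, hf'⟩ := Submodule.exists_le_ker_of_notMem hzK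
    refine hψ ⟨(f z)⁻¹ • f, fun x hx => ?_, ?_⟩
    · rw [LinearMap.smul_apply, LinearMap.mem_ker.mp (hf' hx), smul_zero]
    · rw [LinearMap.smul_apply, smul_eq_mul, inv_mul_cancel₀ hf, one_smul]
  have hinner : ∀ φ : N →ₗ[ℂ] ℂ, (∀ x ∈ lieSpan A, φ x = 0) → (∀ x, φ (T x) = 0) →
      ∃ y ∈ A, ∀ x, φ x • z = ⁅y, x⁆ := by
    intro φ hφK hφT
    have hder : IsDer (φ.smulRight z) := by
      intro u v
      obtain ⟨α, β, a, ha, rfl⟩ := hdec u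
      obtain ⟨γ, δ, b, hb, rfl⟩ := hdec v
      rw [LinearMap.smulRight_apply, LinearMap.smulRight_apply, LinearMap.smulRight_apply, smul_lie,
        lie_smul, hzP, hzc, hbr ha hb, map_add, map_smul, hφK z hzK,
        hφK _ (lie_mem_lieSpan (hAm.mpr ha) (hAm.mpr hb))]
      simp
    obtain ⟨c, y, hy⟩ := H.inner (φ.smulRight z) hder fun x => by
      rw [LinearMap.smulRight_apply, LinearMap.smulRight_apply, hφT, zero_smul, map_smul, hTz,
        smul_zero]
    have hφe : φ e = 0 := by
      have := hφT e
      rw [hTe, map_smul] at this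
      exact (smul_eq_zero.mp this).resolve_left hsC
    have hφf : φ (σ e) = 0 := by
      have := hφT (σ e)
      rw [hTf, map_smul] at this
      exact (smul_eq_zero.mp this).resolve_left (neg_ne_zero.mpr hsC)
    have hye := hy e
    rw [LinearMap.smulRight_apply, hφe, zero_smul, hTe, smul_smul] at hye
    have hc0 : c = 0 := by
      have h1 : ⁅y, e⁆ = (-(c * s)) • e := by
        rw [neg_smul]
        exact eq_neg_of_add_eq_zero_right hye.symm
      have h2 := eq_zero_of_lie_eq_smul H.nil he h1
      rw [neg_eq_zero] at h2
      exact (mul_eq_zero.mp h2).resolve_right hsC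
    have hyf := hy (σ e)
    rw [LinearMap.smulRight_apply, hφf, zero_smul, hc0, zero_smul, zero_add] at hyf
    rw [hc0, zero_mul, zero_smul, zero_add] at hye
    obtain ⟨α, β, a, ha, rfl⟩ := hdec y
    have h1 := hbr (α := α) (β := β) (γ := 1) (δ := 0) ha (map_zero T)
    have h2 := hbr (α := α) (β := β) (γ := 0) (δ := 1) ha (map_zero T)
    simp only [one_smul, zero_smul, add_zero, zero_add, lie_zero, ← hye, ← hyf, mul_zero, mul_one,
      zero_sub, sub_zero] at h1 h2
    have hβ : β = 0 := neg_eq_zero.mp ((smul_eq_zero.mp h1.symm).resolve_right hz0)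
    have hα : α = 0 := (smul_eq_zero.mp h2.symm).resolve_right hz0
    refine ⟨a, hAm.mpr ha, fun x => ?_⟩
    have := hy x
    simpa [hc0, hβ, hα] using this
  let P : Submodule ℂ N :=
    { carrier := {y : N | y ∈ A ∧ ∀ x ∈ A, ⁅y, x⁆ ∈ Submodule.span ℂ {z}}
      add_mem' := fun ha hb => ⟨add_mem ha.1 hb.1, fun x hx => by
        rw [add_lie]
        exact add_mem (ha.2 x hx) (hb.2 x hx)⟩
      zero_mem' := ⟨zero_mem _, fun x _ => by rw [zero_lie]; exact zero_mem _⟩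
      smul_mem' := fun c y hy => ⟨Submodule.smul_mem _ c hy.1, fun x hx => by
        rw [smul_lie]
        exact Submodule.smul_mem _ c (hy.2 x hx)⟩ }
  have hPA : P ≤ A := fun y hy => hy.1
  have hPz : ∀ y ∈ P, ∀ x ∈ A, ⁅y, x⁆ ∈ Submodule.span ℂ {z} := fun y hy => hy.2
  obtain ⟨ζ, hζ, -⟩ := Submodule.exists_le_ker_of_notMem (p := (⊥ : Submodule ℂ N)) (v := z)
    (by simpa using hz0)
  -- Φ reads off the z-coefficient of ⁅y, ·⁆ through ζ. Its range contains all functionals killing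
  -- im T and ⁅A, A⁆, and its kernel contains z.
  let Φ : P →ₗ[ℂ] Module.Dual ℂ N :=
    { toFun := fun y => ζ ∘ₗ (LieAlgebra.ad ℂ N y.1 : Module.End ℂ N) ∘ₗ π
      map_add' := fun y y' => by ext x; simp
      map_smul' := fun c y => by ext x; simp }
  have hΦ : ∀ (y : P) (x : N), Φ y x = ζ ⁅(y : N), π x⁆ := fun _ _ => rfl
  have hrange : (LinearMap.range T ⊔ lieSpan A).dualAnnihilator ≤ LinearMap.range Φ := by
    intro φ hφ
    rw [Submodule.mem_dualAnnihilator] at hφ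
    obtain ⟨y, hyA, hy⟩ := hinner (((ζ z) • φ : N →ₗ[ℂ] ℂ))
      (fun x hx => by rw [LinearMap.smul_apply, hφ x (Submodule.mem_sup_right hx), smul_zero])
      (fun x => by
        rw [LinearMap.smul_apply, hφ _ (Submodule.mem_sup_left ⟨x, rfl⟩), smul_zero])
    have hyP : y ∈ P := ⟨hyA, fun x _ => by
      rw [← hy x]
      exact Submodule.smul_mem _ _ (Submodule.mem_span_singleton_self z)⟩
    -- One factor undoes the scaling of φ by ζ z, the other the value of ζ at z.
    have hyP' : (ζ z)⁻¹ • (ζ z)⁻¹ • y ∈ P := Submodule.smul_mem _ _ (Submodule.smul_mem _ _ hyP)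
    refine ⟨⟨_, hyP'⟩, LinearMap.ext fun x => ?_⟩
    obtain ⟨w, hw⟩ := hπ' x
    have hx : φ (π x) = φ x := by
      have := hφ _ (Submodule.mem_sup_left ⟨w, rfl⟩)
      rw [← hw, map_sub, sub_eq_zero] at this
      exact this.symm
    rw [hΦ]
    change ζ ⁅(ζ z)⁻¹ • (ζ z)⁻¹ • y, π x⁆ = φ x
    rw [smul_lie, smul_lie, ← hy, map_smul, map_smul, map_smul, LinearMap.smul_apply, hx]
    simp only [smul_eq_mul]
    field_simp
  have hzPm : z ∈ P := ⟨hAm.mpr hTz, fun x _ => by rw [hzP]; exact zero_mem _⟩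
  have hkerΦ : 1 ≤ finrank ℂ (LinearMap.ker Φ) := by
    refine Submodule.one_le_finrank_iff.mpr fun h => ?_
    have h1 : (⟨z, hzPm⟩ : P) ∈ LinearMap.ker Φ := by
      rw [LinearMap.mem_ker]
      ext x
      rw [hΦ, hzP, map_zero]
      rfl
    rw [h, Submodule.mem_bot] at h1
    exact hz0 (congrArg Subtype.val h1)
  have hcount : finrank ℂ A + 1 ≤ finrank ℂ P + finrank ℂ (lieSpan A) := by
    have h1 := LinearMap.finrank_range_add_finrank_ker Φ
    have h2 := Submodule.finrank_mono hrange
    have h3 := Subspace.finrank_add_finrank_dualAnnihilator_eq (LinearMap.range T ⊔ lieSpan A)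
    have h4 := Submodule.finrank_add_le_finrank_add_finrank (LinearMap.range T) (lieSpan A)
    have h5 := LinearMap.finrank_range_add_finrank_ker T
    rw [← hA] at h5
    omega
  have hK0 : lieSpan A ≠ ⊥ := fun h => hz0 (by rwa [h, Submodule.mem_bot] at hzK)
  have hK2 := finrank_lieSpan_add_two_le H.nil hKA hK0
  have hA5 : finrank ℂ A ≤ 5 := by rw [hA]; exact hk
  have hfin : lieSpan A ≤ Submodule.span ℂ {z} → False := by
    intro hle
    refine H.false_of_two_step (fun x y w => ?_) (hwt hTz) hz0
    obtain ⟨α, β, a, ha, rfl⟩ := hdec y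
    obtain ⟨γ, δ, b, hb, rfl⟩ := hdec w
    obtain ⟨c, hc⟩ := Submodule.mem_span_singleton.mp
      (hle (lie_mem_lieSpan (hAm.mpr ha) (hAm.mpr hb)))
    rw [hbr ha hb, ← hc, lie_add, lie_smul, lie_smul, hzc, smul_zero, smul_zero, add_zero]
  have hz1 : ∀ {S : Submodule ℂ N}, z ∈ S → ∀ u ∈ P, ∀ v ∈ A, ⁅u, v⁆ ∈ S ∧ ⁅v, u⁆ ∈ S := by
    intro S hzS u hu v hv
    have h1 := (Submodule.span_singleton_le_iff_mem z S).mpr hzS (hPz u hu v hv)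
    refine ⟨h1, ?_⟩
    rw [← lie_skew]
    exact neg_mem h1
  -- From dim ⁅A, A⁆ ≤ 3 the codimension of P in A is at most 2, so ⁅A, A⁆ is spanned by z and one
  -- bracket. The count with dim ⁅A, A⁆ ≤ 2 then gives codimension at most 1, leaving only ℂz.
  obtain ⟨q₁, hq₁, hP₁, hf₁⟩ := exists_le_sup_span_singleton (n := 1) hPA (by omega)
  obtain ⟨q₂, hq₂, hA₂⟩ := exists_le_sup_span_singleton_of_finrank_le hP₁ hf₁
  have hK3 : lieSpan A ≤ Submodule.span ℂ {z, ⁅q₁, q₂⁆} := by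
    have hzS : z ∈ Submodule.span ℂ {z, ⁅q₁, q₂⁆} := Submodule.subset_span (by simp)
    have hqS : ⁅q₁, q₂⁆ ∈ Submodule.span ℂ {z, ⁅q₁, q₂⁆} := Submodule.subset_span (by simp)
    refine lieSpan_le fun u hu v hv => lie_mem_of_mem_sup_span_singleton
      (lie_mem_of_mem_sup_span_singleton (fun u hu v hv => (hz1 hzS u hu v (hPA hv)).1)
        fun u hu => (hz1 hzS u hu q₁ hq₁).2) ?_ u (hA₂ hu) v (hA₂ hv)
    intro u hu
    obtain ⟨p, hp, c, hc, rfl⟩ := Submodule.mem_sup.mp hu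
    obtain ⟨c, rfl⟩ := Submodule.mem_span_singleton.mp hc
    rw [lie_add, lie_smul, ← lie_skew q₂ q₁]
    exact add_mem (hz1 hzS p hp q₂ hq₂).2 (Submodule.smul_mem _ c (neg_mem hqS))
  have hK4 := (Submodule.finrank_mono hK3).trans (finrank_span_pair_le _ _)
  obtain ⟨q, hq, hA₃⟩ := exists_le_sup_span_singleton_of_finrank_le hPA (by omega)
  have hzS := Submodule.mem_span_singleton_self (R := ℂ) z
  exact hfin (lieSpan_le fun u hu v hv => lie_mem_of_mem_sup_span_singleton
    (fun u hu v hv => (hz1 hzS u hu v (hPA hv)).1) (fun u hu => (hz1 hzS u hu q hq).2)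
    u (hA₃ hu) v (hA₃ hv))

end SkewTorus

end RigidLie

/-! ### Assembling the weight patterns -/

namespace RigidLie

open Module

namespace SkewTorus

variable {N : Type*} [LieRing N] [LieAlgebra ℂ N] {T : Module.End ℂ N} {σ : N → N}

theorem false_of_three_weights_of_le (H : SkewTorus T σ) {e₁ e₂ e₃ X : N} {p q r : ℝ}
    (hspan : ⊤ ≤ Submodule.span ℂ (Set.range ![e₁, e₂, e₃, σ e₁, σ e₂, σ e₃, X]))
    (n₁ : e₁ ≠ 0) (n₂ : e₂ ≠ 0) (n₃ : e₃ ≠ 0) (hX : X ≠ 0) (hp : 0 < p) (hpq : p ≤ q) (hqr : q ≤ r)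
    (t₁ : HasWeight T p e₁) (t₂ : HasWeight T q e₂) (t₃ : HasWeight T r e₃)
    (tX : HasWeight T 0 X) : False := by
  rcases hpq.lt_or_eq with hpq | rfl <;> rcases hqr.lt_or_eq with hqr | rfl
  · exact H.false_of_distinct_weights hspan n₁ n₂ n₃ hp hpq hqr t₁ t₂ t₃ tX
  · refine H.false_of_pair (a₁ := e₂) (a₂ := e₃) (w := e₁) (hspan.trans (Submodule.span_mono ?_))
      hX n₁ n₂ (hp.trans hpq) hp hpq.ne' t₂ t₃ t₁ tX
    rintro _ ⟨i, rfl⟩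
    fin_cases i <;> simp
  · exact H.false_of_pair hspan hX n₃ n₁ hp (hp.trans hqr) hqr.ne t₁ t₂ t₃ tX
  · exact H.false_of_equal_weights hspan hX hp t₁ t₂ t₃ tX

theorem false_of_three_weights (H : SkewTorus T σ) {e₁ e₂ e₃ X : N} {p q r : ℝ}
    (hspan : ⊤ ≤ Submodule.span ℂ (Set.range ![e₁, e₂, e₃, σ e₁, σ e₂, σ e₃, X]))
    (n₁ : e₁ ≠ 0) (n₂ : e₂ ≠ 0) (n₃ : e₃ ≠ 0) (hX : X ≠ 0) (hp : 0 < p) (hq : 0 < q) (hr : 0 < r)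
    (t₁ : HasWeight T p e₁) (t₂ : HasWeight T q e₂) (t₃ : HasWeight T r e₃)
    (tX : HasWeight T 0 X) : False := by
  have key : ∀ {a₁ a₂ a₃ : N}, Set.range ![e₁, e₂, e₃, σ e₁, σ e₂, σ e₃, X] ⊆
      Set.range ![a₁, a₂, a₃, σ a₁, σ a₂, σ a₃, X] →
      ⊤ ≤ Submodule.span ℂ (Set.range ![a₁, a₂, a₃, σ a₁, σ a₂, σ a₃, X]) :=
    fun h => hspan.trans (Submodule.span_mono h)
  rcases le_total p q with h₁ | h₁ <;> rcases le_total q r with h₂ | h₂ <;>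
    rcases le_total p r with h₃ | h₃
  · exact H.false_of_three_weights_of_le hspan n₁ n₂ n₃ hX hp h₁ h₂ t₁ t₂ t₃ tX
  · exact H.false_of_three_weights_of_le hspan n₁ n₂ n₃ hX hp h₁ h₂ t₁ t₂ t₃ tX
  · exact H.false_of_three_weights_of_le (key (by rintro _ ⟨i, rfl⟩; fin_cases i <;> simp))
      n₁ n₃ n₂ hX hp h₃ h₂ t₁ t₃ t₂ tX
  · exact H.false_of_three_weights_of_le (key (by rintro _ ⟨i, rfl⟩; fin_cases i <;> simp))
      n₃ n₁ n₂ hX hr h₃ h₁ t₃ t₁ t₂ tX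
  · exact H.false_of_three_weights_of_le (key (by rintro _ ⟨i, rfl⟩; fin_cases i <;> simp))
      n₂ n₁ n₃ hX hq h₁ h₃ t₂ t₁ t₃ tX
  · exact H.false_of_three_weights_of_le (key (by rintro _ ⟨i, rfl⟩; fin_cases i <;> simp))
      n₂ n₃ n₁ hX hq h₂ h₃ t₂ t₃ t₁ tX
  · exact H.false_of_three_weights_of_le (key (by rintro _ ⟨i, rfl⟩; fin_cases i <;> simp))
      n₃ n₂ n₁ hX hr h₂ h₁ t₃ t₂ t₁ tX
  · exact H.false_of_three_weights_of_le (key (by rintro _ ⟨i, rfl⟩; fin_cases i <;> simp))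
      n₃ n₂ n₁ hX hr h₂ h₁ t₃ t₂ t₁ tX

theorem false_of_two_weights (H : SkewTorus T σ) {e₁ e₂ x₁ x₂ x₃ : N} {p q : ℝ}
    (hspan : ⊤ ≤ Submodule.span ℂ (Set.range ![e₁, e₂, x₁, σ e₁, σ e₂, x₂, x₃]))
    (hk : finrank ℂ (LinearMap.ker T) ≤ 3) (hx₁ : HasWeight T 0 x₁) (hx₂ : HasWeight T 0 x₂)
    (hx₃ : HasWeight T 0 x₃) (hx0 : x₁ ≠ 0) (n₁ : e₁ ≠ 0) (n₂ : e₂ ≠ 0) (hp : 0 < p) (hq : 0 < q)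
    (t₁ : HasWeight T p e₁) (t₂ : HasWeight T q e₂) : False := by
  rcases lt_trichotomy p q with h | rfl | h
  · exact H.false_of_two_distinct_weights hspan hk hx₁ hx₂ hx₃ hx0 n₁ n₂ hp h t₁ t₂
  · exact H.false_of_two_equal_weights hspan hk hx₁ hx₂ hx₃ hx0 n₁ hp t₁ t₂
  · refine H.false_of_two_distinct_weights (hspan.trans (Submodule.span_mono ?_)) hk hx₁ hx₂ hx₃ hx0
      n₂ n₁ hq h t₂ t₁
    rintro _ ⟨i, rfl⟩
    fin_cases i <;> simp

section Basis

variable {ι : Type*} [Fintype ι]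

/-- A basis vector of negative weight is the conjugate of a vector of the opposite weight, hence a
combination of conjugates of basis vectors in P. -/
theorem span_half_eq_top (H : SkewTorus T σ) (B : Basis ι ℂ N) {lam : ι → ℝ}
    (hT : ∀ i, HasWeight T (lam i) (B i)) {P Q Z : Set ι} (hPQZ : ∀ i, i ∈ P ∨ i ∈ Q ∨ i ∈ Z)
    (hPQ : ∀ i ∈ Q, ∀ j, lam j = -lam i → j ∈ P) :
    Submodule.span ℂ (B '' P) ⊔ Submodule.span ℂ (σ '' (B '' P)) ⊔ Submodule.span ℂ (B '' Z) =
      ⊤ := by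
  rw [eq_top_iff, ← B.span_eq, Submodule.span_le]
  rintro _ ⟨i, rfl⟩
  rcases hPQZ i with hi | hi | hi
  · exact Submodule.mem_sup_left (Submodule.mem_sup_left (Submodule.subset_span ⟨i, hi, rfl⟩))
  · refine Submodule.mem_sup_left (Submodule.mem_sup_right ?_)
    rw [← H.conj_conj (B i)]
    refine H.conj_mem_span ?_
    obtain ⟨c, hc, hc'⟩ := HasWeight.exists_coeff B hT (H.weight_conj (hT i))
    rw [hc]
    refine Submodule.sum_mem _ fun j _ => ?_
    by_cases hj : lam j = -lam i
    · exact Submodule.smul_mem _ _ (Submodule.subset_span ⟨j, hPQ i hi j hj, rfl⟩)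
    · rw [hc' j hj, zero_smul]
      exact zero_mem _
  · exact Submodule.mem_sup_right (Submodule.subset_span ⟨i, hi, rfl⟩)

/-- Applied to the positive and then to the negative weights, this count shows that there are
equally many of each. -/
theorem finrank_le_two_mul_card_add_card (H : SkewTorus T σ) (B : Basis ι ℂ N) {lam : ι → ℝ}
    (hT : ∀ i, HasWeight T (lam i) (B i)) {P Q Z : Finset ι} (hPQZ : ∀ i, i ∈ P ∨ i ∈ Q ∨ i ∈ Z)
    (hPQ : ∀ i ∈ Q, ∀ j, lam j = -lam i → j ∈ P) : 7 ≤ 2 * P.card + Z.card := by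
  classical
  have := H.finiteDimensional
  have h := H.span_half_eq_top B hT (P := ↑P) (Q := ↑Q) (Z := ↑Z) hPQZ hPQ
  have h1 : ∀ S : Finset ι, finrank ℂ (Submodule.span ℂ (B '' (S : Set ι))) ≤ S.card := fun S => by
    rw [← Finset.coe_image]
    exact (finrank_span_finset_le_card _).trans Finset.card_image_le
  have h2 : finrank ℂ (Submodule.span ℂ (σ '' (B '' (P : Set ι)))) ≤ P.card := by
    rw [← Finset.coe_image, ← Finset.coe_image]
    exact (finrank_span_finset_le_card _).trans
      (Finset.card_image_le.trans Finset.card_image_le)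
  have h3 := Submodule.finrank_add_le_finrank_add_finrank
    (Submodule.span ℂ (B '' (P : Set ι)) ⊔ Submodule.span ℂ (σ '' (B '' (P : Set ι))))
    (Submodule.span ℂ (B '' (Z : Set ι)))
  have h4 := Submodule.finrank_add_le_finrank_add_finrank
    (Submodule.span ℂ (B '' (P : Set ι))) (Submodule.span ℂ (σ '' (B '' (P : Set ι))))
  rw [h, finrank_top, H.finrank_eq] at h3
  have := h1 P
  have := h1 Z
  omega

theorem false_of_basis (H : SkewTorus T σ) (B : Basis ι ℂ N) {lam : ι → ℝ}
    (hT : ∀ i, HasWeight T (lam i) (B i)) (hne : ∃ i, lam i ≠ 0) : False := by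
  classical
  have := H.finiteDimensional
  have hcard : Fintype.card ι = 7 := by rw [← H.finrank_eq, finrank_eq_card_basis B]
  obtain ⟨P, hP⟩ : ∃ P : Finset ι, ∀ i, i ∈ P ↔ 0 < lam i :=
    ⟨Finset.univ.filter fun i => 0 < lam i, fun i => by simp⟩
  obtain ⟨Q, hQ⟩ : ∃ Q : Finset ι, ∀ i, i ∈ Q ↔ lam i < 0 :=
    ⟨Finset.univ.filter fun i => lam i < 0, fun i => by simp⟩
  obtain ⟨Z, hZ⟩ : ∃ Z : Finset ι, ∀ i, i ∈ Z ↔ lam i = 0 :=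
    ⟨Finset.univ.filter fun i => lam i = 0, fun i => by simp⟩
  have hall : ∀ i, i ∈ P ∨ i ∈ Q ∨ i ∈ Z := fun i => by
    rw [hP, hQ, hZ]
    rcases lt_trichotomy (lam i) 0 with h | h | h <;> simp [h]
  have hsum : P.card + Q.card + Z.card = 7 := by
    rw [← Finset.card_union_of_disjoint, ← Finset.card_union_of_disjoint, ← hcard,
      ← Finset.card_univ]
    · congr 1
      ext i
      have := hall i
      simp only [Finset.mem_union, Finset.mem_univ, iff_true]
      tauto
    · rw [Finset.disjoint_left]
      intro i hi hi'
      rw [Finset.mem_union, hP, hQ] at hi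
      rw [hZ] at hi'
      rcases hi with h | h <;> linarith
    · rw [Finset.disjoint_left]
      intro i hi hi'
      rw [hP] at hi
      rw [hQ] at hi'
      linarith
  have hPQ : ∀ i ∈ Q, ∀ j, lam j = -lam i → j ∈ P := fun i hi j hj => by
    rw [hQ] at hi
    rw [hP]
    linarith
  have hQP : ∀ i ∈ P, ∀ j, lam j = -lam i → j ∈ Q := fun i hi j hj => by
    rw [hP] at hi
    rw [hQ]
    linarith
  have h1 := H.finrank_le_two_mul_card_add_card B hT hall hPQ
  have h2 := H.finrank_le_two_mul_card_add_card B hT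
    (fun i => by have := hall i; tauto : ∀ i, i ∈ Q ∨ i ∈ P ∨ i ∈ Z) hQP
  have hP0 : 1 ≤ P.card := by
    by_contra h0
    have hZ7 : Z.card = Fintype.card ι := by omega
    obtain ⟨i, hi⟩ := hne
    rw [Finset.card_eq_iff_eq_univ] at hZ7
    exact hi ((hZ i).mp (hZ7 ▸ Finset.mem_univ i))
  have hspan := H.span_half_eq_top B hT (P := ↑P) (Q := ↑Q) (Z := ↑Z) hall hPQ
  have hkerle : LinearMap.ker T ≤ Submodule.span ℂ (B '' (Z : Set ι)) := by
    intro v hv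
    obtain ⟨c, rfl, hc⟩ := HasWeight.exists_coeff B hT (mem_ker_iff_hasWeight.mp hv)
    refine Submodule.sum_mem _ fun j _ => ?_
    by_cases hj : lam j = 0
    · exact Submodule.smul_mem _ _ (Submodule.subset_span ⟨j, (hZ j).mpr hj, rfl⟩)
    · rw [hc j hj, zero_smul]
      exact zero_mem _
  have hk : finrank ℂ (LinearMap.ker T) ≤ Z.card := by
    refine (Submodule.finrank_mono hkerle).trans ?_
    rw [← Finset.coe_image]
    exact (finrank_span_finset_le_card _).trans Finset.card_image_le
  have hZw : ∀ i ∈ Z, HasWeight T 0 (B i) := fun i hi => (hZ i).mp hi ▸ hT i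
  have hB := B.ne_zero
  have hP3 : P.card = 1 ∨ P.card = 2 ∨ P.card = 3 := by omega
  rcases hP3 with hPc | hPc | hPc
  · obtain ⟨i₀, rfl⟩ := Finset.card_eq_one.mp hPc
    obtain ⟨π, -, h1, h2, h3⟩ := exists_projection_ker B hT
    have hpos : 0 < lam i₀ := (hP i₀).mp (Finset.mem_singleton_self i₀)
    refine H.false_of_single_weight (hT i₀) (hB i₀) hpos.ne' (fun v hv => ?_) (fun v => ?_) h1 h2 h3
      (by omega)
    · obtain ⟨c, hc, hc'⟩ := HasWeight.exists_coeff B hT hv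
      refine ⟨c i₀, hc.trans (Finset.sum_eq_single i₀ (fun i _ hi => ?_)
        fun h => absurd (Finset.mem_univ _) h)⟩
      rw [hc' i fun h => hi (Finset.mem_singleton.mp ((hP i).mpr (h ▸ hpos))), zero_smul]
    · have hv : v ∈ Submodule.span ℂ (B '' (({i₀} : Finset ι) : Set ι)) ⊔
          Submodule.span ℂ (σ '' (B '' (({i₀} : Finset ι) : Set ι))) ⊔
          Submodule.span ℂ (B '' (Z : Set ι)) := hspan ▸ Submodule.mem_top
      rw [Finset.coe_singleton, Set.image_singleton, Set.image_singleton] at hv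
      obtain ⟨w, hw, a, ha, rfl⟩ := Submodule.mem_sup.mp hv
      obtain ⟨x, hx, y, hy, rfl⟩ := Submodule.mem_sup.mp hw
      obtain ⟨α, rfl⟩ := Submodule.mem_span_singleton.mp hx
      obtain ⟨β, rfl⟩ := Submodule.mem_span_singleton.mp hy
      refine ⟨α, β, a, ?_, rfl⟩
      have hle : Submodule.span ℂ (B '' (Z : Set ι)) ≤ LinearMap.ker T := by
        refine Submodule.span_le.mpr ?_
        rintro _ ⟨i, hi, rfl⟩
        exact mem_ker_iff_hasWeight.mpr (hZw i hi)
      exact hle ha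
  · obtain ⟨i, j, -, rfl⟩ := Finset.card_eq_two.mp hPc
    obtain ⟨k, l, m, -, -, -, rfl⟩ := Finset.card_eq_three.mp (show Z.card = 3 by omega)
    refine H.false_of_two_weights (x₁ := B k) (x₂ := B l) (x₃ := B m) (hspan.ge.trans ?_) (by omega)
      (hZw k (by simp)) (hZw l (by simp)) (hZw m (by simp)) (hB k) (hB i) (hB j)
      ((hP i).mp (by simp)) ((hP j).mp (by simp)) (hT i) (hT j)
    rw [← Submodule.span_union, ← Submodule.span_union]
    refine Submodule.span_mono ?_
    simp only [Finset.coe_insert, Finset.coe_singleton, Set.image_insert_eq, Set.image_singleton]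
    rintro _ (((rfl | rfl) | (rfl | rfl)) | (rfl | rfl | rfl))
    exacts [⟨0, rfl⟩, ⟨1, rfl⟩, ⟨3, rfl⟩, ⟨4, rfl⟩, ⟨2, rfl⟩, ⟨5, rfl⟩, ⟨6, rfl⟩]
  · obtain ⟨i, j, k, -, -, -, rfl⟩ := Finset.card_eq_three.mp hPc
    obtain ⟨l, rfl⟩ := Finset.card_eq_one.mp (show Z.card = 1 by omega)
    refine H.false_of_three_weights (X := B l) (hspan.ge.trans ?_) (hB i) (hB j) (hB k) (hB l)
      ((hP i).mp (by simp)) ((hP j).mp (by simp)) ((hP k).mp (by simp)) (hT i) (hT j) (hT k)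
      (hZw l (by simp))
    rw [← Submodule.span_union, ← Submodule.span_union]
    refine Submodule.span_mono ?_
    simp only [Finset.coe_insert, Finset.coe_singleton, Set.image_insert_eq, Set.image_singleton]
    rintro _ (((rfl | rfl | rfl) | (rfl | rfl | rfl)) | rfl)
    exacts [⟨0, rfl⟩, ⟨1, rfl⟩, ⟨2, rfl⟩, ⟨3, rfl⟩, ⟨4, rfl⟩, ⟨5, rfl⟩, ⟨6, rfl⟩]

end Basis

end SkewTorus

end RigidLie

/-! ### Reduction to a purely imaginary spectrum -/

namespace RigidLie

open Module

theorem exists_basis_eigenvectors {N : Type*} [AddCommGroup N] [Module ℂ N]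
    [FiniteDimensional ℂ N] {T : Module.End ℂ N} (hT : T.IsSemisimple) :
    ∃ (B : Basis (Fin (finrank ℂ N)) ℂ N) (lam : Fin (finrank ℂ N) → ℂ),
      ∀ i, T (B i) = lam i • B i := by
  let S : Set N := {v | ∃ μ : ℂ, T v = μ • v}
  have hS : ⊤ ≤ Submodule.span ℂ S := by
    rw [← hT.iSup_eigenspace_eq_top]
    exact iSup_le fun μ v hv =>
      Submodule.subset_span ⟨μ, Module.End.mem_eigenspace_iff.mp hv⟩
  let B := (Basis.ofSpan hS).reindex ((Basis.ofSpan hS).indexEquiv (finBasis ℂ N))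
  have hB : ∀ i, B i ∈ S := fun i => by
    rw [Basis.reindex_apply]
    exact Basis.ofSpan_subset hS ⟨_, rfl⟩
  choose lam hlam using hB
  exact ⟨B, lam, hlam⟩

/-- A real structure `σ` on a seven-dimensional complex nilpotent Lie algebra together with a real
semisimple derivation `T`, such that every derivation commuting with `T` is a multiple of `T` up to
an inner derivation. -/
structure RealTorus {N : Type*} [LieRing N] [LieAlgebra ℂ N] (T : Module.End ℂ N) (σ : N → N) :
    Prop where
  finrank_eq : finrank ℂ N = 7
  nil : LieRing.IsNilpotent N
  der : IsDer T
  semisimple : T.IsSemisimple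
  conj_add : ∀ x y, σ (x + y) = σ x + σ y
  conj_smul : ∀ (c : ℂ) x, σ (c • x) = (starRingEnd ℂ) c • σ x
  conj_lie : ∀ x y : N, σ ⁅x, y⁆ = ⁅σ x, σ y⁆
  conj_conj : ∀ x, σ (σ x) = x
  map_conj : ∀ x, T (σ x) = σ (T x)
  inner : ∀ D : Module.End ℂ N, IsDer D → (∀ x, D (T x) = T (D x)) →
    ∃ (a : ℂ) (y : N), ∀ x, D x = a • T x + ⁅y, x⁆

namespace RealTorus

variable {N : Type*} [LieRing N] [LieAlgebra ℂ N] {T : Module.End ℂ N} {σ : N → N}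

theorem finiteDimensional (H : RealTorus T σ) : FiniteDimensional ℂ N :=
  FiniteDimensional.of_finrank_pos (by rw [H.finrank_eq]; norm_num)

/-- The derivation multiplying eigenvectors of `T` by the real parts of their eigenvalues. -/
theorem exists_derivation_re (H : RealTorus T σ) : ∃ D : Module.End ℂ N, IsDer D ∧
    (∀ x, D (T x) = T (D x)) ∧ ∀ (μ : ℂ) (v : N), T v = μ • v → D v = (μ.re : ℂ) • v := by
  have := H.finiteDimensional
  obtain ⟨B, lam, hB⟩ := exists_basis_eigenvectors H.semisimple
  let D : Module.End ℂ N := B.constr ℂ fun i => ((lam i).re : ℂ) • B i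
  have hD : ∀ i, D (B i) = ((lam i).re : ℂ) • B i := fun i => B.constr_basis ℂ _ i
  have heig : ∀ (μ : ℂ) (v : N), T v = μ • v → D v = (μ.re : ℂ) • v := by
    intro μ v hv
    rw [← B.sum_repr v, map_sum, Finset.smul_sum]
    refine Finset.sum_congr rfl fun i _ => ?_
    rw [map_smul, hD]
    have h2 : B.repr (T v) i = B.repr v i * lam i := by
      conv_lhs => rw [← B.sum_repr v]
      rw [map_sum]
      simp only [map_smul, hB, smul_smul]
      rw [B.repr_sum_self]
    rw [hv, map_smul, Finsupp.smul_apply, smul_eq_mul] at h2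
    have h3 : (μ - lam i) * B.repr v i = 0 := by linear_combination h2
    rcases mul_eq_zero.mp h3 with h | h
    · rw [sub_eq_zero.mp h, smul_comm]
    · simp [h]
  have hmem : ∀ x, x ∈ Submodule.span ℂ (Set.range B) := fun x => B.span_eq ▸ Submodule.mem_top
  refine ⟨D, ?_, fun x => ?_, heig⟩
  · have hpair : ∀ i j, D ⁅B i, B j⁆ = ⁅D (B i), B j⁆ + ⁅B i, D (B j)⁆ := fun i j => by
      rw [heig (lam i + lam j) ⁅B i, B j⁆ (by rw [H.der, hB, hB, smul_lie, lie_smul, add_smul]),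
        hD, hD, smul_lie, lie_smul, Complex.add_re, Complex.ofReal_add, add_smul]
    intro x y
    induction hmem x using Submodule.span_induction with
    | mem x hx =>
      obtain ⟨i, rfl⟩ := hx
      induction hmem y using Submodule.span_induction with
      | mem y hy =>
        obtain ⟨j, rfl⟩ := hy
        exact hpair i j
      | zero => simp
      | add u v _ _ hu hv => simp only [lie_add, map_add, hu, hv]; abel
      | smul c u _ hu => simp only [lie_smul, map_smul, hu, smul_add]
    | zero => simp
    | add u v _ _ hu hv => simp only [add_lie, map_add, hu, hv]; abel
    | smul c u _ hu => simp only [smul_lie, map_smul, hu, smul_add]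
  · induction hmem x using Submodule.span_induction with
    | mem x hx =>
      obtain ⟨i, rfl⟩ := hx
      rw [hB, map_smul, hD, map_smul, hB, smul_comm]
    | zero => simp
    | add u v _ _ hu hv => simp only [map_add, hu, hv]
    | smul c u _ hu => simp only [map_smul, hu]

/-- The derivation of real parts is aT + ad y, so Re μ = aμ for every eigenvalue. A nonreal μ and
its conjugate have the same real part, whence a = 0. -/
theorem re_eq_zero (H : RealTorus T σ) {μ : ℂ} {v : N} (hv : v ≠ 0) (hTv : T v = μ • v)
    (hμ : μ.im ≠ 0) {μ' : ℂ} {v' : N} (hv' : v' ≠ 0) (hTv' : T v' = μ' • v') : μ'.re = 0 := by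
  obtain ⟨D, hD, hDT, hDe⟩ := H.exists_derivation_re
  obtain ⟨a, y, hy⟩ := H.inner D hD hDT
  have key : ∀ (μ : ℂ) (v : N), v ≠ 0 → T v = μ • v → (μ.re : ℂ) = a * μ := by
    intro μ v hv hTv
    have h1 : ⁅y, v⁆ = ((μ.re : ℂ) - a * μ) • v := by
      have := hy v
      rw [hDe μ v hTv, hTv] at this
      rw [sub_smul, this, smul_smul]
      abel
    exact sub_eq_zero.mp (eq_zero_of_lie_eq_smul H.nil hv h1)
  have hσv : σ v ≠ 0 := fun h => hv (by
    rw [← H.conj_conj v, h]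
    simpa using H.conj_smul 0 0)
  have hTσv : T (σ v) = (starRingEnd ℂ μ) • σ v := by rw [H.map_conj, hTv, H.conj_smul]
  have h1 := key _ _ hv hTv
  have h2 := key _ _ hσv hTσv
  rw [Complex.conj_re] at h2
  have h3 : a * (μ - starRingEnd ℂ μ) = 0 := by rw [mul_sub, ← h1, ← h2, sub_self]
  have h4 : μ - starRingEnd ℂ μ ≠ 0 := fun h => hμ (Complex.conj_eq_iff_im.mp (sub_eq_zero.mp h).symm)
  have ha := (mul_eq_zero.mp h3).resolve_right h4
  have h5 := key _ _ hv' hTv'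
  rw [ha, zero_mul] at h5
  exact_mod_cast h5

/-- As σ is conjugate-linear, the factor -i turns commutation with σ into anticommutation, and an
imaginary spectrum into real weights. -/
theorem skewTorus (H : RealTorus T σ) : SkewTorus (-Complex.I • T) σ where
  finrank_eq := H.finrank_eq
  nil := H.nil
  der := H.der.smul _
  semisimple := Module.End.IsSemisimple_smul _ H.semisimple
  conj_add := H.conj_add
  conj_smul := H.conj_smul
  conj_lie := H.conj_lie
  conj_conj := H.conj_conj
  map_conj x := by
    rw [LinearMap.smul_apply, LinearMap.smul_apply, H.conj_smul, H.map_conj, map_neg,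
      Complex.conj_I, neg_neg, neg_smul]
  inner D hD hDT := by
    have hI : ∀ w : N, Complex.I • -Complex.I • w = w := fun w => by
      rw [smul_smul, mul_neg, Complex.I_mul_I, neg_neg, one_smul]
    obtain ⟨a, y, h⟩ := H.inner D hD fun x => by
      have h1 := congrArg (Complex.I • ·) (hDT x)
      simpa only [LinearMap.smul_apply, map_smul, hI] using h1
    refine ⟨a * Complex.I, y, fun x => ?_⟩
    rw [h x, LinearMap.smul_apply, mul_smul, hI]

theorem im_eq_zero (H : RealTorus T σ) {μ : ℂ} {v : N} (hv : v ≠ 0) (hTv : T v = μ • v) :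
    μ.im = 0 := by
  by_contra hμ
  have := H.finiteDimensional
  obtain ⟨B, lam, hB⟩ := exists_basis_eigenvectors H.semisimple
  have hre : ∀ i, lam i = Complex.I * ((lam i).im : ℂ) := fun i => by
    apply Complex.ext <;> simp [H.re_eq_zero hv hTv hμ (B.ne_zero i) (hB i)]
  refine H.skewTorus.false_of_basis B (lam := fun i => (lam i).im) (fun i => ?_) ?_
  · rw [HasWeight, LinearMap.smul_apply, hB, smul_smul]
    conv_lhs => rw [hre i]
    rw [← mul_assoc, neg_mul, Complex.I_mul_I, neg_neg, one_mul]
  · by_contra hcon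
    push Not at hcon
    have hT0 : T = 0 := B.ext fun i => by
      rw [hB, hre, hcon]
      simp
    rw [hT0, LinearMap.zero_apply] at hTv
    rcases smul_eq_zero.mp hTv.symm with h | h
    · exact hμ (by rw [h, Complex.zero_im])
    · exact hv h

end RealTorus

end RigidLie

namespace RigidLie

open Module TensorProduct

/-! ### Complexification and descent to the reals -/

section Complexification

variable {N : Type*} [LieRing N] [LieAlgebra ℝ N]

/-- The real part of a vector of the complexification. -/
noncomputable def rePart (N : Type*) [AddCommGroup N] [Module ℝ N] : ℂ ⊗[ℝ] N →ₗ[ℝ] N :=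
  (TensorProduct.lid ℝ N).toLinearMap ∘ₗ Complex.reLm.rTensor N

/-- Complex conjugation on the complexification. -/
noncomputable def conjPart (N : Type*) [AddCommGroup N] [Module ℝ N] :
    ℂ ⊗[ℝ] N →ₗ[ℝ] ℂ ⊗[ℝ] N :=
  Complex.conjAe.toLinearMap.rTensor N

theorem rePart_tmul (c : ℂ) (x : N) : rePart N (c ⊗ₜ x) = c.re • x := rfl

theorem conjPart_tmul (c : ℂ) (x : N) : conjPart N (c ⊗ₜ x) = (starRingEnd ℂ c) ⊗ₜ x := rfl

theorem eq_rePart_add (z : ℂ ⊗[ℝ] N) :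
    z = 1 ⊗ₜ rePart N z + Complex.I • (1 ⊗ₜ rePart N (-Complex.I • z)) := by
  induction z with
  | zero => simp
  | add x y hx hy =>
    conv_lhs => rw [hx, hy]
    simp only [smul_add, map_add, tmul_add]
    abel
  | tmul c x =>
    rw [smul_tmul', smul_tmul', rePart_tmul, rePart_tmul, ← smul_tmul, ← smul_tmul, ← add_tmul]
    congr 1
    apply Complex.ext <;> simp

theorem rePart_lie_tmul (z : ℂ ⊗[ℝ] N) (y : N) :
    rePart N ⁅z, (1 : ℂ) ⊗ₜ[ℝ] y⁆ = ⁅rePart N z, y⁆ := by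
  induction z with
  | zero => simp
  | add x y hx hy => rw [add_lie, map_add, map_add, hx, hy, add_lie]
  | tmul c x =>
    rw [LieAlgebra.ExtendScalars.bracket_tmul, mul_one, rePart_tmul, rePart_tmul, smul_lie]

theorem rePart_tmul_lie (x : N) (z : ℂ ⊗[ℝ] N) :
    rePart N ⁅(1 : ℂ) ⊗ₜ[ℝ] x, z⁆ = ⁅x, rePart N z⁆ := by
  rw [← lie_skew, map_neg, rePart_lie_tmul, lie_skew]

theorem rePart_baseChange (τ : Module.End ℝ N) (z : ℂ ⊗[ℝ] N) :
    rePart N (τ.baseChange ℂ z) = τ (rePart N z) := by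
  induction z with
  | zero => simp
  | add x y hx hy => simp only [map_add, hx, hy]
  | tmul c x => rw [LinearMap.baseChange_tmul, rePart_tmul, rePart_tmul, map_smul]

theorem conjPart_smul (c : ℂ) (z : ℂ ⊗[ℝ] N) :
    conjPart N (c • z) = (starRingEnd ℂ c) • conjPart N z := by
  induction z with
  | zero => simp
  | add x y hx hy => simp only [map_add, smul_add, hx, hy]
  | tmul d x => rw [smul_tmul', conjPart_tmul, conjPart_tmul, smul_tmul', smul_eq_mul, map_mul,
      smul_eq_mul]

theorem conjPart_conjPart (z : ℂ ⊗[ℝ] N) : conjPart N (conjPart N z) = z := by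
  induction z with
  | zero => simp
  | add x y hx hy => simp only [map_add, hx, hy]
  | tmul c x => rw [conjPart_tmul, conjPart_tmul, Complex.conj_conj]

theorem conjPart_lie (z w : ℂ ⊗[ℝ] N) :
    conjPart N ⁅z, w⁆ = ⁅conjPart N z, conjPart N w⁆ := by
  have hl : ∀ u v w : ℂ ⊗[ℝ] N, ⁅u, v + w⁆ = ⁅u, v⁆ + ⁅u, w⁆ := fun u v w => lie_add u v w
  have hz : ∀ u : ℂ ⊗[ℝ] N, ⁅u, (0 : ℂ ⊗[ℝ] N)⁆ = 0 := fun u => lie_zero u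
  induction z with
  | zero => simp
  | add x y hx hy => simp only [map_add, add_lie, hx, hy]
  | tmul c x =>
    induction w with
    | zero => simp [hz]
    | add u v hu hv => rw [hl, map_add, map_add, hl, hu, hv]
    | tmul d y =>
      rw [LieAlgebra.ExtendScalars.bracket_tmul, conjPart_tmul, conjPart_tmul, conjPart_tmul,
        LieAlgebra.ExtendScalars.bracket_tmul, map_mul]

theorem baseChange_conjPart (τ : Module.End ℝ N) (z : ℂ ⊗[ℝ] N) :
    τ.baseChange ℂ (conjPart N z) = conjPart N (τ.baseChange ℂ z) := by
  induction z with
  | zero => simp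
  | add x y hx hy => simp only [map_add, hx, hy]
  | tmul c x => rw [conjPart_tmul, LinearMap.baseChange_tmul, LinearMap.baseChange_tmul,
      conjPart_tmul]

theorem IsDer.baseChange {τ : Module.End ℝ N} (hτ : IsDer τ) : IsDer (τ.baseChange ℂ) := by
  intro z w
  induction z with
  | zero => simp
  | add x y hx hy => simp only [map_add, add_lie, hx, hy]; abel
  | tmul c x =>
    induction w with
    | zero => simp
    | add x y hx hy => simp only [map_add, lie_add, hx, hy]; abel
    | tmul d y =>
      rw [LieAlgebra.ExtendScalars.bracket_tmul, LinearMap.baseChange_tmul,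
        LinearMap.baseChange_tmul, LinearMap.baseChange_tmul,
        LieAlgebra.ExtendScalars.bracket_tmul, LieAlgebra.ExtendScalars.bracket_tmul, hτ, tmul_add]

theorem isSemisimple_baseChange [FiniteDimensional ℝ N] {τ : Module.End ℝ N}
    (hτ : τ.IsSemisimple) : Module.End.IsSemisimple (τ.baseChange ℂ) := by
  have hsep : ((minpoly ℝ τ).map (algebraMap ℝ ℂ)).Separable :=
    (PerfectField.separable_iff_squarefree.mpr hτ.minpoly_squarefree).map
  refine Module.End.isSemisimple_of_squarefree_aeval_eq_zero hsep.squarefree ?_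
  rw [Polynomial.aeval_map_algebraMap]
  have := Polynomial.aeval_algHom_apply (Module.End.baseChangeHom ℝ ℂ N) τ (minpoly ℝ τ)
  rw [minpoly.aeval, map_zero] at this
  exact this

theorem isNilpotent_baseChange (h : LieRing.IsNilpotent N) : LieRing.IsNilpotent (ℂ ⊗[ℝ] N) :=
  inferInstance

/-- On a seven-dimensional real nilpotent Lie algebra, a semisimple derivation spanning together
with the inner derivations its centralizer in the derivation algebra is diagonalizable. -/
theorem isDiagonalizable_of_inner (hdim : finrank ℝ N = 7) (hnil : LieRing.IsNilpotent N)
    {τ : Module.End ℝ N} (hτ : IsDer τ) (hss : τ.IsSemisimple)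
    (hinner : ∀ δ : Module.End ℝ N, IsDer δ → (∀ x, δ (τ x) = τ (δ x)) →
      ∃ (a : ℝ) (y : N), ∀ x, δ x = a • τ x + ⁅y, x⁆) : IsDiagonalizable τ := by
  have hfd : FiniteDimensional ℝ N := FiniteDimensional.of_finrank_pos (by omega)
  have H : RealTorus (τ.baseChange ℂ) (conjPart N) :=
    { finrank_eq := by rw [Module.finrank_baseChange, hdim]
      nil := isNilpotent_baseChange hnil
      der := hτ.baseChange
      semisimple := isSemisimple_baseChange hss
      conj_add := map_add _
      conj_smul := conjPart_smul
      conj_lie := conjPart_lie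
      conj_conj := conjPart_conjPart
      map_conj := baseChange_conjPart τ
      inner := by
        intro D hD hDτ
        -- The real part of a complex derivation, restricted to N, is a real derivation commuting
        -- with τ. Applied to D and -iD, this gives the real and imaginary parts of the coefficient
        -- and of the inner element.
        have key : ∀ E : Module.End ℂ (ℂ ⊗[ℝ] N), IsDer E →
            (∀ x, E (τ.baseChange ℂ x) = τ.baseChange ℂ (E x)) →
            ∃ (a : ℝ) (y : N), ∀ x, rePart N (E ((1 : ℂ) ⊗ₜ[ℝ] x)) = a • τ x + ⁅y, x⁆ := by
          intro E hE hEτ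
          refine hinner (rePart N ∘ₗ E.restrictScalars ℝ ∘ₗ TensorProduct.mk ℝ ℂ N 1)
            (fun x y => ?_) (fun x => ?_)
          · change rePart N (E ((1 : ℂ) ⊗ₜ[ℝ] ⁅x, y⁆)) = ⁅rePart N (E ((1 : ℂ) ⊗ₜ[ℝ] x)), y⁆ +
              ⁅x, rePart N (E ((1 : ℂ) ⊗ₜ[ℝ] y))⁆
            have h1 : (1 : ℂ) ⊗ₜ[ℝ] ⁅x, y⁆ = ⁅(1 : ℂ) ⊗ₜ[ℝ] x, (1 : ℂ) ⊗ₜ[ℝ] y⁆ := by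
              rw [LieAlgebra.ExtendScalars.bracket_tmul, one_mul]
            rw [h1, hE, map_add, rePart_lie_tmul, rePart_tmul_lie]
          · change rePart N (E ((1 : ℂ) ⊗ₜ[ℝ] τ x)) = τ (rePart N (E ((1 : ℂ) ⊗ₜ[ℝ] x)))
            rw [← rePart_baseChange, ← hEτ, LinearMap.baseChange_tmul]
        obtain ⟨a, y, h1⟩ := key D hD hDτ
        obtain ⟨b, z, h2⟩ := key (-Complex.I • D) (hD.smul _) fun x => by
          rw [LinearMap.smul_apply, LinearMap.smul_apply, hDτ, map_smul]
        refine ⟨(a : ℂ) + Complex.I * b, 1 ⊗ₜ y + Complex.I ⊗ₜ z, fun x => ?_⟩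
        induction x with
        | zero => simp
        | add x y hx hy => simp only [map_add, hx, hy, lie_add, smul_add]; abel
        | tmul c x =>
          have hcx : c ⊗ₜ[ℝ] x = c • ((1 : ℂ) ⊗ₜ[ℝ] x) := by
            rw [smul_tmul', smul_eq_mul, mul_one]
          rw [hcx, map_smul, map_smul, lie_smul, smul_comm _ c, ← smul_add]
          congr 1
          have hc : ∀ (r : ℝ) (v : ℂ ⊗[ℝ] N), r • v = (r : ℂ) • v := fun r v =>
            (algebraMap_smul ℂ r v).symm
          have h3 := eq_rePart_add (D ((1 : ℂ) ⊗ₜ[ℝ] x))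
          have h4 : rePart N (-Complex.I • D ((1 : ℂ) ⊗ₜ[ℝ] x)) = b • τ x + ⁅z, x⁆ := h2 x
          have h5 : Complex.I ⊗ₜ[ℝ] ⁅z, x⁆ = Complex.I • ((1 : ℂ) ⊗ₜ[ℝ] ⁅z, x⁆) := by
            rw [smul_tmul', smul_eq_mul, mul_one]
          rw [h1, h4] at h3
          rw [h3, LinearMap.baseChange_tmul, add_lie, LieAlgebra.ExtendScalars.bracket_tmul,
            LieAlgebra.ExtendScalars.bracket_tmul, mul_one, mul_one, h5, tmul_add, tmul_add,
            tmul_smul, tmul_smul, hc, hc]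
          module }
  have hre : ∀ z : ℂ ⊗[ℝ] N, rePart N z ∈ ⨆ μ : ℝ, Module.End.eigenspace τ μ := by
    intro z
    have hz : z ∈ ⨆ μ : ℂ, Module.End.eigenspace (τ.baseChange ℂ) μ := by
      rw [(isSemisimple_baseChange hss).iSup_eigenspace_eq_top]
      trivial
    induction hz using Submodule.iSup_induction' with
    | zero => rw [map_zero]; exact zero_mem _
    | add x y _ _ hx hy => rw [map_add]; exact add_mem hx hy
    | mem μ v hv =>
      rw [Module.End.mem_eigenspace_iff] at hv
      -- The eigenvalue is real, so real parts of eigenvectors are eigenvectors of τ.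
      refine Submodule.mem_iSup_of_mem μ.re (Module.End.mem_eigenspace_iff.mpr ?_)
      by_cases hv0 : v = 0
      · simp [hv0]
      have him := H.im_eq_zero hv0 hv
      have hμ : μ = (μ.re : ℂ) := Complex.ext rfl (by simp [him])
      rw [← rePart_baseChange, hv, hμ, Complex.coe_smul, map_smul, Complex.ofReal_re]
  refine eq_top_iff.mpr fun x _ => ?_
  have := hre (1 ⊗ₜ x)
  rwa [rePart_tmul, Complex.one_re, one_smul] at this

end Complexification

end RigidLie

namespace RigidLie

open Module

/-! ### Derivations of rigid Lie algebras and the conclusion -/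

section RigidDerivations

variable {K g : Type*} [Field K] [LieRing g] [LieAlgebra K g] [FiniteDimensional K g]

/-- In a rigid Lie algebra, a derivation agrees with an inner one on an ideal of codimension one
containing all brackets. -/
theorem IsDer.exists_eq_lie_of_rigid (hrig : IsAlgebraicallyRigid K g) {α : g →ₗ[K] K} {T : g}
    (hα : ∀ x y : g, α ⁅x, y⁆ = 0) (hT : α T = 1) {D : Module.End K g} (hD : IsDer D) :
    ∃ w : g, ∀ y, α y = 0 → D y = ⁅w, y⁆ := by
  let d : Module.End K g := D - α.smulRight (D T)
  have hdM : ∀ y, α y = 0 → d y = D y := fun y hy => by simp [d, hy]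
  have hdT : d T = 0 := by simp [d, hT]
  have hd : d ∈ relDer α T := ⟨hdT, fun x y hx hy => by
    rw [hdM _ (hα x y), hdM _ hx, hdM _ hy, hD]⟩
  -- On ker α the commutator of ad T with D is ad (-D T), so the class of d is killed by ad T and is
  -- zero by injectivity.
  obtain ⟨-, w, hw⟩ := mem_relInner_of_adComm_mem hrig hα hT hd ⟨by
    rw [adComm_apply, hdT, lie_self, map_zero, lie_zero, sub_zero], -D T, fun y hy => by
      rw [adComm_apply, hdM _ (hα T y), hdM _ hy, hD, neg_lie]; abel⟩
  exact ⟨w, fun y hy => by rw [← hdM y hy, hw y hy]⟩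

/-- Extended by zero at T, δ is a 1-cocycle commuting with ad T. Its class is killed by ad T, hence
zero, and splitting the resulting w along T and M gives the two terms. -/
theorem exists_eq_lie_of_commute_of_rigid (hrig : IsAlgebraicallyRigid K g) {α : g →ₗ[K] K}
    {T : g} (hα : ∀ x y : g, α ⁅x, y⁆ = 0) (hT : α T = 1) {M : LieIdeal K g}
    (hM : ∀ x, x ∈ M ↔ α x = 0) {δ : Module.End K M} (hδ : IsDer δ)
    (hδT : ∀ x : M, (δ ⁅T, x⁆ : g) = ⁅T, (δ x : g)⁆) :
    ∃ (a : K) (y : M), ∀ x : M, (δ x : g) = a • ⁅T, (x : g)⁆ + ⁅(y : g), (x : g)⁆ := by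
  have hp : ∀ x, x - α x • T ∈ M.toSubmodule := fun x => (hM _).mpr (by simp [hT])
  let p : g →ₗ[K] M :=
    (LinearMap.id - α.smulRight T).codRestrict M.toSubmodule hp
  have hpM : ∀ x : M, p x = x := fun x => Subtype.ext (by
    change (x : g) - α x • T = x
    rw [(hM _).mp x.2, zero_smul, sub_zero])
  have hpT : p T = 0 := Subtype.ext (by
    change T - α T • T = 0
    rw [hT, one_smul, sub_self])
  let d : Module.End K g := M.toSubmodule.subtype ∘ₗ δ ∘ₗ p
  have hdM : ∀ x : M, d x = δ x := fun x => congrArg (fun z : M => (δ z : g)) (hpM x)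
  have hdT : d T = 0 := by
    change ((δ (p T) : M) : g) = 0
    rw [hpT, map_zero]
    rfl
  have hd : d ∈ relDer α T := by
    refine ⟨hdT, fun x y hx hy => ?_⟩
    have h1 := hdM ⁅(⟨x, (hM x).mpr hx⟩ : M), (⟨y, (hM y).mpr hy⟩ : M)⁆
    rw [hδ] at h1
    rw [hdM ⟨x, (hM x).mpr hx⟩, hdM ⟨y, (hM y).mpr hy⟩]
    exact h1
  have hc : adComm K T d ∈ relInner α T := by
    refine ⟨by rw [adComm_apply, hdT, lie_self, map_zero, lie_zero, sub_zero], 0, fun y hy => ?_⟩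
    have h1 := hdM ⁅T, (⟨y, (hM y).mpr hy⟩ : M)⁆
    rw [hδT, ← hdM] at h1
    rw [adComm_apply, zero_lie, sub_eq_zero]
    exact h1.symm
  obtain ⟨-, w, hw⟩ := mem_relInner_of_adComm_mem hrig hα hT hd hc
  refine ⟨α w, ⟨w - α w • T, hp w⟩, fun x => ?_⟩
  rw [← hdM, hw _ ((hM _).mp x.2)]
  change _ = α w • ⁅T, (x : g)⁆ + ⁅w - α w • T, (x : g)⁆
  rw [sub_lie, smul_lie, add_sub_cancel]

end RigidDerivations

variable {g : Type*} [LieRing g] [LieAlgebra ℝ g] [FiniteDimensional ℝ g]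

theorem isDiagonalizable_of_restrict {D : Module.End ℝ g} (hD : D.IsSemisimple)
    {M : Submodule ℝ g} (hDM : ∀ x, D x ∈ M) (h : IsDiagonalizable (D.restrict fun x _ => hDM x :
      Module.End ℝ M)) : IsDiagonalizable D := by
  have hle : M ≤ ⨆ μ : ℝ, Module.End.eigenspace D μ := by
    intro x hx
    have hx' : (⟨x, hx⟩ : M) ∈ ⨆ μ : ℝ, Module.End.eigenspace (D.restrict fun x _ => hDM x :
      Module.End ℝ M) μ := h ▸ Submodule.mem_top
    suffices ∀ z : M, z ∈ (⨆ μ : ℝ, Module.End.eigenspace (D.restrict fun x _ => hDM x :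
      Module.End ℝ M) μ) → (z : g) ∈ ⨆ μ : ℝ, Module.End.eigenspace D μ from this _ hx'
    intro z hz
    induction hz using Submodule.iSup_induction' with
    | zero => exact zero_mem _
    | add x y _ _ hx hy => exact add_mem hx hy
    | mem μ v hv =>
      rw [Module.End.mem_eigenspace_iff] at hv
      exact Submodule.mem_iSup_of_mem μ (Module.End.mem_eigenspace_iff.mpr
        (congrArg Subtype.val hv))
  refine eq_top_iff.mpr fun x _ => ?_
  obtain ⟨k, y, hk, rfl⟩ := exists_ker_add_range_of_isSemisimple hD x
  exact add_mem (Submodule.mem_iSup_of_mem 0 (Module.End.mem_eigenspace_iff.mpr (by simp [hk])))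
    (hle (hDM y))

/-- A semisimple derivation of an eight-dimensional rigid Lie algebra whose ad-nilpotent elements
form an ideal of dimension seven is diagonalizable. -/
theorem isDiagonalizable_of_rigid (hrig : IsAlgebraicallyRigid ℝ g)
    (hdim : finrank ℝ g = 8) {M : LieIdeal ℝ g}
    (hM : ∀ x, x ∈ M ↔ IsNilpotent (LieAlgebra.ad ℝ g x)) (hlie : ∀ x y : g, ⁅x, y⁆ ∈ M)
    (hnil : LieRing.IsNilpotent M) (hM7 : finrank ℝ M = 7) {D : Module.End ℝ g} (hD : IsDer D)
    (hss : D.IsSemisimple) : IsDiagonalizable D := by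
  have hMtop : M.toSubmodule ≠ ⊤ := fun h => by
    have h1 : finrank ℝ M.toSubmodule = 7 := hM7
    rw [h, finrank_top, hdim] at h1
    omega
  obtain ⟨α, T, hαM, hT⟩ := exists_dual_ne_zero_of_ne_top hMtop
  have hker : M.toSubmodule = LinearMap.ker α := by
    refine Submodule.eq_of_le_of_finrank_le (fun x hx => hαM x hx) ?_
    have h1 := LinearMap.finrank_range_add_finrank_ker α
    have h2 : 0 < finrank ℝ (LinearMap.range α) := by
      rw [Module.finrank_pos_iff_exists_ne_zero]
      exact ⟨⟨α T, T, rfl⟩, fun h => by simpa [hT] using congrArg Subtype.val h⟩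
    have h3 : finrank ℝ M.toSubmodule = 7 := hM7
    omega
  have hMα : ∀ x, x ∈ M ↔ α x = 0 := fun x => by
    rw [← LinearMap.mem_ker, ← hker]; rfl
  have hα : ∀ x y : g, α ⁅x, y⁆ = 0 := fun x y => (hMα _).mp (hlie x y)
  obtain ⟨w, hw⟩ := hD.exists_eq_lie_of_rigid hrig hα hT
  have hDT : α (D T) = 0 := by
    -- D and ad w agree on ker α, so t centralizes ker α. All brackets lie there, so (ad t)² = 0 and
    -- t is in M.
    let t : g := D T - ⁅w, T⁆
    have htM : ∀ y, α y = 0 → ⁅t, y⁆ = 0 := fun y hy => by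
      have h1 := hw _ (hα T y)
      rw [hD, hw y hy, leibniz_lie w T y] at h1
      rw [sub_lie, sub_eq_zero]
      exact add_right_cancel h1
    have ht : t ∈ M := (hM t).mpr ⟨2, LinearMap.ext fun y => by
      rw [pow_two, Module.End.mul_apply, LieAlgebra.ad_apply, LieAlgebra.ad_apply,
        htM _ (hα t y), LinearMap.zero_apply]⟩
    have h2 := (hMα _).mp ht
    rwa [map_sub, hα, sub_zero] at h2
  have hDM : ∀ x, D x ∈ M := fun x => by
    have h1 : x = α x • T + (x - α x • T) := by abel
    rw [hMα, h1, map_add, map_add, map_smul, map_smul, hDT, hw _ (by simp [hT]), hα, smul_zero,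
      add_zero]
  -- If w is in M, D is nilpotent as well as semisimple, hence zero. Otherwise w, with α rescaled,
  -- plays the role of T, so that the derivation ad T of M is exactly the restriction of D.
  by_cases hαw : α w = 0
  · have hn : IsNilpotent D := by
      obtain ⟨n, hn⟩ := (hM w).mp ((hMα w).mpr hαw)
      have hpow : ∀ k, ∀ x ∈ M, (D ^ k) x = (LieAlgebra.ad ℝ g w ^ k) x := by
        intro k
        induction k with
        | zero => exact fun _ _ => rfl
        | succ k ih =>
          intro x hx
          rw [pow_succ, pow_succ, Module.End.mul_apply, Module.End.mul_apply, ih _ (hDM x),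
            hw x ((hMα x).mp hx), LieAlgebra.ad_apply]
      refine ⟨n + 1, LinearMap.ext fun x => ?_⟩
      rw [pow_succ, Module.End.mul_apply, hpow n _ (hDM x), hn]
      rfl
    have hD0 := Module.End.eq_zero_of_isNilpotent_isSemisimple hn hss
    refine eq_top_iff.mpr fun x _ => Submodule.mem_iSup_of_mem 0 ?_
    rw [Module.End.mem_eigenspace_iff, hD0, zero_smul, LinearMap.zero_apply]
  · refine isDiagonalizable_of_restrict hss hDM
      (isDiagonalizable_of_inner hM7 hnil (fun x y => Subtype.ext (hD x y))
        (hss.restrict fun x _ => hDM x) fun δ hδ hδτ => ?_)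
    have hwM : ∀ x : M, D x = ⁅w, (x : g)⁆ := fun x => hw x ((hMα _).mp x.2)
    obtain ⟨a, y, h⟩ := exists_eq_lie_of_commute_of_rigid hrig (α := (α w)⁻¹ • α) (T := w) (M := M)
      (fun x y => by rw [LinearMap.smul_apply, hα, smul_zero])
      (by rw [LinearMap.smul_apply, smul_eq_mul, inv_mul_cancel₀ hαw])
      (fun x => by rw [hMα, LinearMap.smul_apply, smul_eq_zero_iff_right (inv_ne_zero hαw)])
      hδ (fun x => by
        have h1 : ⁅w, x⁆ = (⟨D x, hDM x⟩ : M) := Subtype.ext (hwM x).symm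
        rw [h1, ← hwM]
        exact congrArg Subtype.val (hδτ x))
    refine ⟨a, y, fun x => Subtype.ext ?_⟩
    rw [h x, ← hwM]
    rfl

end RigidLie

theorem mainTheorem4 {g : Type*} [LieRing g] [LieAlgebra ℝ g]
    (hdim : Module.finrank ℝ g = 8)
    (hsolv : LieAlgebra.IsSolvable g)
    (hrigid : RigidLie.IsAlgebraicallyRigid ℝ g)
    (t : LieSubalgebra ℝ (LieDerivation ℝ g g))
    (ht : RigidLie.IsExteriorTorus t)
    (hnd : ∃ f ∈ t, ¬ RigidLie.IsDiagonalizable (f : g →ₗ[ℝ] g)) :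
    Module.finrank ℝ (RigidLie.nilradical ℝ g) ≤ 6 ∧ RigidLie.rank ℝ g ≠ 1 := by
  have hfd : FiniteDimensional ℝ g := FiniteDimensional.of_finrank_pos (by omega)
  obtain ⟨D, hDt, hDnd⟩ := hnd
  have hss := ht.2 D hDt
  obtain ⟨M, hM, hlie, hnil⟩ := RigidLie.exists_ideal_mem_iff_isNilpotent_ad (g := g)
  have hle : Module.finrank ℝ M ≤ Module.finrank ℝ g := Submodule.finrank_le M.toSubmodule
  have h8 : Module.finrank ℝ M ≠ 8 := fun h => by
    have hMtop : M.toSubmodule = ⊤ :=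
      Submodule.eq_top_of_finrank_eq (show Module.finrank ℝ M = _ by rw [h, hdim])
    refine RigidLie.not_rigid_of_isNilpotent hrigid
      ((LieAlgebra.isNilpotent_iff_forall (R := ℝ)).mpr fun x => (hM x).mp ?_) (by omega)
    exact (hMtop ▸ Submodule.mem_top : x ∈ M.toSubmodule)
  have h7 : Module.finrank ℝ M ≠ 7 := fun h => hDnd
    (RigidLie.isDiagonalizable_of_rigid hrigid hdim hM hlie hnil h
      (RigidLie.isDer_lieDerivation D) hss)
  have h6 : Module.finrank ℝ M ≤ 6 := by omega
  refine ⟨(Submodule.finrank_mono (RigidLie.nilradical_le hM :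
    -- Rank one would make M of codimension at most one, that is, of dimension at least 7.
    (RigidLie.nilradical ℝ g).toSubmodule ≤ M.toSubmodule)).trans h6, fun hr => ?_⟩
  have hD0 : D ≠ 0 := by
    rintro rfl
    refine hDnd (eq_top_iff.mpr fun x _ => Submodule.mem_iSup_of_mem 0 ?_)
    rw [Module.End.mem_eigenspace_iff, zero_smul]
    rfl
  have := RigidLie.finrank_le_finrank_add_one_of_rank_le_one hr.le hss hD0 hM
  omega
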